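/- Let $X$ be a compact complex manifold of dimension $n\ge 1$ with complex structure $J$, and let $g$ be a balanced hermitian metric on $X$: its fundamental form $\omega(V,W)=g(JV,W)$ satisfies $d(\omega^{n-1})=0$. Let $E$ be a smooth complex vector bundle of finite rank over $X$ with a smooth hermitian metric $h$, let $\operatorname{End}(E,h)$ be the bundle of skew-hermitian endomorphisms of $(E,h)$, let $\mathcal A$ be the space of unitary connections on $(E,h)$, an affine space modelled on $\Omega^1(\operatorname{End}(E,h))$, and let $\mathcal G$ be the unitary gauge group, i.e. the group of smooth unitary automorphisms of $(E,h)$ covering the identity of $X$. It acts on $\mathcal A$ by $u\cdot d_A=u\,d_A\,u^{-1}$, and $\operatorname{Lie}\mathcal G\cong\Omega^0(\operatorname{End}(E,h))$, the one-parameter subgroup with velocity $\zeta$ being $\gamma_\zeta(t)=e^{t\zeta}$. For $\operatorname{End}(E)$-valued two-forms, let $\Lambda_\omega$ denote the contraction with the bivector dual to $\omega$, normalized so that $\Lambda_\omega\omega=n$. For $A\in\mathcal A$ let $F_A=d_A\circ d_A$ be the curvature. Let $\lambda$ be any real constant. Then the formula $$\omega_{\mathcal A}(a,b)=-\int_X\operatorname{tr}(a\wedge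 b)\wedge\omega^{n-1},\qquad a,b\in T_A\mathcal A=\Omega^1(\operatorname{End}(E,h)),$$ takes real values and defines a (constant, weakly nondegenerate) symplectic form on $\mathcal A$. The group $\mathcal G$ acts on $\mathcal A$ by affine maps, the derivative of $u\in\mathcal G$ being $a\mapsto uau^{-1}$, and it preserves $\omega_{\mathcal A}$. This action is Hamiltonian with equivariant moment map $\mu\colon\mathcal A\to(\operatorname{Lie}\mathcal G)^*$ given by $$\langle\mu(A),\zeta\rangle=-\int_X\operatorname{tr}\bigl(\zeta\,(\Lambda_\omega F_A+i\lambda\,\mathrm{Id})\bigr)\frac{\omega^n}{n},\qquad \zeta\in\Omega^0(\operatorname{End}(E,h)).$$ That is: these integrals are real; for every $A$ the functional $\mu(A)$ is linear and continuous in $\zeta$ (for the $C^0$-topology); for all $A\in\mathcal A$, $\zeta\in\operatorname{Lie}\mathcal G$ and $a\in\Omega^1(\operatorname{End}(E,h))$, $$\frac{d}{dt}\Big|_{t=0}\langle\mu(A+ta),\zeta\rangle=\omega_{\mathcal A}(Y_\zeta(A),a),$$ where $Y_\zeta(A)=\frac{d}{dt}\big|_{t=0}\,\gamma_\zeta(t)\cdot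 A\in\Omega^1(\operatorname{End}(E,h))$ is the infinitesimal action of $\zeta$; and for all $u\in\mathcal G$, $$\langle\mu(u\cdot A),u\zeta u^{-1}\rangle=\langle\mu(A),\zeta\rangle .$$ -/

import Mathlib

open Bundle
open scoped Manifold ContDiff

set_option linter.unusedSectionVars false

namespace GaugeTheory

noncomputable section

/-- The model with corners for complex manifolds of dimension `n`. -/
abbrev ComplexModel (n : ℕ) : ModelWithCorners ℂ (Fin n → ℂ) (Fin n → ℂ) := 𝓘(ℂ, Fin n → ℂ)

/-- The real model underlying `ComplexModel n`: `ℂⁿ` as a real vector space. -/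
abbrev RealModel (n : ℕ) : ModelWithCorners ℝ (Fin n → ℂ) (Fin n → ℂ) := 𝓘(ℝ, Fin n → ℂ)

/-- A complex manifold is a smooth real manifold. -/
instance realManifold (n : ℕ) (X : Type*) [TopologicalSpace X] [ChartedSpace (Fin n → ℂ) X]
    [h : IsManifold (ComplexModel n) ω X] : IsManifold (RealModel n) ∞ X := by
  refine isManifold_of_contDiffOn _ _ _ fun e e' he he' => ?_
  have := (h.compatible he he')
  rw [contDiffGroupoid, mem_groupoid_of_pregroupoid] at this
  have h1 := this.1
  simp only [contDiffPregroupoid, modelWithCornersSelf_coe, modelWithCornersSelf_coe_symm] at h1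
  have h2 := ContDiffOn.restrict_scalars ℝ h1
  exact h2.of_le (by simp)

section Forms

/-- The wedge product (sum over shuffles, so that `(a ∧ b)(v, w) = a v * b w - a w * b v` for
one-forms). -/
def wedge {n p q : ℕ} (α : (Fin n → ℂ) [⋀^Fin p]→L[ℝ] ℂ) (β : (Fin n → ℂ) [⋀^Fin q]→L[ℝ] ℂ) :
    (Fin n → ℂ) [⋀^Fin (p + q)]→L[ℝ] ℂ :=
  { ((LinearMap.mul' ℝ ℂ).compAlternatingMap
      (α.toAlternatingMap.domCoprod β.toAlternatingMap)).domDomCongr finSumFinEquiv with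
    cont := by
      change Continuous fun v : Fin (p + q) → Fin n → ℂ =>
        LinearMap.mul' ℝ ℂ ((∑ σ, AlternatingMap.domCoprod.summand α.toAlternatingMap
          β.toAlternatingMap σ) fun i => v (finSumFinEquiv i))
      simp only [sum_apply, map_sum]
      refine continuous_finsetSum _ fun σ _ => ?_
      induction σ using Quotient.inductionOn' with
      | h σ =>
        simp only [AlternatingMap.domCoprod.summand_mk'', smul_apply,
          MultilinearMap.domDomCongr_apply, MultilinearMap.domCoprod_apply]
        simp only [Units.smul_def, map_zsmul, LinearMap.mul'_apply]
        refine continuous_const.smul (Continuous.mul ?_ ?_)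
        · exact α.cont.comp (by fun_prop)
        · exact β.cont.comp (by fun_prop) }

/-- The power `α ∧ ... ∧ α` (`k` factors) of a two-form. -/
def wedgePow {n : ℕ} (α : (Fin n → ℂ) [⋀^Fin 2]→L[ℝ] ℂ) :
    (k : ℕ) → (Fin n → ℂ) [⋀^Fin (2 * k)]→L[ℝ] ℂ
  | 0 => ContinuousAlternatingMap.constOfIsEmpty ℝ (Fin n → ℂ) (Fin 0) 1
  | k + 1 => wedge (wedgePow α k) α


theorem continuous_bilinear {n : ℕ} (B : (Fin n → ℂ) →ₗ[ℝ] (Fin n → ℂ) →ₗ[ℝ] ℂ) :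
    Continuous fun p : (Fin n → ℂ) × (Fin n → ℂ) => B p.1 p.2 := by
  exact ((LinearMap.toContinuousLinearMap (LinearMap.toContinuousLinearMap.toLinearMap ∘ₗ B) :
    (Fin n → ℂ) →L[ℝ] (Fin n → ℂ) →L[ℝ] ℂ).isBoundedBilinearMap).continuous

/-- The two-form `(v, w) ↦ B v w` of an alternating bilinear map. -/
def twoForm {n : ℕ} (B : (Fin n → ℂ) →ₗ[ℝ] (Fin n → ℂ) →ₗ[ℝ] ℂ) (hB : ∀ v, B v v = 0) :
    (Fin n → ℂ) [⋀^Fin 2]→L[ℝ] ℂ where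
  toFun v := B (v 0) (v 1)
  map_update_add' m i x y := by
    fin_cases i <;> simp [Function.update]
  map_update_smul' m i c x := by
    fin_cases i <;> simp [Function.update]
  map_eq_zero_of_eq' v i j h hij := by
    fin_cases i <;> fin_cases j <;> simp_all
  cont := (continuous_bilinear B).comp
    (f := fun v : Fin 2 → Fin n → ℂ => (v 0, v 1)) (by fun_prop)

/-- Complex-valued `k`-forms on the underlying real manifold. The tangent space at `x` is `ℂⁿ`,
identified through the preferred chart at `x`. -/
abbrev DForm (n : ℕ) (X : Type*) (k : ℕ) := X → (Fin n → ℂ) [⋀^Fin k]→L[ℝ] ℂ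

variable {n : ℕ} {X : Type*} [TopologicalSpace X] [ChartedSpace (Fin n → ℂ) X]

/-- The form `α` written in the chart centred at `c`, i.e. its pull-back by the inverse chart. -/
def chartForm {k : ℕ} (c : X) (α : DForm n X k) (y : Fin n → ℂ) : (Fin n → ℂ) [⋀^Fin k]→L[ℝ] ℂ :=
  (α ((chartAt (Fin n → ℂ) c).symm y)).compContinuousLinearMap
    (mfderiv (RealModel n) (RealModel n) (chartAt (Fin n → ℂ) c).symm y :
      (Fin n → ℂ) →L[ℝ] (Fin n → ℂ))

/-- `dα = 0`, checked in the charts. -/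
def IsClosedForm {k : ℕ} (α : DForm n X k) : Prop :=
  ∀ c : X, ∀ y ∈ (chartAt (Fin n → ℂ) c).target, extDeriv (chartForm c α) y = 0

/-- The real basis `e₁, i e₁, e₂, i e₂, ...` of `ℂⁿ`, positively oriented for the complex
orientation. -/
def realFrame (n : ℕ) (j : Fin (2 * n)) : Fin n → ℂ :=
  Pi.single ⟨j / 2, by omega⟩ (if (j : ℕ) % 2 = 0 then 1 else Complex.I)

/-- A smooth partition of unity subordinate to the charts. -/
def chartPartition (n : ℕ) (X : Type*) [TopologicalSpace X] [ChartedSpace (Fin n → ℂ) X]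
    [IsManifold (RealModel n) ∞ X] [T2Space X] [CompactSpace X] :
    SmoothPartitionOfUnity X (RealModel n) X Set.univ :=
  Classical.choose (SmoothPartitionOfUnity.exists_isSubordinate_chartAt_source (RealModel n) X)

/-- The integral of a form of top degree `k = 2n` over the compact complex manifold `X` with its
complex orientation: cut off by a partition of unity, integrate over the coordinate domains. In
the real coordinates `z_j = x_j + i y_j` the oriented volume form is `dx₁ ∧ dy₁ ∧ dx₂ ∧ ...`, and
Lebesgue measure on `ℂⁿ` is `volume`. -/
def formIntegral [IsManifold (RealModel n) ∞ X] [T2Space X] [CompactSpace X] {k : ℕ}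
    (hk : k = 2 * n) (α : DForm n X k) : ℂ :=
  ∑ᶠ c : X, ∫ y in (chartAt (Fin n → ℂ) c).target,
    (chartPartition n X c ((chartAt (Fin n → ℂ) c).symm y) : ℂ) *
      chartForm c α y fun i => realFrame n (i.cast hk)

/-- The complex structure `J` on the tangent spaces: multiplication by `i`. -/
def complexStructure (x : X) :
    TangentSpace (RealModel n) x →ₗ[ℝ] TangentSpace (RealModel n) x :=
  (Complex.I • (LinearMap.id : (Fin n → ℂ) →ₗ[ℂ] (Fin n → ℂ))).restrictScalars ℝ

variable (n X) in
/-- A hermitian metric: a smooth Riemannian metric with `g(Jv, Jw) = g(v, w)`. -/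
structure HermitianMetric [IsManifold (RealModel n) ∞ X] extends
    Bundle.ContMDiffRiemannianMetric (RealModel n) ∞ (Fin n → ℂ)
      (fun x : X => TangentSpace (RealModel n) x) where
  hermitian : ∀ (x : X) (v w : TangentSpace (RealModel n) x),
    inner x (complexStructure x v) (complexStructure x w) = inner x v w

theorem complexStructure_sq (x : X) (v : TangentSpace (RealModel n) x) :
    complexStructure x (complexStructure x v) = -v := by
  have h : ∀ w : Fin n → ℂ, Complex.I • Complex.I • w = -w := fun w => by
    rw [smul_smul, Complex.I_mul_I, neg_one_smul]
  exact h v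

variable [IsManifold (RealModel n) ∞ X]

theorem HermitianMetric.inner_complexStructure_self (g : HermitianMetric n X) (x : X)
    (v : TangentSpace (RealModel n) x) : g.inner x (complexStructure x v) v = 0 := by
  have h := g.hermitian x (complexStructure x v) v
  rw [complexStructure_sq, map_neg, neg_apply, g.symm] at h
  linarith

/-- `(v, w) ↦ g(Jv, w)`. -/
def HermitianMetric.kahlerBilin (g : HermitianMetric n X) (x : X) :
    TangentSpace (RealModel n) x →ₗ[ℝ] TangentSpace (RealModel n) x →ₗ[ℝ] ℝ :=
  LinearMap.mk₂ ℝ (fun v w => g.inner x (complexStructure x v) w)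
    (by simp) (by simp) (by simp) (by simp)

/-- The fundamental two-form `ω(v, w) = g(Jv, w)`. -/
def HermitianMetric.kahlerForm (g : HermitianMetric n X) : DForm n X 2 := fun x =>
  twoForm ((g.kahlerBilin x).compr₂ (Complex.ofRealCLM : ℝ →ₗ[ℝ] ℂ)) fun v => by
    have h : g.kahlerBilin x v v = 0 := g.inner_complexStructure_self x v
    change ((g.kahlerBilin x v v : ℝ) : ℂ) = 0
    rw [h, Complex.ofReal_zero]

/-- The metric is balanced: `d(ω^(n-1)) = 0`. -/
def HermitianMetric.IsBalanced (g : HermitianMetric n X) : Prop :=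
  IsClosedForm fun x => wedgePow (g.kahlerForm x) (n - 1)

/-- The matrix of `ω` in the real basis `realFrame n` of the tangent space. -/
def HermitianMetric.kahlerMatrix (g : HermitianMetric n X) (x : X) :
    Matrix (Fin (2 * n)) (Fin (2 * n)) ℝ :=
  Matrix.of fun i j => g.kahlerBilin x (realFrame n i) (realFrame n j)

/-- The contraction `Λ_ω ψ` of a two-form with values in `M` with the bivector dual to `ω`:
`½ Σ (W⁻¹)_{ji} ψ(b_i, b_j)` with `W_{ij} = ω(b_i, b_j)`, so that `Λ_ω ω = n`. -/
def HermitianMetric.contract (g : HermitianMetric n X) {M : Type*} [AddCommGroup M] [Module ℝ M]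
    (x : X) (ψ : TangentSpace (RealModel n) x → TangentSpace (RealModel n) x → M) : M :=
  (1 / 2 : ℝ) • ∑ i, ∑ j, (g.kahlerMatrix x)⁻¹ j i • ψ (realFrame n i) (realFrame n j)

end Forms

section Tensorial

variable {n : ℕ} {X : Type*} [TopologicalSpace X] [ChartedSpace (Fin n → ℂ) X]
  [IsManifold (RealModel n) ∞ X] [T2Space X]
  {G : Type*} [NormedAddCommGroup G] [NormedSpace ℝ G] [FiniteDimensional ℝ G]
  {W : X → Type*} [TopologicalSpace (TotalSpace G W)] [∀ x, AddCommGroup (W x)]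
  [∀ x, Module ℝ (W x)] [∀ x, TopologicalSpace (W x)] [∀ x, IsTopologicalAddGroup (W x)]
  [∀ x, ContinuousSMul ℝ (W x)] [FiberBundle G W] [VectorBundle ℝ G W]
  [ContMDiffVectorBundle ∞ G W (RealModel n)]

/-- The product of a smooth function and a smooth section. -/
def functionSmul (f : X → ℝ) (hf : ContMDiff (RealModel n) 𝓘(ℝ, ℝ) ∞ f)
    (s : Cₛ^∞⟮RealModel n; G, W⟯) : Cₛ^∞⟮RealModel n; G, W⟯ :=
  ⟨fun x => f x • s x, ContMDiff.smul_section hf s.contMDiff⟩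

theorem exists_bump (x : X) : ∃ χ : X → ℝ, ContMDiff (RealModel n) 𝓘(ℝ, ℝ) ∞ χ ∧
    tsupport χ ⊆ (trivializationAt G W x).baseSet ∧ χ x = 1 := by
  obtain ⟨χ, -, hχ⟩ := (SmoothBumpFunction.nhds_basis_tsupport (I := RealModel n) x).mem_iff.1
    ((trivializationAt G W x).open_baseSet.mem_nhds
      (FiberBundle.mem_baseSet_trivializationAt G W x))
  exact ⟨χ, χ.contMDiff, hχ, χ.eq_one⟩

theorem exists_section_eq (x : X) (w : W x) : ∃ s : Cₛ^∞⟮RealModel n; G, W⟯, s x = w := by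
  obtain ⟨χ, hχ, hsupp, hx⟩ := exists_bump (n := n) (G := G) (W := W) x
  set e := trivializationAt G W x
  have hmem : x ∈ e.baseSet := FiberBundle.mem_baseSet_trivializationAt G W x
  let b := Module.finBasis ℝ G
  have hsm : ContMDiffOn (RealModel n) ((RealModel n).prod 𝓘(ℝ, G)) ∞
      (fun y => TotalSpace.mk' G y (∑ i, e.localFrameCoeff (RealModel n) b i x w •
        e.localFrame b i y)) e.baseSet :=
    ContMDiffOn.sum_section fun i _ =>
      ContMDiffOn.const_smul_section (e.contMDiffOn_localFrame_baseSet (I := RealModel n) ∞ b i)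
  refine ⟨⟨_, ContMDiffOn.smul_section_of_tsupport (hχ.contMDiffOn) e.open_baseSet hsupp hsm⟩, ?_⟩
  classical
  change χ x • (∑ i, e.localFrameCoeff (RealModel n) b i x w • e.localFrame b i x) = w
  have h := e.eq_sum_localFrameCoeff_smul (I := RealModel n) (b := b)
    (s := Function.update 0 x w) hmem
  rw [Function.update_self] at h
  rw [← h, hx, one_smul]

theorem eq_zero_of_tensorial {A : Type*} [AddCommGroup A] [Module ℝ A] (x : X)
    (φ : Cₛ^∞⟮RealModel n; G, W⟯ →+ A)
    (hφ : ∀ f hf s, φ (functionSmul f hf s) = f x • φ s)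
    {s : Cₛ^∞⟮RealModel n; G, W⟯} (hs : s x = 0) : φ s = 0 := by
  obtain ⟨χ, hχ, hsupp, hx⟩ := exists_bump (n := n) (G := G) (W := W) x
  set e := trivializationAt G W x
  have hmem : x ∈ e.baseSet := FiberBundle.mem_baseSet_trivializationAt G W x
  let b := Module.finBasis ℝ G
  let fr (i) : Cₛ^∞⟮RealModel n; G, W⟯ :=
    ⟨_, ContMDiffOn.smul_section_of_tsupport hχ.contMDiffOn e.open_baseSet hsupp
      (e.contMDiffOn_localFrame_baseSet (I := RealModel n) ∞ b i)⟩
  let co (i) (y : X) : ℝ := χ y * e.localFrameCoeff (RealModel n) b i y (s y)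
  have hco (i) : ContMDiff (RealModel n) 𝓘(ℝ, ℝ) ∞ (co i) := by
    refine contMDiff_of_tsupport fun y hy => ?_
    have hy' : y ∈ e.baseSet := hsupp (closure_mono (by
      intro z hz
      simp only [co, Function.mem_support] at hz ⊢
      exact left_ne_zero_of_mul hz) hy)
    exact (hχ y).mul (contMDiffAt_localFrameCoeff (I := RealModel n) b hy' (s.contMDiff y) i)
  have key : functionSmul (fun y => χ y * χ y) (hχ.mul hχ) s =
      ∑ i, functionSmul (co i) (hco i) (fr i) := by
    ext y
    have h1 : (∑ i, functionSmul (co i) (hco i) (fr i)) y = ∑ i, co i y • χ y • e.localFrame b i y := by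
      have h0 : ∀ t : Cₛ^∞⟮RealModel n; G, W⟯, t y = ContMDiffSection.coeAddHom (RealModel n) G ∞ W t y :=
        fun _ => rfl
      rw [h0, map_sum, Finset.sum_apply]
      rfl
    rw [h1]
    change (χ y * χ y) • s y = _
    by_cases hy : y ∈ e.baseSet
    · conv_lhs => rw [e.eq_sum_localFrameCoeff_smul (I := RealModel n) (b := b) (s := s) hy]
      rw [Finset.smul_sum]
      refine Finset.sum_congr rfl fun i _ => ?_
      simp only [co, smul_smul]
      congr 1
      ring
    · have h0 : χ y = 0 := by
        by_contra h
        exact hy (hsupp (subset_tsupport _ h))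
      simp [h0]
  have h2 := congrArg φ key
  rw [hφ, map_sum, hx] at h2
  simp only [mul_one, one_smul] at h2
  rw [h2]
  refine Finset.sum_eq_zero fun i _ => ?_
  rw [hφ]
  simp [co, hs]

end Tensorial

section LieDerivative

variable {n : ℕ} {X : Type*} [TopologicalSpace X] [ChartedSpace (Fin n → ℂ) X]
  [IsManifold (RealModel n) ∞ X]

theorem contMDiff_mvfderiv_apply {f : X → ℝ} (hf : ContMDiff (RealModel n) 𝓘(ℝ, ℝ) ∞ f)
    (V : Cₛ^∞⟮RealModel n; Fin n → ℂ, (TangentSpace (RealModel n) : X → Type _)⟯) :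
    ContMDiff (RealModel n) 𝓘(ℝ, ℝ) ∞ fun x => mvfderiv (RealModel n) f x (V x) := by
  have h := (hf.contMDiff_tangentMap (m := ∞) (by simp)).comp V.contMDiff
  exact (contMDiff_snd_tangentBundle_modelSpace ℝ 𝓘(ℝ, ℝ)).comp h

/-- `[U, V] f = U (V f) - V (U f)`. -/
theorem mvfderiv_mlieBracket [T2Space X] {f : X → ℝ} (hf : ContMDiff (RealModel n) 𝓘(ℝ, ℝ) ∞ f)
    (U V : Cₛ^∞⟮RealModel n; Fin n → ℂ, (TangentSpace (RealModel n) : X → Type _)⟯) (x : X) :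
    mvfderiv (RealModel n) f x (VectorField.mlieBracket (RealModel n) U V x) =
      mvfderiv (RealModel n) (fun y => mvfderiv (RealModel n) f y (V y)) x (U x) -
        mvfderiv (RealModel n) (fun y => mvfderiv (RealModel n) f y (U y)) x (V x) := by
  rcases subsingleton_or_nontrivial (Fin n → ℂ) with hn | hn
  · have h : ∀ v : TangentSpace (RealModel n) x, v = 0 := fun v => hn.elim v 0
    rw [h (U x), h (V x), h (VectorField.mlieBracket (RealModel n) U V x)]
    simp
  have hn' : Nontrivial (TangentSpace (RealModel n) x) := hn
  obtain ⟨w, hw⟩ := exists_ne (0 : TangentSpace (RealModel n) x)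
  obtain ⟨W, rfl⟩ := exists_section_eq (n := n) (G := Fin n → ℂ) x w
  have i3 : IsManifold (RealModel n) (minSmoothness ℝ 3) X := by
    rw [minSmoothness_of_isRCLikeNormedField]
    infer_instance
  have l2 : (2 : WithTop ℕ∞) ≤ ∞ := WithTop.coe_le_coe.2 (le_top : (2 : ℕ∞) ≤ ⊤)
  have i4 : IsManifold (RealModel n) (((2 : ℕ∞) : WithTop ℕ∞) + 1) X :=
    IsManifold.of_le (n := ∞) (by exact_mod_cast (le_top : (2 + 1 : ℕ∞) ≤ ⊤))
  have md : ∀ (T : Cₛ^∞⟮RealModel n; Fin n → ℂ, (TangentSpace (RealModel n) : X → Type _)⟯) y,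
      MDifferentiableAt (RealModel n) ((RealModel n).prod 𝓘(ℝ, Fin n → ℂ))
        (fun x => TotalSpace.mk' (Fin n → ℂ) x (T x)) y := fun T y => T.mdifferentiableAt
  have c2 : ∀ (T : Cₛ^∞⟮RealModel n; Fin n → ℂ, (TangentSpace (RealModel n) : X → Type _)⟯),
      ContMDiffAt (RealModel n) ((RealModel n).prod 𝓘(ℝ, Fin n → ℂ)) (minSmoothness ℝ 2)
        (fun x => TotalSpace.mk' (Fin n → ℂ) x (T x)) x := fun T => by
    rw [minSmoothness_of_isRCLikeNormedField]
    exact (T.contMDiff x).of_le l2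
  have br : ∀ (T S : Cₛ^∞⟮RealModel n; Fin n → ℂ, (TangentSpace (RealModel n) : X → Type _)⟯),
      MDifferentiableAt (RealModel n) ((RealModel n).prod 𝓘(ℝ, Fin n → ℂ))
        (fun x => TotalSpace.mk' (Fin n → ℂ) x (VectorField.mlieBracket (RealModel n) T S x)) x := fun T S => by
    refine ContMDiffAt.mdifferentiableAt (n := 1) ?_ one_ne_zero
    refine ContMDiffAt.mlieBracket_vectorField (m := 1) (n := 2) 
      ((T.contMDiff x).of_le l2)
      ((S.contMDiff x).of_le l2) ?_
    rw [minSmoothness_of_isRCLikeNormedField]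
    norm_num
  have fd : ∀ y, MDifferentiableAt (RealModel n) 𝓘(ℝ, ℝ) f y := fun y => hf.mdifferentiableAt (by simp)
  have Ud : MDifferentiableAt (RealModel n) 𝓘(ℝ, ℝ) (fun y => mvfderiv (RealModel n) f y (U y)) x :=
    (contMDiff_mvfderiv_apply hf U).mdifferentiableAt (by simp)
  have Vd : MDifferentiableAt (RealModel n) 𝓘(ℝ, ℝ) (fun y => mvfderiv (RealModel n) f y (V y)) x :=
    (contMDiff_mvfderiv_apply hf V).mdifferentiableAt (by simp)
  have J1 := VectorField.leibniz_identity_mlieBracket_apply (c2 U) (c2 V)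
    (c2 (functionSmul f hf W))
  have J2 := VectorField.leibniz_identity_mlieBracket_apply (c2 U) (c2 V) (c2 W)
  have e : (functionSmul f hf W : ∀ y, TangentSpace (RealModel n) y) = f • ⇑W := rfl
  have s1 : ∀ T : Cₛ^∞⟮RealModel n; Fin n → ℂ, (TangentSpace (RealModel n) : X → Type _)⟯,
      VectorField.mlieBracket (RealModel n) T (f • ⇑W) =
      (fun y => mvfderiv (RealModel n) f y (T y)) • ⇑W +
        f • VectorField.mlieBracket (RealModel n) T W := fun T => by
    funext y
    exact VectorField.mlieBracket_smul_right (fd y) (md W y)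
  rw [e, s1 U, s1 V, VectorField.mlieBracket_add_right ((Vd.smul_section (md W x)))
    ((fd x).smul_section (br V W)), VectorField.mlieBracket_add_right ((Ud.smul_section (md W x)))
    ((fd x).smul_section (br U W)), VectorField.mlieBracket_smul_right Vd (md W x),
    VectorField.mlieBracket_smul_right Ud (md W x),
    VectorField.mlieBracket_smul_right (fd x) (br V W),
    VectorField.mlieBracket_smul_right (fd x) (br U W),
    VectorField.mlieBracket_smul_right (fd x) (md W x), J2] at J1
  have key : (mvfderiv (RealModel n) f x (VectorField.mlieBracket (RealModel n) U V x) -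
      (mvfderiv (RealModel n) (fun y => mvfderiv (RealModel n) f y (V y)) x (U x) -
        mvfderiv (RealModel n) (fun y => mvfderiv (RealModel n) f y (U y)) x (V x))) • W x = 0 := by
    rw [← sub_eq_zero] at J1
    rw [← neg_eq_zero, ← J1]
    module
  exact sub_eq_zero.1 ((smul_eq_zero.1 key).resolve_right hw)

end LieDerivative


section Hermitian

variable {H : Type*} [NormedAddCommGroup H] [InnerProductSpace ℂ H]

/-- Skew-hermitian endomorphisms of a hermitian vector space. -/
def IsSkewHermitian (T : H →ₗ[ℂ] H) : Prop := ∀ e f : H, inner ℂ (T e) f = -inner ℂ e (T f)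

theorem IsSkewHermitian.add {S T : H →ₗ[ℂ] H} (hS : IsSkewHermitian S) (hT : IsSkewHermitian T) :
    IsSkewHermitian (S + T) := fun e f => by
  rw [LinearMap.add_apply, LinearMap.add_apply, inner_add_left, inner_add_right, hS, hT, neg_add]

theorem IsSkewHermitian.real_smul {T : H →ₗ[ℂ] H} (hT : IsSkewHermitian T) (r : ℝ) :
    IsSkewHermitian (r • T) := fun e f => by
  simp only [LinearMap.smul_apply, ← Complex.coe_smul r, inner_smul_left, inner_smul_right, hT e f,
    Complex.conj_ofReal, mul_neg]

theorem IsSkewHermitian.conj {T : H →ₗ[ℂ] H} (hT : IsSkewHermitian T) (U : H ≃ₗᵢ[ℂ] H) :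
    IsSkewHermitian (U.toLinearEquiv.conj T) := fun e f => by
  have h := hT (U.symm e) (U.symm f)
  rw [← U.inner_map_map, ← U.inner_map_map (U.symm e), U.apply_symm_apply, U.apply_symm_apply] at h
  exact h

end Hermitian

section Bundles

variable (n : ℕ) {X : Type*} [TopologicalSpace X] [ChartedSpace (Fin n → ℂ) X]
  (F : Type*) [NormedAddCommGroup F] [NormedSpace ℂ F]
  (E : X → Type*) [TopologicalSpace (TotalSpace F E)] [∀ x, NormedAddCommGroup (E x)]
  [∀ x, InnerProductSpace ℂ (E x)] [FiberBundle F E]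

/-- Smooth sections of the vector bundle `E`. -/
abbrev SmoothSection := Cₛ^∞⟮RealModel n; F, E⟯

variable (X) in
/-- Smooth real vector fields. -/
abbrev SmoothVectorField [IsManifold (RealModel n) ∞ X] :=
  Cₛ^∞⟮RealModel n; Fin n → ℂ, (TangentSpace (RealModel n) : X → Type _)⟯

variable {E} in
/-- Smoothness of a section. -/
def IsSmooth (s : ∀ x, E x) : Prop :=
  ContMDiff (RealModel n) ((RealModel n).prod 𝓘(ℝ, F)) ∞ fun x => TotalSpace.mk' F x (s x)

variable [VectorBundle ℂ F E] [VectorBundle ℝ F E] 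

variable {n F E}

theorem IsSmooth.add {s t : ∀ x, E x} (hs : IsSmooth n F s) (ht : IsSmooth n F t) :
    IsSmooth n F fun x => s x + t x :=
  ContMDiff.add_section hs ht

theorem IsSmooth.const_smul {s : ∀ x, E x} (r : ℝ) (hs : IsSmooth n F s) :
    IsSmooth n F fun x => r • s x :=
  ContMDiff.const_smul_section hs

theorem IsSmooth.smul {f : X → ℂ} (hf : ContMDiff (RealModel n) 𝓘(ℝ, ℂ) ∞ f)
    {s : ∀ x, E x} (hs : IsSmooth n F s) : IsSmooth n F fun x => f x • s x := by
  intro x₀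
  have h := hs x₀
  rw [contMDiffAt_section] at h ⊢
  set e := trivializationAt F E x₀
  have h2 : ContMDiffAt (RealModel n) 𝓘(ℝ, F) ∞ (fun x => f x • (e ⟨x, s x⟩).2) x₀ := by
    have h3 : ContMDiffAt (RealModel n) 𝓘(ℝ, F →L[ℝ] F) ∞
        (fun x => ContinuousLinearMap.lsmul ℝ ℂ (E := F) (f x)) x₀ :=
      ((ContinuousLinearMap.lsmul ℝ ℂ (E := F)).contDiff.contMDiff.comp hf) x₀
    exact h3.clm_apply h
  refine h2.congr_of_eventuallyEq ?_
  filter_upwards [e.open_baseSet.mem_nhds (FiberBundle.mem_baseSet_trivializationAt F E x₀)]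
    with x hx
  exact (e.linear ℂ hx).map_smul (f x) (s x)


variable [IsManifold (RealModel n) ∞ X] [ContMDiffVectorBundle ∞ F E (RealModel n)]

variable (n F E) in
/-- The inner products of the fibres of `E` form a smooth hermitian metric. -/
def IsSmoothHermitian : Prop :=
  ∀ s t : SmoothSection n F E, ContMDiff (RealModel n) 𝓘(ℝ, ℂ) ∞ fun x => (inner ℂ (s x) (t x) : ℂ)

variable (n X F E) in
/-- A unitary connection `d_A` on the hermitian bundle `E`: a map from smooth sections to smooth
`E`-valued one-forms, additive, with `d_A(f s) = df ⊗ s + f d_A s` for smooth complex functions `f`,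
and `d(s, t) = (d_A s, t) + (s, d_A t)`. Here `toFun s x v` is the value of `d_A s` at `v ∈ T_x X`. -/
structure UnitaryConnection where
  toFun : SmoothSection n F E → ∀ x : X, TangentSpace (RealModel n) x →ₗ[ℝ] E x
  smooth : ∀ (s : SmoothSection n F E) (V : SmoothVectorField n X),
    IsSmooth n F fun x => toFun s x (V x)
  add : ∀ s t : SmoothSection n F E, toFun (s + t) = toFun s + toFun t
  leibniz : ∀ (f : X → ℂ) (hf : ContMDiff (RealModel n) 𝓘(ℝ, ℂ) ∞ f) (s : SmoothSection n F E)
    (x : X) (v : TangentSpace (RealModel n) x),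
    toFun ⟨fun y => f y • s y, IsSmooth.smul hf s.contMDiff⟩ x v =
      mvfderiv (RealModel n) f x v • s x + f x • toFun s x v
  metric : ∀ (s t : SmoothSection n F E) (x : X) (v : TangentSpace (RealModel n) x),
    mvfderiv (RealModel n) (fun y => inner ℂ (s y) (t y)) x v =
      inner ℂ (toFun s x v) (t x) + inner ℂ (s x) (toFun t x v)

variable (n X F E) in
/-- Smooth one-forms with values in the skew-hermitian endomorphisms of `E`. A family of
endomorphisms is smooth if it maps smooth sections to smooth sections. -/
def unitaryOneForms :
    Submodule ℝ (∀ x : X, TangentSpace (RealModel n) x →ₗ[ℝ] (E x →ₗ[ℂ] E x)) where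
  carrier := {a | (∀ x v, IsSkewHermitian (a x v)) ∧
    ∀ (V : SmoothVectorField n X) (s : SmoothSection n F E),
      IsSmooth n F fun x => a x (V x) (s x)}
  zero_mem' := ⟨by simp [IsSkewHermitian], fun _ _ => (0 : SmoothSection n F E).contMDiff⟩
  add_mem' := fun {a b} ha hb => ⟨fun x v => (ha.1 x v).add (hb.1 x v), fun V s => (ha.2 V s).add (hb.2 V s)⟩
  smul_mem' := fun r a ha => ⟨fun x v => (ha.1 x v).real_smul r, fun V s => (ha.2 V s).const_smul r⟩

variable (n X F E) in
/-- Smooth skew-hermitian endomorphisms of `E`, the Lie algebra of the gauge group. -/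
def gaugeLieAlgebra : Submodule ℝ (∀ x : X, E x →ₗ[ℂ] E x) where
  carrier := {ζ | (∀ x, IsSkewHermitian (ζ x)) ∧
    ∀ s : SmoothSection n F E, IsSmooth n F fun x => ζ x (s x)}
  zero_mem' := ⟨by simp [IsSkewHermitian], fun _ => (0 : SmoothSection n F E).contMDiff⟩
  add_mem' := fun {a b} ha hb => ⟨fun x => (ha.1 x).add (hb.1 x), fun s => (ha.2 s).add (hb.2 s)⟩
  smul_mem' := fun r a ha => ⟨fun x => (ha.1 x).real_smul r, fun s => (ha.2 s).const_smul r⟩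

variable (n X F E) in
/-- The gauge group: smooth unitary automorphisms of `E` covering the identity of `X`. -/
def unitaryGaugeGroup : Subgroup (∀ x : X, E x ≃ₗᵢ[ℂ] E x) where
  carrier := {g | (∀ s : SmoothSection n F E, IsSmooth n F fun x => g x (s x)) ∧
    ∀ s : SmoothSection n F E, IsSmooth n F fun x => (g x).symm (s x)}
  one_mem' := ⟨fun s => s.contMDiff, fun s => s.contMDiff⟩
  mul_mem' := fun ha hb => ⟨fun s => ha.1 ⟨_, hb.1 s⟩, fun s => hb.2 ⟨_, ha.2 s⟩⟩
  inv_mem' := fun ha => ⟨ha.2, ha.1⟩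


/-- The action of a gauge transformation on sections. -/
def gaugeAct (g : unitaryGaugeGroup n X F E) (s : SmoothSection n F E) :
    SmoothSection n F E :=
  ⟨fun x => g.1 x (s x), g.2.1 s⟩

/-- `a ↦ g a g⁻¹` on one-forms. -/
def adjointOneForm (g : unitaryGaugeGroup n X F E)
    (a : unitaryOneForms n X F E) : unitaryOneForms n X F E :=
  ⟨fun x => (LinearEquiv.conj (g.1 x).toLinearEquiv).toLinearMap.restrictScalars ℝ ∘ₗ a.1 x, 
    fun x v => (a.2.1 x v).conj (g.1 x),
    fun V s => g.2.1 ⟨_, a.2.2 V ⟨_, g.2.2 s⟩⟩⟩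

/-- The adjoint action `ζ ↦ g ζ g⁻¹` on the Lie algebra. -/
def adjoint (g : unitaryGaugeGroup n X F E)
    (ζ : gaugeLieAlgebra n X F E) : gaugeLieAlgebra n X F E :=
  ⟨fun x => (LinearEquiv.conj (g.1 x).toLinearEquiv) (ζ.1 x), 
    fun x => (ζ.2.1 x).conj (g.1 x),
    fun s => g.2.1 ⟨_, ζ.2.2 ⟨_, g.2.2 s⟩⟩⟩

namespace UnitaryConnection

theorem ext {A B : UnitaryConnection n X F E} (h : A.toFun = B.toFun) : A = B := by
  cases A; cases B; congr

/-- The affine structure: `a + d_A`. -/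
instance : VAdd (unitaryOneForms n X F E) (UnitaryConnection n X F E) where
  vadd a A :=
    { toFun := fun s x =>
        A.toFun s x + (LinearMap.applyₗ (R := ℂ) (s x)).restrictScalars ℝ ∘ₗ a.1 x
      smooth := fun s V => (A.smooth s V).add (a.2.2 V s)
      add := fun s t => by
        funext x
        ext v
        change A.toFun (s + t) x v + a.1 x v (s x + t x) =
          (A.toFun s x v + a.1 x v (s x)) + (A.toFun t x v + a.1 x v (t x))
        rw [A.add, map_add]
        exact add_add_add_comm _ _ _ _
      leibniz := fun f hf s x v => by
        change A.toFun _ x v + a.1 x v (f x • s x) =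
          mvfderiv (RealModel n) f x v • s x + f x • (A.toFun s x v + a.1 x v (s x))
        rw [A.leibniz f hf, map_smul, smul_add, add_assoc]
      metric := fun s t x v => by
        change _ = inner ℂ (A.toFun s x v + a.1 x v (s x)) (t x) +
          inner ℂ (s x) (A.toFun t x v + a.1 x v (t x))
        rw [A.metric, inner_add_left, inner_add_right, a.2.1 x v]
        abel }

/-- The gauge action `g · d_A = g ∘ d_A ∘ g⁻¹`. -/
instance : SMul (unitaryGaugeGroup n X F E) (UnitaryConnection n X F E) where
  smul g A :=
    { toFun := fun s x =>
        ((g.1 x).toLinearEquiv.toLinearMap.restrictScalars ℝ) ∘ₗ A.toFun (gaugeAct g⁻¹ s) x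
      smooth := fun s V => g.2.1 ⟨_, A.smooth _ V⟩
      add := fun s t => by
        have h : gaugeAct g⁻¹ (s + t) = gaugeAct g⁻¹ s + gaugeAct g⁻¹ t := by
          ext y
          exact map_add (g.1 y).symm (s y) (t y)
        funext x
        rw [h, A.add]
        exact LinearMap.comp_add _ _ _
      leibniz := fun f hf s x v => by
        have h : gaugeAct g⁻¹ (⟨fun y => f y • s y, IsSmooth.smul hf s.contMDiff⟩) =
            ⟨fun y => f y • gaugeAct g⁻¹ s y, IsSmooth.smul hf (gaugeAct g⁻¹ s).contMDiff⟩ := by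
          ext y
          exact map_smul (g.1 y).symm (f y) (s y)
        change g.1 x (A.toFun _ x v) = _ • s x + f x • g.1 x (A.toFun (gaugeAct g⁻¹ s) x v)
        rw [h, A.leibniz f hf, map_add, map_smul, map_smul]
        congr 2
        exact (g.1 x).apply_symm_apply (s x)
      metric := fun s t x v => by
        have h := A.metric (gaugeAct g⁻¹ s) (gaugeAct g⁻¹ t) x v
        have h1 : (fun y => (inner ℂ (gaugeAct g⁻¹ s y) (gaugeAct g⁻¹ t y) : ℂ)) =
            fun y => inner ℂ (s y) (t y) := by
          funext y
          exact (g.1 y).symm.inner_map_map (s y) (t y)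
        rw [h1, ← (g.1 x).inner_map_map, ← (g.1 x).inner_map_map (gaugeAct g⁻¹ s x)] at h
        have h2 (u : SmoothSection n F E) : g.1 x (gaugeAct g⁻¹ u x) = u x :=
          (g.1 x).apply_symm_apply (u x)
        rw [h2, h2] at h
        exact h }

instance : MulAction (unitaryGaugeGroup n X F E) (UnitaryConnection n X F E) where
  one_smul A := ext (by rfl)
  mul_smul g g' A := ext (by rfl)

/-- The covariant derivative `∇_V s = (d_A s)(V)`. -/
def covariant (A : UnitaryConnection n X F E) (V : SmoothVectorField n X) (s : SmoothSection n F E) :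
    SmoothSection n F E :=
  ⟨fun x => A.toFun s x (V x), A.smooth s V⟩

/-- `R` is the curvature two-form `F_A = d_A ∘ d_A` of `A`, i.e.
`R(V, W) s = ∇_V ∇_W s - ∇_W ∇_V s - ∇_[V,W] s`. -/
def IsCurvature (A : UnitaryConnection n X F E)
    (R : ∀ x : X, TangentSpace (RealModel n) x → TangentSpace (RealModel n) x → (E x →ₗ[ℂ] E x)) :
    Prop :=
  ∀ (V W : SmoothVectorField n X) (s : SmoothSection n F E) (x : X),
    R x (V x) (W x) (s x) = A.covariant V (A.covariant W s) x - A.covariant W (A.covariant V s) x -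
      A.toFun s x (VectorField.mlieBracket (RealModel n) V W x)

theorem toFun_functionSmul (A : UnitaryConnection n X F E) {f : X → ℝ}
    (hf : ContMDiff (RealModel n) 𝓘(ℝ, ℝ) ∞ f) (s : SmoothSection n F E) (x : X)
    (v : TangentSpace (RealModel n) x) :
    A.toFun (functionSmul f hf s) x v = mvfderiv (RealModel n) f x v • s x + f x • A.toFun s x v := by
  have hc : ContMDiff (RealModel n) 𝓘(ℝ, ℂ) ∞ fun y => (f y : ℂ) :=
    Complex.ofRealCLM.contDiff.contMDiff.comp hf
  have h := A.leibniz (fun y => (f y : ℂ)) hc s x v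
  have h1 : mvfderiv (RealModel n) (fun y => (f y : ℂ)) x v = (mvfderiv (RealModel n) f x v : ℂ) := by
    have h2 := mfderiv_comp_apply (I := RealModel n) (I' := 𝓘(ℝ, ℝ)) (I'' := 𝓘(ℝ, ℂ))
      (g := (Complex.ofRealCLM : ℝ → ℂ)) (f := f) x Complex.ofRealCLM.mdifferentiableAt
      (hf.mdifferentiableAt (by simp)) v
    rw [mfderiv_eq_fderiv, ContinuousLinearMap.fderiv] at h2
    exact h2
  rw [h1, Complex.coe_smul, Complex.coe_smul] at h
  exact h

theorem covariant_add_right (A : UnitaryConnection n X F E) (V : SmoothVectorField n X)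
    (s t : SmoothSection n F E) :
    A.covariant V (s + t) = A.covariant V s + A.covariant V t := by
  ext x
  change A.toFun (s + t) x (V x) = A.toFun s x (V x) + A.toFun t x (V x)
  rw [A.add]
  rfl

theorem covariant_add_left (A : UnitaryConnection n X F E) (V W : SmoothVectorField n X)
    (s : SmoothSection n F E) :
    A.covariant (V + W) s = A.covariant V s + A.covariant W s := by
  ext x
  exact map_add (A.toFun s x) (V x) (W x)

theorem covariant_functionSmul_left (A : UnitaryConnection n X F E) {f : X → ℝ}
    (hf : ContMDiff (RealModel n) 𝓘(ℝ, ℝ) ∞ f) (V : SmoothVectorField n X)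
    (s : SmoothSection n F E) :
    A.covariant (functionSmul f hf V) s = functionSmul f hf (A.covariant V s) := by
  ext x
  exact map_smul (A.toFun s x) (f x) (V x)

theorem covariant_functionSmul (A : UnitaryConnection n X F E) {f : X → ℝ}
    (hf : ContMDiff (RealModel n) 𝓘(ℝ, ℝ) ∞ f) (V : SmoothVectorField n X)
    (s : SmoothSection n F E) :
    A.covariant V (functionSmul f hf s) =
      functionSmul (fun y => mvfderiv (RealModel n) f y (V y)) (contMDiff_mvfderiv_apply hf V) s +
        functionSmul f hf (A.covariant V s) := by
  ext x
  exact A.toFun_functionSmul hf s x (V x)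

/-- The curvature operator `∇_V ∇_W s - ∇_W ∇_V s - ∇_[V,W] s`. -/
def curvatureOp (A : UnitaryConnection n X F E) (V W : SmoothVectorField n X)
    (s : SmoothSection n F E) (x : X) : E x :=
  A.covariant V (A.covariant W s) x - A.covariant W (A.covariant V s) x -
    A.toFun s x (VectorField.mlieBracket (RealModel n) V W x)

theorem curvatureOp_swap (A : UnitaryConnection n X F E) (V W : SmoothVectorField n X)
    (s : SmoothSection n F E) (x : X) : A.curvatureOp V W s x = -A.curvatureOp W V s x := by
  unfold curvatureOp
  rw [VectorField.mlieBracket_swap_apply, map_neg]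
  abel

theorem curvatureOp_add_right (A : UnitaryConnection n X F E) (V W : SmoothVectorField n X)
    (s t : SmoothSection n F E) (x : X) :
    A.curvatureOp V W (s + t) x = A.curvatureOp V W s x + A.curvatureOp V W t x := by
  unfold curvatureOp
  simp only [covariant_add_right, A.add, Pi.add_apply, LinearMap.add_apply]
  have h : ∀ a b : SmoothSection n F E, (a + b) x = a x + b x := fun _ _ => rfl
  rw [h, h]
  abel

theorem curvatureOp_const_smul (A : UnitaryConnection n X F E) (V W : SmoothVectorField n X)
    (c : ℂ) (s : SmoothSection n F E) (x : X) :
    A.curvatureOp V W ⟨fun y => c • s y, IsSmooth.smul contMDiff_const s.contMDiff⟩ x =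
      c • A.curvatureOp V W s x := by
  have h : ∀ (t : SmoothSection n F E) y v,
      A.toFun ⟨fun y => c • t y, IsSmooth.smul contMDiff_const t.contMDiff⟩ y v =
        c • A.toFun t y v := fun t y v => by
    rw [A.leibniz (fun _ => c) contMDiff_const t y v]
    simp [mvfderiv]
  have h1 : ∀ (U : SmoothVectorField n X) (t : SmoothSection n F E),
      A.covariant U ⟨fun y => c • t y, IsSmooth.smul contMDiff_const t.contMDiff⟩ =
        ⟨fun y => c • A.covariant U t y, IsSmooth.smul contMDiff_const
          (A.covariant U t).contMDiff⟩ := fun U t => by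
    ext y
    exact h t y (U y)
  unfold curvatureOp
  rw [h1, h1, h1, h1, h, smul_sub, smul_sub]
  rfl

variable [T2Space X]

theorem curvatureOp_functionSmul_right (A : UnitaryConnection n X F E)
    (V W : SmoothVectorField n X) {f : X → ℝ} (hf : ContMDiff (RealModel n) 𝓘(ℝ, ℝ) ∞ f)
    (s : SmoothSection n F E) (x : X) :
    A.curvatureOp V W (functionSmul f hf s) x = f x • A.curvatureOp V W s x := by
  have h : ∀ a b : SmoothSection n F E, (a + b) x = a x + b x := fun _ _ => rfl
  have h' : ∀ (f : X → ℝ) hf (a : SmoothSection n F E), functionSmul f hf a x = f x • a x :=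
    fun _ _ _ => rfl
  unfold curvatureOp
  simp only [covariant_functionSmul, covariant_add_right, h, h', toFun_functionSmul,
    mvfderiv_mlieBracket hf]
  module

theorem curvatureOp_add_left (A : UnitaryConnection n X F E)
    (V V' W : SmoothVectorField n X) (s : SmoothSection n F E) (x : X) :
    A.curvatureOp (V + V') W s x = A.curvatureOp V W s x + A.curvatureOp V' W s x := by
  have h : ∀ a b : SmoothSection n F E, (a + b) x = a x + b x := fun _ _ => rfl
  have hb : VectorField.mlieBracket (RealModel n) (V + V' : SmoothVectorField n X) W x =
      VectorField.mlieBracket (RealModel n) V W x +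
        VectorField.mlieBracket (RealModel n) V' W x :=
    VectorField.mlieBracket_add_left (V := V) (V₁ := V') V.mdifferentiableAt V'.mdifferentiableAt
  unfold curvatureOp
  simp only [covariant_add_left, covariant_add_right, h, hb, map_add]
  abel

theorem curvatureOp_functionSmul_left (A : UnitaryConnection n X F E)
    (V W : SmoothVectorField n X) {f : X → ℝ} (hf : ContMDiff (RealModel n) 𝓘(ℝ, ℝ) ∞ f)
    (s : SmoothSection n F E) (x : X) :
    A.curvatureOp (functionSmul f hf V) W s x = f x • A.curvatureOp V W s x := by
  have h : ∀ a b : SmoothSection n F E, (a + b) x = a x + b x := fun _ _ => rfl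
  have h' : ∀ (f : X → ℝ) hf (a : SmoothSection n F E), functionSmul f hf a x = f x • a x :=
    fun _ _ _ => rfl
  have hb : VectorField.mlieBracket (RealModel n) (functionSmul f hf V) W x =
      -mvfderiv (RealModel n) f x (W x) • V x +
        f x • VectorField.mlieBracket (RealModel n) V W x :=
    VectorField.mlieBracket_smul_left (V := V) (hf.mdifferentiableAt (by simp))
      V.mdifferentiableAt
  unfold curvatureOp
  simp only [covariant_functionSmul_left, covariant_functionSmul, h, h', hb, map_add, map_smul]
  have hV : A.toFun s x (V x) = A.covariant V s x := rfl
  rw [hV]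
  module

variable [FiniteDimensional ℂ F]

theorem curvatureOp_congr (A : UnitaryConnection n X F E)
    {V V' W W' : SmoothVectorField n X} {s s' : SmoothSection n F E} {x : X}
    (hV : V x = V' x) (hW : W x = W' x) (hs : s x = s' x) :
    A.curvatureOp V W s x = A.curvatureOp V' W' s' x := by
  have : FiniteDimensional ℝ F := FiniteDimensional.complexToReal F
  have left : ∀ {V V' W : SmoothVectorField n X} {s : SmoothSection n F E}, V x = V' x →
      A.curvatureOp V W s x = A.curvatureOp V' W s x := fun {V V' W s} h => by
    let φ : SmoothVectorField n X →+ E x := AddMonoidHom.mk' (fun U => A.curvatureOp U W s x)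
      fun U U' => A.curvatureOp_add_left U U' W s x
    have := eq_zero_of_tensorial x φ (fun f hf U => A.curvatureOp_functionSmul_left U W hf s x)
      (s := V - V') (sub_eq_zero.2 h)
    rw [map_sub, sub_eq_zero] at this
    exact this
  have right : A.curvatureOp V' W' s x = A.curvatureOp V' W' s' x := by
    let φ : SmoothSection n F E →+ E x := AddMonoidHom.mk' (fun t => A.curvatureOp V' W' t x)
      fun t t' => A.curvatureOp_add_right V' W' t t' x
    have := eq_zero_of_tensorial x φ (fun f hf U => A.curvatureOp_functionSmul_right V' W' hf U x)
      (s := s - s') (sub_eq_zero.2 hs)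
    rw [map_sub, sub_eq_zero] at this
    exact this
  rw [left hV, curvatureOp_swap, left hW, ← curvatureOp_swap, right]

theorem exists_isCurvature (A : UnitaryConnection n X F E) : ∃ R, A.IsCurvature R := by
  have : FiniteDimensional ℝ F := FiniteDimensional.complexToReal F
  choose T hT using fun (x : X) (v : TangentSpace (RealModel n) x) =>
    exists_section_eq (n := n) (G := Fin n → ℂ) x v
  choose S hS using fun (x : X) (e : E x) => exists_section_eq (n := n) (G := F) x e
  refine ⟨fun x v w =>
    { toFun := fun e => A.curvatureOp (T x v) (T x w) (S x e) x
      map_add' := fun e e' => ?_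
      map_smul' := fun c e => ?_ }, fun V W s x => ?_⟩
  · rw [← A.curvatureOp_add_right]
    refine A.curvatureOp_congr rfl rfl ?_
    change S x (e + e') x = S x e x + S x e' x
    rw [hS, hS, hS]
  · rw [RingHom.id_apply, ← A.curvatureOp_const_smul]
    refine A.curvatureOp_congr rfl rfl ?_
    change S x (c • e) x = c • S x e x
    rw [hS, hS]
  · exact A.curvatureOp_congr (hT x _) (hT x _) (hS x _)

/-- The curvature `F_A`, the unique endomorphism-valued two-form with `IsCurvature`. -/
def curvature (A : UnitaryConnection n X F E) (x : X) :
    TangentSpace (RealModel n) x → TangentSpace (RealModel n) x → (E x →ₗ[ℂ] E x) :=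
  Classical.choose A.exists_isCurvature x

end UnitaryConnection

section Hamiltonian

/-- The two-form `tr(a ∧ b)`, that is `(v, w) ↦ tr(a(v) b(w)) - tr(a(w) b(v))`. -/
def traceWedge (a b : unitaryOneForms n X F E) : DForm n X 2 := fun x =>
  let B : TangentSpace (RealModel n) x →ₗ[ℝ] TangentSpace (RealModel n) x →ₗ[ℝ] ℂ :=
    LinearMap.mk₂ ℝ (fun v w => LinearMap.trace ℂ (E x) (a.1 x v ∘ₗ b.1 x w))
      (fun v v' w => by rw [map_add, LinearMap.add_comp, map_add])
      (fun c v w => by rw [map_smul, LinearMap.smul_comp, LinearMap.map_smul_of_tower])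
      (fun v w w' => by rw [map_add, LinearMap.comp_add, map_add])
      (fun c v w => by rw [map_smul, LinearMap.comp_smul, LinearMap.map_smul_of_tower])
  twoForm (B - B.flip) fun v => sub_self (B v v)

variable [T2Space X] [CompactSpace X]

/-- `-∫ tr(a ∧ b) ∧ ω^(n-1)`. -/
def symplecticIntegral (hn : 1 ≤ n) (g : HermitianMetric n X) (a b : unitaryOneForms n X F E) : ℂ :=
  -formIntegral (n := n) (X := X) (k := 2 + 2 * (n - 1)) (by omega) fun x =>
    wedge (traceWedge a b x) (wedgePow (g.kahlerForm x) (n - 1))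

/-- `-∫ tr(ζ (Λ_ω F_A + i lam Id)) ω^n / n`. -/
def momentIntegral [FiniteDimensional ℂ F] (g : HermitianMetric n X) (lam : ℝ)
    (A : UnitaryConnection n X F E) (ζ : gaugeLieAlgebra n X F E) : ℂ :=
  -formIntegral (n := n) (X := X) rfl fun x =>
    (LinearMap.trace ℂ (E x) (ζ.1 x ∘ₗ
      (g.contract x (A.curvature x) + (Complex.I * (lam : ℂ)) • LinearMap.id)) / (n : ℂ)) •
        wedgePow (g.kahlerForm x) n

/-- `γ` is the one-parameter subgroup of the gauge group with velocity `ζ` at the identity. -/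
def IsOneParameterSubgroup (γ : ℝ → unitaryGaugeGroup n X F E) (ζ : gaugeLieAlgebra n X F E) :
    Prop :=
  (∀ s t, γ (s + t) = γ s * γ t) ∧
    ∀ (x : X) (e : E x), HasDerivAt (fun t => (γ t).1 x e) (ζ.1 x e) 0

/-- The tangent vector `Y` at `A` is the velocity at time `0` of the curve `t ↦ γ t · A`. -/
def IsOrbitVelocity (γ : ℝ → unitaryGaugeGroup n X F E) (A : UnitaryConnection n X F E)
    (Y : unitaryOneForms n X F E) : Prop :=
  ∀ (s : SmoothSection n F E) (x : X) (v : TangentSpace (RealModel n) x),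
    HasDerivAt (fun t => (γ t • A).toFun s x v) (Y.1 x v (s x)) 0

/-- The translation-invariant two-form `Ω` on the affine space of unitary connections is a (weak)
symplectic form; being constant it is closed. -/
structure IsSymplecticForm
    (Ω : unitaryOneForms n X F E →ₗ[ℝ] unitaryOneForms n X F E →ₗ[ℝ] ℝ) : Prop where
  alternating : ∀ a, Ω a a = 0
  nondegenerate : ∀ a, (∀ b, Ω a b = 0) → a = 0

/-- The gauge group acts on the affine space of unitary connections by affine maps, the derivative
of `g` being `a ↦ g a g⁻¹`, and these preserve `Ω`. -/
structure IsSymplecticAction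
    (Ω : unitaryOneForms n X F E →ₗ[ℝ] unitaryOneForms n X F E →ₗ[ℝ] ℝ) : Prop where
  affine : ∀ (u : unitaryGaugeGroup n X F E) (a : unitaryOneForms n X F E)
    (A : UnitaryConnection n X F E), u • (a +ᵥ A) = adjointOneForm u a +ᵥ u • A
  invariant : ∀ (u : unitaryGaugeGroup n X F E) (a b : unitaryOneForms n X F E),
    Ω (adjointOneForm u a) (adjointOneForm u b) = Ω a b

/-- `μ` is an equivariant moment map for the gauge action, with values in the continuous dual of
the Lie algebra: `d⟨μ, ζ⟩(a) = Ω(Y_ζ, a)`, where `Y_ζ` is the vector field on the space of unitary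
connections induced by `ζ`, and `⟨μ(u · A), u ζ u⁻¹⟩ = ⟨μ(A), ζ⟩`. -/
structure IsEquivariantMomentMap
    (Ω : unitaryOneForms n X F E →ₗ[ℝ] unitaryOneForms n X F E →ₗ[ℝ] ℝ)
    (μ : UnitaryConnection n X F E → (gaugeLieAlgebra n X F E →ₗ[ℝ] ℝ)) : Prop where
  continuous : ∀ A, ∃ C : ℝ, ∀ (ζ : gaugeLieAlgebra n X F E) (M : ℝ), 0 ≤ M →
    (∀ (x : X) (e : E x), ‖ζ.1 x e‖ ≤ M * ‖e‖) → |μ A ζ| ≤ C * M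
  exists_subgroup : ∀ ζ, ∃ γ, IsOneParameterSubgroup (n := n) (X := X) (F := F) (E := E) γ ζ
  moment : ∀ ζ γ, IsOneParameterSubgroup (n := n) (X := X) (F := F) (E := E) γ ζ →
    ∀ A, ∃ Y, IsOrbitVelocity γ A Y ∧
      ∀ a, HasDerivAt (fun t : ℝ => μ ((t • a) +ᵥ A) ζ) (Ω Y a) 0
  equivariant : ∀ u A ζ, μ (u • A) (adjoint u ζ) = μ A ζ

end Hamiltonian

end Bundles

end

end GaugeTheory

open GaugeTheory

/-!
Both integrals are integrals of real functions against the positive density `ωⁿ`. For a two-form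
`ψ` one has `n ψ ∧ ω^(n-1) = (Λ_ω ψ) ωⁿ` (`wedge_kahlerForm_pow`, from the linear algebra statement
`natCast_mul_wedge_wedgePow`), and `ωⁿ` is positive in every holomorphic chart
(`exists_wedgePow_eq_pos`). The traces of products of two skew-hermitian endomorphisms are real, so
`n Ω(a, b)` is minus the integral of the real function `Λ_ω tr(a ∧ b)` against `ωⁿ`, and `n ⟨μ(A), ζ⟩`
minus that of `Λ_ω tr(ζ F_A) + λ i tr ζ`.

Weak nondegeneracy comes from testing `a` against `a ∘ J`: twice the contraction of
`tr(a ∧ (a ∘ J))` is the trace with respect to `g` of the positive semidefinite form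
`-tr(a(v) a(w))` plus that of its pull-back by `J`. Hence the integrand of `-Ω(a, a ∘ J)` is
nonnegative and vanishes only where `a` does (`contraction_nonneg`,
`isSymplecticForm_symplecticForm`).

For the moment map identity, `F_(A + ta) = F_A + t d_A a + t² a ∧ a` (`curvature_smul_vadd`) gives
the derivative `-∫ tr(ζ d_A a) ∧ ω^(n-1)` of `⟨μ(A + ta), ζ⟩`, while the infinitesimal action of `ζ`
is `A ↦ -d_A ζ` (`isOrbitVelocity`), so that the right-hand side is `∫ tr(d_A ζ ∧ a) ∧ ω^(n-1)`.
The difference is the integral of `d tr(ζ a) ∧ ω^(n-1)` (`traceWedge_covGauge_add`), which vanishes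
because `d(ω^(n-1)) = 0`: a partition of unity reduces to `ζ` supported in a chart, and there Stokes'
theorem is the vanishing of the integral over `ℂⁿ` of the derivative of a compactly supported
function (`setIntegral_wedge_eq_zero`, `twoFormIntegral_exactForm`). Equivariance is
`F_(u · A) = u F_A u⁻¹` (`curvature_smul`) and the invariance of the trace.

Everything about the bundle is reduced to functions by a resolution of the identity: finitely many
global sections with `∑ₖ ⟨tₖ, ·⟩ sₖ = Id` (`exists_resolution`). It yields the smoothness of traces,
the Leibniz rule `d tr T = tr [∇, T]`, the smoothness of `exp(tζ)`, the uniqueness of the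
one-parameter subgroup, and the bound on `μ(A)` by the sup norm of `ζ`.
-/

namespace GaugeTheory

open Finset

noncomputable section

/-! ### Wedge products and Pfaffian sums -/

section WedgeAlgebra

variable {n : ℕ}

theorem factorial_mul_ne_zero (p q : ℕ) : ((p.factorial * q.factorial : ℕ) : ℂ) ≠ 0 :=
  Nat.cast_ne_zero.2 (by positivity)

/-- The wedge product as a signed sum over all permutations. -/
theorem factorial_smul_wedge_apply {p q : ℕ} (α : (Fin n → ℂ) [⋀^Fin p]→L[ℝ] ℂ)
    (β : (Fin n → ℂ) [⋀^Fin q]→L[ℝ] ℂ) (v : Fin (p + q) → Fin n → ℂ) :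
    ((p.factorial * q.factorial : ℕ) : ℂ) * wedge α β v =
      ∑ σ : Equiv.Perm (Fin p ⊕ Fin q), (Equiv.Perm.sign σ : ℤ) •
        (α (fun i => v (finSumFinEquiv (σ (Sum.inl i)))) *
          β (fun i => v (finSumFinEquiv (σ (Sum.inr i))))) := by
  have h := congrArg (fun f => LinearMap.mul' ℝ ℂ (f fun i => v (finSumFinEquiv i)))
    (MultilinearMap.domCoprod_alternization_eq α.toAlternatingMap β.toAlternatingMap)
  simp only [Fintype.card_fin, AlternatingMap.smul_apply, map_nsmul] at h
  have h2 : wedge α β v = LinearMap.mul' ℝ ℂ ((α.toAlternatingMap.domCoprod β.toAlternatingMap)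
    fun i => v (finSumFinEquiv i)) := rfl
  rw [h2, ← nsmul_eq_mul]
  refine h.symm.trans ?_
  rw [MultilinearMap.alternatization_apply, map_sum]
  refine sum_congr rfl fun σ _ => ?_
  rw [Units.smul_def, map_zsmul]
  rfl

theorem wedge_add_left {p q : ℕ} (α α' : (Fin n → ℂ) [⋀^Fin p]→L[ℝ] ℂ)
    (β : (Fin n → ℂ) [⋀^Fin q]→L[ℝ] ℂ) : wedge (α + α') β = wedge α β + wedge α' β := by
  ext v
  have hp := factorial_mul_ne_zero p q
  refine mul_left_cancel₀ hp ?_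
  rw [ContinuousAlternatingMap.add_apply, mul_add]
  simp only [factorial_smul_wedge_apply, ← sum_add_distrib, ContinuousAlternatingMap.add_apply,
    add_mul, smul_add]

theorem wedge_smul_left {p q : ℕ} (c : ℂ) (α : (Fin n → ℂ) [⋀^Fin p]→L[ℝ] ℂ)
    (β : (Fin n → ℂ) [⋀^Fin q]→L[ℝ] ℂ) : wedge (c • α) β = c • wedge α β := by
  ext v
  have hp := factorial_mul_ne_zero p q
  refine mul_left_cancel₀ hp ?_
  rw [ContinuousAlternatingMap.smul_apply, smul_eq_mul, mul_left_comm]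
  simp only [factorial_smul_wedge_apply, mul_sum, ContinuousAlternatingMap.smul_apply,
    smul_eq_mul, mul_assoc, mul_smul_comm]

/-- Pull-back is compatible with wedge products. -/
theorem wedge_compContinuousLinearMap {p q : ℕ} (α : (Fin n → ℂ) [⋀^Fin p]→L[ℝ] ℂ)
    (β : (Fin n → ℂ) [⋀^Fin q]→L[ℝ] ℂ) (L : (Fin n → ℂ) →L[ℝ] (Fin n → ℂ)) :
    (wedge α β).compContinuousLinearMap L =
      wedge (α.compContinuousLinearMap L) (β.compContinuousLinearMap L) := by
  ext v
  have hp := factorial_mul_ne_zero p q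
  refine mul_left_cancel₀ hp ?_
  rw [ContinuousAlternatingMap.compContinuousLinearMap_apply, factorial_smul_wedge_apply,
    factorial_smul_wedge_apply]
  rfl

theorem wedgePow_compContinuousLinearMap (α : (Fin n → ℂ) [⋀^Fin 2]→L[ℝ] ℂ)
    (L : (Fin n → ℂ) →L[ℝ] (Fin n → ℂ)) (k : ℕ) :
    (wedgePow α k).compContinuousLinearMap L = wedgePow (α.compContinuousLinearMap L) k := by
  induction k with
  | zero => rfl
  | succ k ih => rw [wedgePow, wedgePow, wedge_compContinuousLinearMap, ih]

/-- The signed sum `Σ sgn σ ∏ᵢ Bᵢ(w_σ(i,0), w_σ(i,1))` over the permutations of the entries of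
all pairs: for
`Bᵢ = B` it is a multiple of the Pfaffian. -/
def pairSum {V : Type*} {ι : Type*} [Fintype ι] [DecidableEq ι] (B : ι → V → V → ℂ)
    (w : ι × Fin 2 → V) : ℂ :=
  ∑ σ : Equiv.Perm (ι × Fin 2), (Equiv.Perm.sign σ : ℤ) • ∏ i, B i (w (σ (i, 0))) (w (σ (i, 1)))

theorem pairSum_reindex {V ι κ : Type*} [Fintype ι] [DecidableEq ι] [Fintype κ] [DecidableEq κ]
    (e : ι ≃ κ) (B : κ → V → V → ℂ) (w : κ × Fin 2 → V) :
    pairSum (fun i => B (e i)) (fun p => w (e p.1, p.2)) = pairSum B w := by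
  unfold pairSum
  let E : ι × Fin 2 ≃ κ × Fin 2 := e.prodCongr (Equiv.refl _)
  refine Fintype.sum_equiv E.permCongr _ _ fun σ => ?_
  rw [Equiv.Perm.sign_permCongr]
  congr 1
  refine Fintype.prod_equiv e _ _ fun i => ?_
  simp [E, Equiv.permCongr_apply]
  rfl

/-- If `c γ` is a Pfaffian sum, so is `2 c γ ∧ α`: the sum over the permutations of all indices is
reindexed by the permutations inside the factor `γ`. -/
theorem pairSum_wedge_right {p : ℕ} {ι : Type*} [Fintype ι] [DecidableEq ι] (e : ι × Fin 2 ≃ Fin p)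
    {c : ℂ} {γ : (Fin n → ℂ) [⋀^Fin p]→L[ℝ] ℂ} {B : ι → (Fin n → ℂ) → (Fin n → ℂ) → ℂ}
    (h : ∀ v, c * γ v = pairSum B fun i => v (e i)) (α : (Fin n → ℂ) [⋀^Fin 2]→L[ℝ] ℂ)
    (v : Fin (p + 2) → Fin n → ℂ) :
    2 * c * wedge γ α v = pairSum (ι := ι ⊕ Fin 1) (Sum.elim B fun _ x y => α ![x, y])
      fun i => v (finSumFinEquiv (Sum.elim (fun j => Sum.inl (e (j, i.2))) (fun _ => Sum.inr i.2)
        i.1)) := by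
  set w : Fin p ⊕ Fin 2 → Fin n → ℂ := fun i => v (finSumFinEquiv i) with hw
  let f : Equiv.Perm (Fin p ⊕ Fin 2) → ℂ := fun σ => (Equiv.Perm.sign σ : ℤ) •
    ((∏ i, B i (w (σ (Sum.inl (e (i, 0))))) (w (σ (Sum.inl (e (i, 1)))))) *
      α ![w (σ (Sum.inr 0)), w (σ (Sum.inr 1))])
  have h1 := factorial_smul_wedge_apply γ α v
  have h2 : ∀ σ : Equiv.Perm (Fin p ⊕ Fin 2), c * ((Equiv.Perm.sign σ : ℤ) •
      (γ (fun i => w (σ (Sum.inl i))) * α (fun i => w (σ (Sum.inr i))))) =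
      ∑ τ : Equiv.Perm (ι × Fin 2), f (σ * Equiv.sumCongr (e.permCongr τ) 1) := fun σ => by
    rw [mul_smul_comm, ← mul_assoc, h, pairSum, sum_mul, smul_sum]
    refine sum_congr rfl fun τ _ => ?_
    have h3 : (fun i => w (σ (Sum.inr i))) = ![w (σ (Sum.inr 0)), w (σ (Sum.inr 1))] := by
      ext i : 1
      fin_cases i <;> rfl
    have h4 : Equiv.Perm.sign (Equiv.sumCongr (e.permCongr τ) (1 : Equiv.Perm (Fin 2))) =
        Equiv.Perm.sign τ := by
      rw [Equiv.Perm.sign_sumCongr, Equiv.Perm.sign_permCongr, map_one, mul_one]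
    simp only [f, h3, Equiv.Perm.sign_mul, h4, Units.val_mul, mul_smul, smul_mul_assoc]
    simp [Equiv.permCongr_apply]
  have h5 : (p.factorial : ℂ) * (2 * c * wedge γ α v) = p.factorial * ∑ σ, f σ := by
    calc (p.factorial : ℂ) * (2 * c * wedge γ α v)
        = c * (((p.factorial * Nat.factorial 2 : ℕ) : ℂ) * wedge γ α v) := by
          push_cast [Nat.factorial_two]
          ring
      _ = ∑ τ : Equiv.Perm (ι × Fin 2), ∑ σ, f (σ * Equiv.sumCongr (e.permCongr τ) 1) := by
          rw [h1, mul_sum, sum_comm]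
          exact sum_congr rfl fun σ _ => h2 σ
      _ = ∑ τ : Equiv.Perm (ι × Fin 2), ∑ σ, f σ :=
          sum_congr rfl fun τ _ => Equiv.sum_comp (Equiv.mulRight _) f
      _ = p.factorial * ∑ σ, f σ := by
          rw [sum_const, card_univ, Fintype.card_perm, Fintype.card_congr e, Fintype.card_fin,
            nsmul_eq_mul]
  rw [mul_left_cancel₀ (Nat.cast_ne_zero.2 p.factorial_ne_zero) h5, pairSum]
  let E : Fin p ⊕ Fin 2 ≃ (ι ⊕ Fin 1) × Fin 2 :=
    (Equiv.sumCongr e.symm (Equiv.uniqueProd (Fin 2) (Fin 1)).symm).trans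
      (Equiv.sumProdDistrib ι (Fin 1) (Fin 2)).symm
  have hE : ∀ i, w (E.symm i) = v (finSumFinEquiv (Sum.elim (fun j => Sum.inl (e (j, i.2)))
      (fun _ => Sum.inr i.2) i.1)) := by
    rintro ⟨i | i, b⟩
    · rfl
    · rfl
  refine Fintype.sum_equiv E.permCongr _ _ fun σ => ?_
  simp only [f, Equiv.Perm.sign_permCongr]
  congr 1
  rw [Fintype.prod_sum_type]
  simp only [univ_unique, Finset.prod_singleton, Sum.elim_inl, Sum.elim_inr, ← hE,
    Equiv.permCongr_apply, Equiv.symm_apply_apply]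
  have a1 : ∀ i b, E.symm (Sum.inl i, b) = Sum.inl (e (i, b)) := fun _ _ => rfl
  have a2 : ∀ i b, E.symm (Sum.inr i, b) = Sum.inr b := fun _ _ => rfl
  simp only [a1, a2]

/-- The analogue of `pairSum_wedge_right` for `α ∧ γ`. -/
theorem pairSum_wedge_left {p : ℕ} {ι : Type*} [Fintype ι] [DecidableEq ι] (e : ι × Fin 2 ≃ Fin p)
    {c : ℂ} {γ : (Fin n → ℂ) [⋀^Fin p]→L[ℝ] ℂ} {B : ι → (Fin n → ℂ) → (Fin n → ℂ) → ℂ}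
    (h : ∀ v, c * γ v = pairSum B fun i => v (e i)) (α : (Fin n → ℂ) [⋀^Fin 2]→L[ℝ] ℂ)
    (v : Fin (2 + p) → Fin n → ℂ) :
    2 * c * wedge α γ v = pairSum (ι := Fin 1 ⊕ ι) (Sum.elim (fun _ x y => α ![x, y]) B)
      fun i => v (finSumFinEquiv (Sum.elim (fun _ => Sum.inl i.2) (fun j => Sum.inr (e (j, i.2)))
        i.1)) := by
  set w : Fin 2 ⊕ Fin p → Fin n → ℂ := fun i => v (finSumFinEquiv i) with hw
  let f : Equiv.Perm (Fin 2 ⊕ Fin p) → ℂ := fun σ => (Equiv.Perm.sign σ : ℤ) •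
    (α ![w (σ (Sum.inl 0)), w (σ (Sum.inl 1))] *
      (∏ i, B i (w (σ (Sum.inr (e (i, 0))))) (w (σ (Sum.inr (e (i, 1)))))))
  have h1 := factorial_smul_wedge_apply α γ v
  have h2 : ∀ σ : Equiv.Perm (Fin 2 ⊕ Fin p), c * ((Equiv.Perm.sign σ : ℤ) •
      (α (fun i => w (σ (Sum.inl i))) * γ (fun i => w (σ (Sum.inr i))))) =
      ∑ τ : Equiv.Perm (ι × Fin 2), f (σ * Equiv.sumCongr 1 (e.permCongr τ)) := fun σ => by
    rw [mul_smul_comm, mul_left_comm, h, pairSum, mul_sum, smul_sum]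
    refine sum_congr rfl fun τ _ => ?_
    have h3 : (fun i => w (σ (Sum.inl i))) = ![w (σ (Sum.inl 0)), w (σ (Sum.inl 1))] := by
      ext i : 1
      fin_cases i <;> rfl
    have h4 : Equiv.Perm.sign (Equiv.sumCongr (1 : Equiv.Perm (Fin 2)) (e.permCongr τ)) =
        Equiv.Perm.sign τ := by
      rw [Equiv.Perm.sign_sumCongr, Equiv.Perm.sign_permCongr, map_one, one_mul]
    simp only [f, h3, Equiv.Perm.sign_mul, h4, Units.val_mul, mul_smul, mul_smul_comm]
    simp [Equiv.permCongr_apply]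
  have h5 : (p.factorial : ℂ) * (2 * c * wedge α γ v) = p.factorial * ∑ σ, f σ := by
    calc (p.factorial : ℂ) * (2 * c * wedge α γ v)
        = c * (((Nat.factorial 2 * p.factorial : ℕ) : ℂ) * wedge α γ v) := by
          push_cast [Nat.factorial_two]
          ring
      _ = ∑ τ : Equiv.Perm (ι × Fin 2), ∑ σ, f (σ * Equiv.sumCongr 1 (e.permCongr τ)) := by
          rw [h1, mul_sum, sum_comm]
          exact sum_congr rfl fun σ _ => h2 σ
      _ = ∑ τ : Equiv.Perm (ι × Fin 2), ∑ σ, f σ :=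
          sum_congr rfl fun τ _ => Equiv.sum_comp (Equiv.mulRight _) f
      _ = p.factorial * ∑ σ, f σ := by
          rw [sum_const, card_univ, Fintype.card_perm, Fintype.card_congr e, Fintype.card_fin,
            nsmul_eq_mul]
  rw [mul_left_cancel₀ (Nat.cast_ne_zero.2 p.factorial_ne_zero) h5, pairSum]
  let E : Fin 2 ⊕ Fin p ≃ (Fin 1 ⊕ ι) × Fin 2 :=
    (Equiv.sumCongr (Equiv.uniqueProd (Fin 2) (Fin 1)).symm e.symm).trans
      (Equiv.sumProdDistrib (Fin 1) ι (Fin 2)).symm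
  have hE : ∀ i, w (E.symm i) = v (finSumFinEquiv (Sum.elim (fun _ => Sum.inl i.2)
      (fun j => Sum.inr (e (j, i.2))) i.1)) := by
    rintro ⟨i | i, b⟩
    · rfl
    · rfl
  refine Fintype.sum_equiv E.permCongr _ _ fun σ => ?_
  simp only [f, Equiv.Perm.sign_permCongr]
  congr 1
  rw [Fintype.prod_sum_type]
  simp only [univ_unique, Finset.prod_singleton, Sum.elim_inl, Sum.elim_inr, ← hE,
    Equiv.permCongr_apply, Equiv.symm_apply_apply]
  have a1 : ∀ i b, E.symm (Sum.inr i, b) = Sum.inr (e (i, b)) := fun _ _ => rfl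
  have a2 : ∀ i b, E.symm (Sum.inl i, b) = Sum.inl b := fun _ _ => rfl
  simp only [a1, a2]

/-- The `i`-th pair of a list of `2k` indices is `2i, 2i + 1`. -/
def pairEquiv (k : ℕ) : Fin k × Fin 2 ≃ Fin (2 * k) :=
  finProdFinEquiv.trans (finCongr (mul_comm k 2))

theorem pairEquiv_val (k : ℕ) (i : Fin k × Fin 2) : (pairEquiv k i : ℕ) = i.2 + 2 * i.1 := rfl

/-- `2ᵏ αᵏ` is the sum of `∏ᵢ α(v_σ(i,0), v_σ(i,1))` over all permutations of the arguments. -/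
theorem wedgePow_apply (α : (Fin n → ℂ) [⋀^Fin 2]→L[ℝ] ℂ) (k : ℕ) (v : Fin (2 * k) → Fin n → ℂ) :
    2 ^ k * wedgePow α k v =
      pairSum (fun _ x y => α ![x, y]) fun i => v (pairEquiv k i) := by
  induction k with
  | zero => simp [wedgePow, pairSum]
  | succ k ih =>
    have h := pairSum_wedge_right (pairEquiv k) ih α v
    rw [pow_succ', wedgePow]
    refine h.trans ?_
    rw [← pairSum_reindex (finSumFinEquiv (m := k) (n := 1))]
    congr 1
    · ext i x y
      rcases i with i | i <;> rfl
    · ext i : 1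
      rcases i with ⟨i | i, b⟩
      · refine congrArg v (Fin.ext ?_)
        simp [pairEquiv_val]
      · refine congrArg v (Fin.ext ?_)
        simp [pairEquiv_val]
        omega

/-- `2^(k+1) ψ ∧ αᵏ` is the same sum with `α` replaced by `ψ` on the first pair. -/
theorem wedge_wedgePow_apply (ψ α : (Fin n → ℂ) [⋀^Fin 2]→L[ℝ] ℂ) (k : ℕ)
    (v : Fin (2 * (k + 1)) → Fin n → ℂ) :
    2 ^ (k + 1) * wedge ψ (wedgePow α k) (fun i => v (i.cast (by omega))) =
      pairSum (Function.update (fun _ x y => α ![x, y]) 0 fun x y => ψ ![x, y])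
        fun i => v (pairEquiv (k + 1) i) := by
  have h := pairSum_wedge_left (pairEquiv k) (wedgePow_apply α k) ψ
    (fun i => v (i.cast (by omega)))
  rw [pow_succ']
  refine h.trans ?_
  rw [← pairSum_reindex (finSumFinEquiv.trans (finCongr (add_comm 1 k)) :
    Fin 1 ⊕ Fin k ≃ Fin (k + 1))]
  congr 1
  · ext i x y
    rcases i with i | i
    · have : (finSumFinEquiv.trans (finCongr (add_comm 1 k)) : Fin 1 ⊕ Fin k ≃ Fin (k + 1))
          (Sum.inl i) = 0 := by
        ext
        simp
      rw [this]
      simp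
    · have : (finSumFinEquiv.trans (finCongr (add_comm 1 k)) : Fin 1 ⊕ Fin k ≃ Fin (k + 1))
          (Sum.inr i) ≠ 0 := by
        intro h
        have := congrArg Fin.val h
        simp at this
      rw [Function.update_of_ne this]
      rfl
  · ext i : 1
    rcases i with ⟨i | i, b⟩
    · refine congrArg v (Fin.ext ?_)
      simp [pairEquiv_val]
    · refine congrArg v (Fin.ext ?_)
      simp [pairEquiv_val]
      omega

/-- It does not matter on which pair `B` is replaced by `C`: exchanging two pairs is an even
permutation. -/
theorem pairSum_update_eq {V ι : Type*} [Fintype ι] [DecidableEq ι] (B C : V → V → ℂ)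
    (w : ι × Fin 2 → V) (i j : ι) :
    pairSum (Function.update (fun _ => B) i C) w = pairSum (Function.update (fun _ => B) j C) w := by
  let ρ : Equiv.Perm (ι × Fin 2) := Equiv.prodCongrLeft fun _ => Equiv.swap i j
  have hρ : Equiv.Perm.sign ρ = 1 := by
    rw [Equiv.Perm.sign_prodCongrLeft, Fin.prod_univ_two, Int.units_mul_self]
  unfold pairSum
  rw [← Equiv.sum_comp (Equiv.mulRight ρ)]
  refine sum_congr rfl fun σ _ => ?_
  rw [Equiv.coe_mulRight, Equiv.Perm.sign_mul, hρ, mul_one]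
  congr 1
  refine Fintype.prod_equiv (Equiv.swap i j) _ _ fun k => ?_
  have h : Function.update (fun _ => B) i C k = Function.update (fun _ => B) j C (Equiv.swap i j k) := by
    rcases eq_or_ne k i with rfl | hk
    · simp
    · rw [Function.update_of_ne hk, Function.update_of_ne]
      intro h
      exact hk ((Equiv.swap i j).injective (h.trans (Equiv.swap_apply_left i j).symm))
  rw [h]
  rfl

end WedgeAlgebra

/-! ### Forms of top degree and the contraction identity -/

section TopForms

variable {n : ℕ}

/-- `realFrame n` as a real basis of `ℂⁿ`. -/
def realBasis (n : ℕ) : Module.Basis (Fin (2 * n)) ℝ (Fin n → ℂ) :=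
  (Pi.basis fun _ : Fin n => Complex.basisOneI).reindex
    ((Equiv.sigmaEquivProd (Fin n) (Fin 2)).trans (pairEquiv n))

theorem realFrame_pairEquiv (i : Fin n) (b : Fin 2) :
    realFrame n (pairEquiv n (i, b)) = Pi.single i (if b = 0 then 1 else Complex.I) := by
  unfold realFrame
  have h1 : (pairEquiv n (i, b) : ℕ) = b + 2 * i := rfl
  have h2 : (⟨(pairEquiv n (i, b) : ℕ) / 2, by omega⟩ : Fin n) = i := by
    ext
    simp only [h1]
    omega
  have h3 : (pairEquiv n (i, b) : ℕ) % 2 = b := by omega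
  rw [h2, h3]
  congr 1
  fin_cases b <;> simp

theorem coe_realBasis : ⇑(realBasis n) = realFrame n := by
  ext1 j
  obtain ⟨⟨i, b⟩, rfl⟩ := (pairEquiv n).surjective j
  rw [realFrame_pairEquiv]
  simp only [realBasis, Module.Basis.reindex_apply, Equiv.symm_trans_apply, Equiv.symm_apply_apply]
  simp only [Equiv.sigmaEquivProd_symm_apply, Pi.basis_apply]
  fin_cases b <;> simp [Complex.basisOneI]

/-- In top degree the pull-back by `T` is multiplication by `det T`. -/
theorem topForm_map (f : (Fin n → ℂ) [⋀^Fin (2 * n)]→L[ℝ] ℂ)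
    (T : (Fin n → ℂ) →ₗ[ℝ] (Fin n → ℂ)) (v : Fin (2 * n) → Fin n → ℂ) :
    f (fun i => T (v i)) = ((LinearMap.det T : ℝ) : ℂ) * f v := by
  have key : ∀ h : (Fin n → ℂ) [⋀^Fin (2 * n)]→ₗ[ℝ] ℝ,
      h (fun i => T (v i)) = LinearMap.det T * h v := fun h => by
    rw [h.eq_smul_basis_det (realBasis n)]
    simp only [AlternatingMap.smul_apply, smul_eq_mul]
    have := (realBasis n).det_comp T v
    rw [Function.comp_def] at this
    rw [this]
    ring
  have hr := key (Complex.reLm.compAlternatingMap f.toAlternatingMap)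
  have hi := key (Complex.imLm.compAlternatingMap f.toAlternatingMap)
  apply Complex.ext
  · rw [Complex.re_ofReal_mul]
    exact hr
  · rw [Complex.im_ofReal_mul]
    exact hi

/-- The derivative of the determinant at the identity is the trace. -/
theorem hasDerivAt_det_one_add_smul {m : Type*} [Fintype m] [DecidableEq m] (A : Matrix m m ℝ) :
    HasDerivAt (fun t : ℝ => (1 + t • A).det) A.trace 0 := by
  have h : (fun t : ℝ => (1 + t • A).det) = fun t => 1 + A.trace * t +
      (Matrix.det (1 + (Polynomial.X : Polynomial ℝ) • A.map Polynomial.C)).divX.divX.eval t * t ^ 2 :=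
    funext fun t => Matrix.det_one_add_smul t A
  rw [h]
  have h2 := (((hasDerivAt_id (0 : ℝ)).const_mul A.trace).const_add 1).add
    (((Matrix.det (1 + (Polynomial.X : Polynomial ℝ) • A.map Polynomial.C)).divX.divX.hasDerivAt
      0).mul (hasDerivAt_pow 2 (0 : ℝ)))
  exact h2.congr_deriv (by simp)

/-- For a nondegenerate two-form `ω`, wedging a two-form `ψ` with `ω^(n-1)` is contracting `ψ` with
the bivector dual to `ω`: `n ψ ∧ ω^(n-1) = ½ tr(W⁻¹ Ψ) ω^n`. The proof differentiates
`((1 + tA)^* ω)^n = det(1 + tA) ω^n` at `t = 0`, where `A` is chosen with `ω(Av, w) = ½ ψ(v, w)`. -/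
theorem natCast_mul_wedge_wedgePow {k : ℕ} (B : (Fin (k + 1) → ℂ) →ₗ[ℝ] (Fin (k + 1) → ℂ) →ₗ[ℝ] ℂ)
    (hB : ∀ v, B v v = 0) (ψ : (Fin (k + 1) → ℂ) [⋀^Fin 2]→L[ℝ] ℂ)
    (W Ψ : Matrix (Fin (2 * (k + 1))) (Fin (2 * (k + 1))) ℝ) (hW : IsUnit W.det)
    (hBW : ∀ i j, B (realFrame (k + 1) i) (realFrame (k + 1) j) = W i j)
    (hψ : ∀ i j, ψ ![realFrame (k + 1) i, realFrame (k + 1) j] = Ψ i j) :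
    ((k + 1 : ℕ) : ℂ) * wedge ψ (wedgePow (twoForm B hB) k)
        (fun i => realFrame (k + 1) (i.cast (by omega))) =
      ((1 / 2 * ∑ i, ∑ j, W⁻¹ j i * Ψ i j : ℝ) : ℂ) *
        wedgePow (twoForm B hB) (k + 1) (realFrame (k + 1)) := by
  set b := realBasis (k + 1) with hb
  set e := realFrame (k + 1) with he
  have hbe : ∀ i, b i = e i := fun i => congrFun coe_realBasis i
  have hBs : ∀ v w, B v w = -B w v := fun v w => by
    have h := hB (v + w)
    simp only [map_add, LinearMap.add_apply, hB, zero_add, add_zero] at h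
    exact eq_neg_of_add_eq_zero_right h
  have hWt : W.transpose = -W := by
    ext i j
    have h := hBs (e j) (e i)
    rw [hBW, hBW] at h
    exact_mod_cast h
  have hΨt : Ψ.transpose = -Ψ := by
    ext i j
    have h := ψ.toAlternatingMap.map_swap ![e i, e j] (show (0 : Fin 2) ≠ 1 by decide)
    have h1 : (![e i, e j] ∘ Equiv.swap (0 : Fin 2) 1) = ![e j, e i] := by
      ext x : 1
      fin_cases x <;> rfl
    rw [h1] at h
    have h2 : ψ ![e j, e i] = -ψ ![e i, e j] := h
    rw [hψ, hψ] at h2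
    exact_mod_cast h2
  set A : Matrix (Fin (2 * (k + 1))) (Fin (2 * (k + 1))) ℝ :=
    ((1 / 2 : ℝ) • (Ψ * W⁻¹)).transpose with hA
  have hAW : A.transpose * W = (1 / 2 : ℝ) • Ψ := by
    rw [hA, Matrix.transpose_transpose, Matrix.smul_mul, Matrix.mul_assoc, Matrix.nonsing_inv_mul _ hW,
      Matrix.mul_one]
  have hWA : W * A = (1 / 2 : ℝ) • Ψ := by
    have h := congrArg Matrix.transpose hAW
    rw [Matrix.transpose_mul, Matrix.transpose_transpose, hWt, Matrix.transpose_smul, hΨt,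
      Matrix.neg_mul, smul_neg, neg_inj] at h
    exact h
  set a : Fin (2 * (k + 1)) → Fin (k + 1) → ℂ := fun i => ∑ l, A l i • e l with ha
  have h1 : ∀ i j, B (a i) (e j) + B (e i) (a j) = ψ ![e i, e j] := fun i j => by
    have e1 := congrFun (congrFun hAW i) j
    have e2 := congrFun (congrFun hWA i) j
    simp only [Matrix.mul_apply, Matrix.transpose_apply, Matrix.smul_apply, smul_eq_mul] at e1 e2
    have f1 : B (a i) (e j) = ((∑ l, A l i * W l j : ℝ) : ℂ) := by
      simp only [ha, map_sum, map_smul, LinearMap.sum_apply, LinearMap.smul_apply, hBW]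
      push_cast
      rfl
    have f2 : B (e i) (a j) = ((∑ l, W i l * A l j : ℝ) : ℂ) := by
      simp only [ha, map_sum, map_smul, hBW]
      push_cast
      exact sum_congr rfl fun l _ => (Complex.real_smul).trans (mul_comm _ _)
    rw [f1, f2, e1, e2, hψ]
    push_cast
    ring
  let T : ℝ → (Fin (k + 1) → ℂ) →ₗ[ℝ] (Fin (k + 1) → ℂ) := fun t => Matrix.toLin b b (1 + t • A)
  have hT : ∀ t i, T t (e i) = e i + t • a i := fun t i => by
    rw [← hbe, Matrix.toLin_self]
    simp only [Matrix.add_apply, Matrix.smul_apply, add_smul, sum_add_distrib, hbe, ha, smul_sum,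
      smul_eq_mul, mul_smul]
    congr 1
    simp [Matrix.one_apply]
  have hdet : ∀ t, (2 : ℂ) ^ (k + 1) * (((1 + t • A).det : ℝ) * wedgePow (twoForm B hB) (k + 1) e) =
      pairSum (fun _ x y => B (T t x) (T t y)) fun i => e (pairEquiv (k + 1) i) := fun t => by
    rw [← LinearMap.det_toLin b, ← topForm_map, wedgePow_apply]
    rfl
  -- the two sides of `hdet` are differentiated at `t = 0`: the determinant contributes `tr A`
  have hd1 : HasDerivAt (fun t : ℝ => (2 : ℂ) ^ (k + 1) * (((1 + t • A).det : ℝ) *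
      wedgePow (twoForm B hB) (k + 1) e))
      (2 ^ (k + 1) * ((A.trace : ℂ) * wedgePow (twoForm B hB) (k + 1) e)) 0 :=
    (((hasDerivAt_det_one_add_smul A).ofReal_comp).mul_const _).const_mul _
  -- the product rule replaces `B` by `ψ` on one pair at a time
  have hd2 : HasDerivAt (fun t => pairSum (fun _ x y => B (T t x) (T t y))
      fun i => e (pairEquiv (k + 1) i))
      (∑ i, pairSum (Function.update (fun _ x y => B x y) i fun x y => ψ ![x, y])
        fun i => e (pairEquiv (k + 1) i)) 0 := by
    have h2 : ∀ i j, HasDerivAt (fun t => B (T t (e i)) (T t (e j))) (ψ ![e i, e j]) 0 := fun i j => by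
      have h3 : (fun t : ℝ => B (T t (e i)) (T t (e j))) = fun t : ℝ => B (e i) (e j) +
          t • (ψ ![e i, e j]) + (t ^ 2) • B (a i) (a j) := by
        funext t
        rw [hT, hT, ← h1]
        simp only [map_add, map_smul, LinearMap.add_apply, LinearMap.smul_apply]
        module
      rw [h3]
      have h4 := (((hasDerivAt_id (0 : ℝ)).smul_const (ψ ![e i, e j])).const_add (B (e i) (e j))).add
        ((hasDerivAt_pow 2 (0 : ℝ)).smul_const (B (a i) (a j)))
      exact h4.congr_deriv (by simp)
    unfold pairSum
    rw [sum_comm]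
    refine HasDerivAt.fun_sum fun σ _ => ?_
    have h5 := HasDerivAt.fun_finsetProd (u := univ) (x := (0 : ℝ))
      (f := fun i t => B (T t (e (pairEquiv (k + 1) (σ (i, 0)))))
        (T t (e (pairEquiv (k + 1) (σ (i, 1))))))
      (fun i _ => h2 (pairEquiv (k + 1) (σ (i, 0))) (pairEquiv (k + 1) (σ (i, 1))))
    have h6 := h5.const_smul (Equiv.Perm.sign σ : ℤ)
    refine h6.congr_deriv ?_
    rw [smul_sum]
    refine sum_congr rfl fun i _ => ?_
    congr 1
    rw [← mul_prod_erase univ _ (mem_univ i), Function.update_self, smul_eq_mul, mul_comm]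
    congr 1
    refine prod_congr rfl fun j hj => ?_
    rw [Function.update_of_ne (ne_of_mem_erase hj), hT, hT]
    simp
  -- all these terms are equal, which gives the factor `k + 1`
  have hd3 : ∀ i : Fin (k + 1), pairSum (Function.update (fun _ x y => B x y) i fun x y => ψ ![x, y])
      (fun i => e (pairEquiv (k + 1) i)) = 2 ^ (k + 1) * wedge ψ (wedgePow (twoForm B hB) k)
        (fun i => e (i.cast (by omega))) := fun i => by
    rw [wedge_wedgePow_apply]
    exact pairSum_update_eq _ _ _ _ _
  have h7 := (hd1.congr_of_eventuallyEq (Filter.Eventually.of_forall fun t => (hdet t).symm)).unique hd2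
  rw [sum_congr rfl fun i _ => hd3 i, sum_const, card_univ, Fintype.card_fin, nsmul_eq_mul,
    mul_left_comm ((k + 1 : ℕ) : ℂ)] at h7
  have h8 := mul_left_cancel₀ (pow_ne_zero _ two_ne_zero) h7
  rw [← h8]
  congr 2
  rw [hA, Matrix.trace_transpose, Matrix.trace_smul, Matrix.trace, smul_eq_mul]
  congr 1
  refine sum_congr rfl fun i _ => ?_
  rw [Matrix.diag_apply, Matrix.mul_apply]
  exact sum_congr rfl fun j _ => mul_comm _ _

/-- The Pfaffian sum of the standard symplectic matrix is positive: a permutation contributes only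
if it permutes the pairs, and then its sign cancels the product of the matrix entries. -/
theorem pairSum_standard_pos {V ι : Type*} [Fintype ι] [DecidableEq ι] (B : V → V → ℂ)
    (w : ι × Fin 2 → V) (h0 : ∀ i j b c, i ≠ j → B (w (i, b)) (w (j, c)) = 0)
    (h1 : ∀ i, B (w (i, 0)) (w (i, 1)) = 1) (h2 : ∀ i, B (w (i, 1)) (w (i, 0)) = -1) :
    ∃ N : ℕ, 0 < N ∧ pairSum (fun _ => B) w = N := by
  classical
  have term : ∀ σ : Equiv.Perm (ι × Fin 2), ((Equiv.Perm.sign σ : ℤ) •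
      ∏ i, B (w (σ (i, 0))) (w (σ (i, 1)))) = 0 ∨ ((Equiv.Perm.sign σ : ℤ) •
      ∏ i, B (w (σ (i, 0))) (w (σ (i, 1)))) = 1 := fun σ => by
    by_cases hσ : ∀ i, (σ (i, 0)).1 = (σ (i, 1)).1
    · right
      have hne : ∀ i, (σ (i, 0)).2 ≠ (σ (i, 1)).2 := fun i h => by
        have := σ.injective (Prod.ext (hσ i) h)
        simp at this
      -- `τ` undoes the exchanges inside the pairs, so that `σ * τ` permutes whole pairs
      let s : ι → Equiv.Perm (Fin 2) := fun i => if (σ (i, 0)).2 = 0 then 1 else Equiv.swap 0 1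
      have hs : ∀ i, B (w (σ (i, 0))) (w (σ (i, 1))) = ((Equiv.Perm.sign (s i) : ℤ) : ℂ) := fun i => by
        have e0 : σ (i, 0) = ((σ (i, 0)).1, (σ (i, 0)).2) := rfl
        have e1 : σ (i, 1) = ((σ (i, 0)).1, (σ (i, 1)).2) := Prod.ext (hσ i).symm rfl
        by_cases h : (σ (i, 0)).2 = 0
        · have h' : (σ (i, 1)).2 = 1 := by
            have := hne i
            omega
          rw [e0, e1, h, h', h1]
          simp [s, h]
        · have h' : (σ (i, 1)).2 = 0 := by
            have := hne i
            omega
          have h'' : (σ (i, 0)).2 = 1 := by omega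
          rw [e0, e1, h', h'', h2]
          simp [s, h]
      let τ : Equiv.Perm (ι × Fin 2) := Equiv.prodCongrRight s
      have hτ : ∀ i b, (σ * τ) (i, b) = ((σ (i, 0)).1, b) := fun i b => by
        change σ (i, s i b) = _
        have := hne i
        have := hσ i
        by_cases h : (σ (i, 0)).2 = 0
        · simp only [s, h, if_true, Equiv.Perm.one_apply]
          fin_cases b
          · exact Prod.ext rfl h
          · refine Prod.ext (hσ i).symm ?_
            change (σ (i, 1)).2 = 1
            omega
        · simp only [s, h, if_false]
          fin_cases b
          · refine Prod.ext (hσ i).symm ?_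
            change (σ (i, 1)).2 = 0
            omega
          · refine Prod.ext rfl ?_
            change (σ (i, 0)).2 = 1
            omega
      have hinj : Function.Injective fun i => (σ (i, 0)).1 := fun i j h => by
        have h' : (σ * τ) (i, 0) = (σ * τ) (j, 0) := by
          rw [hτ, hτ]
          exact Prod.ext h rfl
        exact congrArg Prod.fst ((σ * τ).injective h')
      let ρ : Equiv.Perm ι := Equiv.ofBijective _ (Finite.injective_iff_bijective.1 hinj)
      have hρ : σ * τ = Equiv.prodCongrLeft fun _ => ρ := by
        ext ⟨i, b⟩ : 1
        exact hτ i b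
      have hsign : Equiv.Perm.sign σ * Equiv.Perm.sign τ = 1 := by
        rw [← Equiv.Perm.sign_mul, hρ, Equiv.Perm.sign_prodCongrLeft, Fin.prod_univ_two,
          Int.units_mul_self]
      have hprod : ∏ i, B (w (σ (i, 0))) (w (σ (i, 1))) = ((Equiv.Perm.sign τ : ℤ) : ℂ) := by
        rw [Equiv.Perm.sign_prodCongrRight, prod_congr rfl fun i _ => hs i]
        push_cast
        rfl
      rw [hprod, zsmul_eq_mul, ← Int.cast_mul, ← Units.val_mul, hsign]
      simp
    · left
      push Not at hσ
      obtain ⟨i, hi⟩ := hσ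
      rw [prod_eq_zero (mem_univ i) (h0 _ _ _ _ hi), smul_zero]
  refine ⟨(univ.filter fun σ : Equiv.Perm (ι × Fin 2) => ((Equiv.Perm.sign σ : ℤ) •
      ∏ i, B (w (σ (i, 0))) (w (σ (i, 1)))) = 1).card, card_pos.2 ⟨1, ?_⟩, ?_⟩
  · simp [h1]
  · rw [card_filter, pairSum]
    push_cast
    refine sum_congr rfl fun σ _ => ?_
    split_ifs with h
    · exact h
    · exact (term σ).resolve_right h

end TopForms

/-! ### Hermitian linear algebra -/

section HermitianAlgebra

open scoped Matrix MatrixOrder ComplexOrder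

theorem exists_conjTranspose_mul_self {m 𝕜 : Type*} [Fintype m] [DecidableEq m] [RCLike 𝕜]
    {M : Matrix m m 𝕜} (hM : M.PosSemidef) : ∃ R : Matrix m m 𝕜, M = Rᴴ * R :=
  CStarAlgebra.nonneg_iff_eq_star_mul_self.mp hM.nonneg

theorem posDef_isUnit_det {m 𝕜 : Type*} [Fintype m] [DecidableEq m] [RCLike 𝕜]
    {M : Matrix m m 𝕜} (hM : M.PosDef) : IsUnit M.det :=
  isUnit_iff_ne_zero.2 hM.det_pos.ne'

/-- The trace of a positive semidefinite form with respect to a metric is nonnegative, and it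
vanishes only for the zero form. -/
theorem trace_inv_mul_nonneg {m : Type*} [Fintype m] [DecidableEq m] {M C : Matrix m m ℝ}
    (hM : M.PosDef) (hC : C.PosSemidef) :
    0 ≤ (M⁻¹ * C).trace ∧ ((M⁻¹ * C).trace = 0 → C = 0) := by
  obtain ⟨R, hR⟩ := exists_conjTranspose_mul_self hM.posSemidef.inv
  have hdet : IsUnit R.det := by
    have h := (Matrix.isUnit_nonsing_inv_det M (posDef_isUnit_det hM))
    rw [hR, Matrix.det_mul] at h
    exact isUnit_of_mul_isUnit_right h
  have hP : (R * C * Rᴴ).PosSemidef := hC.mul_mul_conjTranspose_same R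
  have ht : (M⁻¹ * C).trace = (R * C * Rᴴ).trace := by
    rw [hR, Matrix.mul_assoc, Matrix.trace_mul_comm]
  refine ⟨ht ▸ hP.trace_nonneg, fun h => ?_⟩
  have h0 := hP.trace_eq_zero_iff.1 (ht ▸ h)
  have hdet' : IsUnit (Rᴴ).det := by
    rw [Matrix.det_conjTranspose]
    exact hdet.star
  calc C = R⁻¹ * (R * C * Rᴴ) * Rᴴ⁻¹ := by
        rw [Matrix.mul_assoc R, ← Matrix.mul_assoc R⁻¹, Matrix.nonsing_inv_mul _ hdet,
          Matrix.one_mul, Matrix.mul_assoc, Matrix.mul_nonsing_inv _ hdet', Matrix.mul_one]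
    _ = 0 := by rw [h0, Matrix.mul_zero, Matrix.zero_mul]

variable {n : ℕ} (G : (Fin n → ℂ) →ₗ[ℝ] (Fin n → ℂ) →ₗ[ℝ] ℝ)

theorem posDef_gram (hs : ∀ v w, G v w = G w v) (hp : ∀ v, v ≠ 0 → 0 < G v v) :
    (Matrix.of fun i j => G (realFrame n i) (realFrame n j)).PosDef := by
  refine Matrix.PosDef.of_dotProduct_mulVec_pos ?_ fun x hx => ?_
  · ext i j
    simp [hs]
  · have h : star x ⬝ᵥ ((Matrix.of fun i j => G (realFrame n i) (realFrame n j)) *ᵥ x) =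
        G (∑ i, x i • realFrame n i) (∑ j, x j • realFrame n j) := by
      simp only [map_sum, LinearMap.sum_apply, map_smul, LinearMap.smul_apply, dotProduct,
        Matrix.mulVec, Matrix.of_apply, smul_eq_mul, star_trivial, mul_sum]
      rw [sum_comm]
      refine sum_congr rfl fun i _ => sum_congr rfl fun j _ => by ring
    rw [h]
    refine hp _ fun h0 => hx ?_
    rw [← coe_realBasis] at h0
    exact funext fun i => Fintype.linearIndependent_iff.1 (realBasis n).linearIndependent x h0 i

theorem posSemidef_gram (hs : ∀ v w, G v w = G w v) (hp : ∀ v, 0 ≤ G v v) :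
    (Matrix.of fun i j => G (realFrame n i) (realFrame n j)).PosSemidef := by
  refine Matrix.PosSemidef.of_dotProduct_mulVec_nonneg ?_ fun x => ?_
  · ext i j
    simp [hs]
  · have h : star x ⬝ᵥ ((Matrix.of fun i j => G (realFrame n i) (realFrame n j)) *ᵥ x) =
        G (∑ i, x i • realFrame n i) (∑ j, x j • realFrame n j) := by
      simp only [map_sum, LinearMap.sum_apply, map_smul, LinearMap.smul_apply, dotProduct,
        Matrix.mulVec, Matrix.of_apply, smul_eq_mul, star_trivial, mul_sum]
      rw [sum_comm]
      refine sum_congr rfl fun i _ => sum_congr rfl fun j _ => by ring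
    rw [h]
    exact hp _

/-- The matrix of multiplication by `i` in the real frame. -/
def rotationMatrix (n : ℕ) : Matrix (Fin (2 * n)) (Fin (2 * n)) ℝ :=
  Matrix.of fun k j => (realBasis n).repr (Complex.I • realFrame n j) k

theorem I_smul_realFrame (j : Fin (2 * n)) :
    Complex.I • realFrame n j = ∑ k, rotationMatrix n k j • realFrame n k := by
  have h := (realBasis n).sum_repr (Complex.I • realFrame n j)
  rw [coe_realBasis] at h
  exact h.symm

theorem rotationMatrix_mul_self : rotationMatrix n * rotationMatrix n = -1 := by
  ext k j
  have h : Complex.I • Complex.I • realFrame n j =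
      ∑ k, (rotationMatrix n * rotationMatrix n) k j • realFrame n k := by
    have h2 : ∀ (r : ℝ) (v : Fin n → ℂ), Complex.I • r • v = r • Complex.I • v :=
      fun r v => smul_comm _ _ _
    rw [I_smul_realFrame, smul_sum]
    simp only [h2, I_smul_realFrame, smul_sum, Matrix.mul_apply, sum_smul, smul_smul]
    rw [sum_comm]
    exact sum_congr rfl fun i _ => sum_congr rfl fun l _ => by rw [mul_comm]
  have h3 : (realBasis n).repr (Complex.I • Complex.I • realFrame n j) k =
      (rotationMatrix n * rotationMatrix n) k j := by
    rw [h, ← coe_realBasis]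
    simp [Finsupp.single_apply]
  rw [← h3, smul_smul, Complex.I_mul_I, neg_one_smul, map_neg, ← coe_realBasis,
    Module.Basis.repr_self]
  simp [Finsupp.single_apply, Matrix.one_apply, eq_comm]

variable {G} (hs : ∀ v w, G v w = G w v) (hp : ∀ v, v ≠ 0 → 0 < G v v)
  {W : Matrix (Fin (2 * n)) (Fin (2 * n)) ℝ}
  (hW : ∀ i j, W i j = G (Complex.I • realFrame n i) (realFrame n j))

include hW in
/-- The matrix of `ω(v, w) = G(iv, w)` is obtained from the Gram matrix of `G` by the matrix of
multiplication by `i`. -/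
theorem kahler_matrix_eq :
    W = (rotationMatrix n)ᵀ * Matrix.of fun i j => G (realFrame n i) (realFrame n j) := by
  ext i j
  rw [hW, I_smul_realFrame]
  simp [Matrix.mul_apply]

include hs hp hW in
theorem kahler_matrix_isUnit : IsUnit W.det := by
  rw [kahler_matrix_eq hW, Matrix.det_mul]
  refine IsUnit.mul ?_ (posDef_isUnit_det (posDef_gram G hs hp))
  rw [Matrix.det_transpose]
  have h := congrArg Matrix.det (rotationMatrix_mul_self (n := n))
  rw [Matrix.det_mul] at h
  refine isUnit_of_mul_isUnit_left (y := (rotationMatrix n).det) ?_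
  rw [h, Matrix.det_neg]
  simp

include hs hp hW in
/-- For a positive semidefinite symmetric form `C`, twice the contraction of the two-form
`-C(v, iw) + C(w, iv)` is the sum of the traces of `C` and of its pull-back by `i` with respect to
the metric. It is nonnegative, and it vanishes only for `C = 0`. -/
theorem contraction_nonneg (C : (Fin n → ℂ) →ₗ[ℝ] (Fin n → ℂ) →ₗ[ℝ] ℝ)
    (hCs : ∀ v w, C v w = C w v) (hCp : ∀ v, 0 ≤ C v v)
    {Ψ : Matrix (Fin (2 * n)) (Fin (2 * n)) ℝ}
    (hΨ : ∀ i j, Ψ i j = -C (realFrame n i) (Complex.I • realFrame n j) +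
      C (realFrame n j) (Complex.I • realFrame n i)) :
    0 ≤ ∑ i, ∑ j, W⁻¹ j i * Ψ i j ∧ (∑ i, ∑ j, W⁻¹ j i * Ψ i j = 0 → C = 0) := by
  set Gm := Matrix.of fun i j => G (realFrame n i) (realFrame n j) with hGm
  set Cm := Matrix.of fun i j => C (realFrame n i) (realFrame n j) with hCm
  set J := rotationMatrix n with hJ
  have hG : Gm.PosDef := posDef_gram G hs hp
  have hC : Cm.PosSemidef := posSemidef_gram C hCs hCp
  have hJJ : Jᵀ * Jᵀ = -1 := by
    rw [← Matrix.transpose_mul, rotationMatrix_mul_self]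
    simp
  have hCJ : ∀ i j, C (realFrame n i) (Complex.I • realFrame n j) = (Cm * J) i j := fun i j => by
    rw [I_smul_realFrame]
    simp only [map_sum, map_smul, Matrix.mul_apply, hCm, Matrix.of_apply, smul_eq_mul]
    exact sum_congr rfl fun k _ => mul_comm _ _
  have hCt : Cmᵀ = Cm := by
    ext i j
    exact hCs _ _
  have hΨ' : Ψ = -(Cm * J) + Jᵀ * Cm := by
    have h : Jᵀ * Cm = (Cm * J)ᵀ := by rw [Matrix.transpose_mul, hCt]
    ext i j
    rw [hΨ, hCJ, hCJ, h]
    rfl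
  have hWi : W⁻¹ = -(Gm⁻¹ * Jᵀ) := by
    refine Matrix.inv_eq_left_inv ?_
    rw [kahler_matrix_eq hW, Matrix.neg_mul, Matrix.mul_assoc, ← Matrix.mul_assoc Jᵀ, hJJ,
      Matrix.neg_mul, Matrix.one_mul, Matrix.mul_neg, neg_neg,
      Matrix.nonsing_inv_mul _ (posDef_isUnit_det hG)]
  have hsum : ∑ i, ∑ j, W⁻¹ j i * Ψ i j = (Gm⁻¹ * (Jᵀ * Cm * J)).trace + (Gm⁻¹ * Cm).trace := by
    have h1 : ∑ i, ∑ j, W⁻¹ j i * Ψ i j = (W⁻¹ * Ψ).trace := by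
      rw [sum_comm]
      rfl
    rw [h1, hWi, hΨ', ← Matrix.trace_add]
    congr 1
    rw [Matrix.mul_add, Matrix.neg_mul, Matrix.mul_neg, neg_neg, Matrix.neg_mul, Matrix.mul_assoc,
      Matrix.mul_assoc Gm⁻¹ Jᵀ, ← Matrix.mul_assoc Jᵀ Jᵀ, hJJ, Matrix.neg_mul, Matrix.one_mul,
      Matrix.mul_neg, neg_neg, Matrix.mul_assoc Jᵀ]
  have hC2 : (Jᵀ * Cm * J).PosSemidef := by
    have h := hC.conjTranspose_mul_mul_same J
    rwa [Matrix.conjTranspose_eq_transpose_of_trivial] at h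
  have p1 := trace_inv_mul_nonneg hG hC
  have p2 := trace_inv_mul_nonneg hG hC2
  rw [hsum]
  refine ⟨add_nonneg p2.1 p1.1, fun h => ?_⟩
  have h0 := p1.2 (by linarith [p1.1, p2.1])
  refine (realBasis n).ext fun i => (realBasis n).ext fun j => ?_
  have := congrFun (congrFun h0 i) j
  rw [coe_realBasis]
  simpa [hCm] using this

include hs hp in
/-- A hermitian metric is the pull-back of the standard one by a complex linear isomorphism. -/
theorem exists_unitary_coframe
    (hI : ∀ v w, G (Complex.I • v) (Complex.I • w) = G v w) :
    ∃ U : (Fin n → ℂ) →ₗ[ℂ] (Fin n → ℂ), LinearMap.det U ≠ 0 ∧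
      ∀ v w, G (Complex.I • v) w = (∑ k, star (U v k) * U w k).im := by
  have hI1 : ∀ v w, G (Complex.I • v) w = -G v (Complex.I • w) := fun v w => by
    rw [← hI v, smul_smul, Complex.I_mul_I, neg_one_smul, map_neg, neg_neg]
  have hc : ∀ (z : ℂ) (v : Fin n → ℂ), z • v = z.re • v + z.im • Complex.I • v := fun z v => by
    conv_lhs => rw [← Complex.re_add_im z, add_smul, mul_smul]
    simp only [Complex.coe_smul]
  let e : Fin n → Fin n → ℂ := fun k => Pi.single k 1
  let h : (Fin n → ℂ) → (Fin n → ℂ) → ℂ := fun v w => ⟨G v w, G (Complex.I • v) w⟩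
  have hr : ∀ v w (z : ℂ), h v (z • w) = z * h v w := fun v w z => by
    apply Complex.ext
    · simp only [h, hc z w, map_add, map_smul, smul_eq_mul, Complex.mul_re, hI1]
      ring
    · simp only [h, hc z w, map_add, map_smul, smul_eq_mul, Complex.mul_im, hI]
  have hl : ∀ v w (z : ℂ), h (z • v) w = star z * h v w := fun v w z => by
    have hz : Complex.I • z • v = z • Complex.I • v := smul_comm _ _ _
    apply Complex.ext
    · simp only [h, hc z v, map_add, map_smul, smul_eq_mul, Complex.mul_re, LinearMap.add_apply,
        LinearMap.smul_apply, Complex.star_def, Complex.conj_re, Complex.conj_im]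
      ring
    · simp only [h, hz, hc z (Complex.I • v), map_add, map_smul, smul_eq_mul, Complex.mul_im,
        LinearMap.add_apply, LinearMap.smul_apply, Complex.star_def, Complex.conj_re,
        Complex.conj_im, smul_smul Complex.I Complex.I, Complex.I_mul_I, neg_one_smul, map_neg,
        LinearMap.neg_apply]
      ring
  have hal : ∀ v v' w, h (v + v') w = h v w + h v' w := fun v v' w => by
    apply Complex.ext <;> simp [h]
  have har : ∀ v w w', h v (w + w') = h v w + h v w' := fun v w w' => by
    apply Complex.ext <;> simp [h]
  let hL : (Fin n → ℂ) → (Fin n → ℂ) →+ ℂ := fun w => AddMonoidHom.mk' (fun v => h v w) fun v v' => hal v v' w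
  let hR : (Fin n → ℂ) → (Fin n → ℂ) →+ ℂ := fun v => AddMonoidHom.mk' (fun w => h v w) fun w w' => har v w w'
  have expand : ∀ v : Fin n → ℂ, v = ∑ k, v k • e k := fun v => by
    ext j
    simp [e, Pi.single_apply]
  set H : Matrix (Fin n) (Fin n) ℂ := Matrix.of fun k l => h (e k) (e l) with hH
  have hform : ∀ v w, h v w = ∑ k, ∑ l, star (v k) * H k l * w l := fun v w => by
    have h1 : h v w = ∑ k, star (v k) * h (e k) w := by
      conv_lhs => rw [expand v]
      refine (map_sum (hL w) _ _).trans (sum_congr rfl fun k _ => hl _ _ _)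
    rw [h1]
    refine sum_congr rfl fun k _ => ?_
    have h2 : h (e k) w = ∑ l, w l * h (e k) (e l) := by
      conv_lhs => rw [expand w]
      refine (map_sum (hR (e k)) _ _).trans (sum_congr rfl fun l _ => hr _ _ _)
    rw [h2, mul_sum]
    exact sum_congr rfl fun l _ => by rw [hH, Matrix.of_apply]; ring
  have hpos : H.PosDef := by
    refine Matrix.PosDef.of_dotProduct_mulVec_pos ?_ fun x hx => ?_
    · ext k l
      rw [Matrix.conjTranspose_apply]
      apply Complex.ext
      · simp [hH, h, hs (e l)]
      · simp only [hH, h, Matrix.of_apply, Complex.star_def, Complex.conj_im]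
        rw [hI1, hs, neg_neg]
    · have h1 : star x ⬝ᵥ (H *ᵥ x) = h x x := by
        rw [hform]
        simp only [dotProduct, Matrix.mulVec, mul_sum, Pi.star_apply, mul_assoc]
      have h2 : G (Complex.I • x) x = 0 := by
        have := hI1 x x
        rw [hs x] at this
        linarith
      rw [h1, Complex.lt_def]
      exact ⟨hp x hx, h2.symm⟩
  obtain ⟨R, hR'⟩ := exists_conjTranspose_mul_self hpos.posSemidef
  refine ⟨Matrix.toLin' R, ?_, fun v w => ?_⟩
  · rw [LinearMap.det_toLin']
    have := posDef_isUnit_det hpos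
    rw [hR', Matrix.det_mul] at this
    exact (isUnit_of_mul_isUnit_right this).ne_zero
  · change (h v w).im = _
    congr 1
    rw [hform, hR']
    have h1 : ∀ m, star (Matrix.toLin' R v m) * Matrix.toLin' R w m =
        ∑ k, ∑ l, star (v k) * (star (R m k) * R m l) * w l := fun m => by
      simp only [Matrix.toLin'_apply, Matrix.mulVec, dotProduct, star_sum, star_mul', sum_mul_sum]
      exact sum_congr rfl fun k _ => sum_congr rfl fun l _ => by ring
    rw [sum_congr rfl fun m _ => h1 m]
    conv_rhs => rw [sum_comm]
    refine sum_congr rfl fun k _ => ?_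
    conv_rhs => rw [sum_comm]
    refine sum_congr rfl fun l _ => ?_
    rw [Matrix.mul_apply, mul_sum, sum_mul]
    rfl

include hs hp in
/-- The top power of the fundamental form of a hermitian metric is a positive volume form for the
complex orientation. -/
theorem exists_wedgePow_eq_pos
    (hI : ∀ v w, G (Complex.I • v) (Complex.I • w) = G v w)
    (B : (Fin n → ℂ) →ₗ[ℝ] (Fin n → ℂ) →ₗ[ℝ] ℂ) (hB : ∀ v, B v v = 0)
    (hBG : ∀ v w, B v w = G (Complex.I • v) w) :
    ∃ r : ℝ, 0 < r ∧ wedgePow (twoForm B hB) n (realFrame n) = r := by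
  obtain ⟨U, hU, hUG⟩ := exists_unitary_coframe hs hp hI
  let S : (Fin n → ℂ) →ₗ[ℝ] (Fin n → ℂ) →ₗ[ℝ] ℂ :=
    LinearMap.mk₂ ℝ (fun v w => (((∑ k, star (v k) * w k).im : ℝ) : ℂ))
      (fun v v' w => by simp [add_mul, sum_add_distrib])
      (fun c v w => by simp [mul_sum, mul_add, mul_assoc])
      (fun v w w' => by simp [mul_add, sum_add_distrib])
      (fun c v w => by simp [mul_sum, mul_left_comm])
  have hS : ∀ v, S v v = 0 := fun v => by
    change (((∑ k, star (v k) * v k).im : ℝ) : ℂ) = 0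
    rw [Complex.im_sum, sum_eq_zero, Complex.ofReal_zero]
    intro k _
    simp [mul_comm]
  let Ur : (Fin n → ℂ) →L[ℝ] (Fin n → ℂ) := LinearMap.toContinuousLinearMap (U.restrictScalars ℝ)
  have h1 : twoForm B hB = (twoForm S hS).compContinuousLinearMap Ur := by
    ext v
    change B (v 0) (v 1) = (((∑ k, star (U (v 0) k) * U (v 1) k).im : ℝ) : ℂ)
    rw [hBG, hUG]
  obtain ⟨N, hN, hSN⟩ := pairSum_standard_pos (fun x y => S x y)
    (fun p : Fin n × Fin 2 => realFrame n (pairEquiv n p))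
    (fun i j b c hij => by
      change (((∑ k, star (realFrame n (pairEquiv n (i, b)) k) *
        realFrame n (pairEquiv n (j, c)) k).im : ℝ) : ℂ) = 0
      rw [sum_eq_zero, Complex.zero_im, Complex.ofReal_zero]
      intro k _
      rw [realFrame_pairEquiv, realFrame_pairEquiv]
      by_cases hk : k = i
      · subst hk
        rw [Pi.single_eq_of_ne hij, mul_zero]
      · rw [Pi.single_eq_of_ne hk, star_zero, zero_mul])
    (fun i => by
      change (((∑ k, star (realFrame n (pairEquiv n (i, 0)) k) *
        realFrame n (pairEquiv n (i, 1)) k).im : ℝ) : ℂ) = 1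
      rw [sum_eq_single i, realFrame_pairEquiv, realFrame_pairEquiv]
      · simp
      · intro k _ hk
        rw [realFrame_pairEquiv, Pi.single_eq_of_ne hk, star_zero, zero_mul]
      · simp)
    (fun i => by
      change (((∑ k, star (realFrame n (pairEquiv n (i, 1)) k) *
        realFrame n (pairEquiv n (i, 0)) k).im : ℝ) : ℂ) = -1
      rw [sum_eq_single i, realFrame_pairEquiv, realFrame_pairEquiv]
      · simp
      · intro k _ hk
        rw [realFrame_pairEquiv, Pi.single_eq_of_ne hk, star_zero, zero_mul]
      · simp)
  have h2 : (2 : ℂ) ^ n * wedgePow (twoForm S hS) n (realFrame n) = N :=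
    (wedgePow_apply _ _ _).trans hSN
  have h3 : wedgePow (twoForm S hS) n (realFrame n) = ((N / 2 ^ n : ℝ) : ℂ) := by
    push_cast
    rw [eq_div_iff (by positivity), mul_comm, h2]
  have h4 : LinearMap.det (U.restrictScalars ℝ) = Complex.normSq (LinearMap.det U) := by
    rw [LinearMap.det_restrictScalars, Algebra.norm_complex_apply]
  refine ⟨Complex.normSq (LinearMap.det U) * (N / 2 ^ n),
    mul_pos (Complex.normSq_pos.2 hU) (by positivity), ?_⟩
  rw [h1, ← wedgePow_compContinuousLinearMap, Complex.ofReal_mul, ← h3, ← h4, ← topForm_map]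
  rfl

end HermitianAlgebra

/-! ### Smooth functions -/

section SmoothFunctions

variable {n : ℕ} {X : Type*} [TopologicalSpace X] [ChartedSpace (Fin n → ℂ) X]

variable (n) in
/-- Smooth complex functions on the underlying real manifold. -/
abbrev IsSmoothFun (f : X → ℂ) : Prop := ContMDiff (RealModel n) 𝓘(ℝ, ℂ) ∞ f

theorem IsSmoothFun.mul {f g : X → ℂ} (hf : IsSmoothFun n f) (hg : IsSmoothFun n g) :
    IsSmoothFun n fun x => f x * g x := fun x =>
  (contDiff_mul (𝕜 := ℝ) (𝔸 := ℂ) (n := ∞)).contDiffAt.contMDiffAt.comp x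
    ((hf x).prodMk_space (hg x))

theorem IsSmoothFun.add {f g : X → ℂ} (hf : IsSmoothFun n f) (hg : IsSmoothFun n g) :
    IsSmoothFun n fun x => f x + g x := fun x =>
  (contDiff_add (𝕜 := ℝ) (F := ℂ) (n := ∞)).contDiffAt.contMDiffAt.comp x
    ((hf x).prodMk_space (hg x))

theorem IsSmoothFun.const (c : ℂ) : IsSmoothFun n fun _ : X => c := contMDiff_const

theorem IsSmoothFun.sum {ι : Type*} (s : Finset ι) {f : ι → X → ℂ}
    (h : ∀ i ∈ s, IsSmoothFun n (f i)) : IsSmoothFun n fun x => ∑ i ∈ s, f i x := by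
  classical
  induction s using Finset.induction_on with
  | empty => simpa using IsSmoothFun.const (n := n) (X := X) 0
  | insert a s ha ih =>
    simp only [sum_insert ha]
    exact (h a (mem_insert_self a s)).add (ih fun i hi => h i (mem_insert_of_mem hi))

theorem IsSmoothFun.prod {ι : Type*} (s : Finset ι) {f : ι → X → ℂ}
    (h : ∀ i ∈ s, IsSmoothFun n (f i)) : IsSmoothFun n fun x => ∏ i ∈ s, f i x := by
  classical
  induction s using Finset.induction_on with
  | empty => simpa using IsSmoothFun.const (n := n) (X := X) 1
  | insert a s ha ih =>
    simp only [prod_insert ha]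
    exact (h a (mem_insert_self a s)).mul (ih fun i hi => h i (mem_insert_of_mem hi))

theorem IsSmoothFun.det {ι : Type*} [Fintype ι] [DecidableEq ι] {M : X → Matrix ι ι ℂ}
    (h : ∀ i j, IsSmoothFun n fun x => M x i j) : IsSmoothFun n fun x => (M x).det := by
  simp only [Matrix.det_apply']
  exact .sum _ fun σ _ => (IsSmoothFun.const _).mul (.prod _ fun i _ => h _ _)

theorem IsSmoothFun.adjugate {ι : Type*} [Fintype ι] [DecidableEq ι] {M : X → Matrix ι ι ℂ}
    (h : ∀ i j, IsSmoothFun n fun x => M x i j) (i j : ι) :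
    IsSmoothFun n fun x => (M x).adjugate i j := by
  simp only [Matrix.adjugate_apply]
  refine .det fun k l => ?_
  by_cases hk : k = j
  · subst hk
    simpa using IsSmoothFun.const _
  · simpa [Matrix.updateRow_ne hk] using h k l

theorem IsSmoothFun.ofReal {f : X → ℝ} (hf : ContMDiff (RealModel n) 𝓘(ℝ, ℝ) ∞ f) :
    IsSmoothFun n fun x => (f x : ℂ) :=
  Complex.ofRealCLM.contDiff.contMDiff.comp hf

end SmoothFunctions

/-! ### Resolutions of the identity of a hermitian bundle -/

section Resolution

variable {n : ℕ} {X : Type*} [TopologicalSpace X] [ChartedSpace (Fin n → ℂ) X]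
  {F : Type*} [NormedAddCommGroup F] [NormedSpace ℂ F]
  {E : X → Type*} [TopologicalSpace (TotalSpace F E)] [∀ x, NormedAddCommGroup (E x)]
  [∀ x, InnerProductSpace ℂ (E x)] [FiberBundle F E] [VectorBundle ℂ F E] [VectorBundle ℝ F E]

/-- The product of a smooth complex function and a smooth section. -/
def complexSmul (f : X → ℂ) (hf : IsSmoothFun n f) (s : SmoothSection n F E) :
    SmoothSection n F E :=
  ⟨fun x => f x • s x, IsSmooth.smul hf s.contMDiff⟩

theorem sum_apply_section {ι : Type*} (t : Finset ι) (s : ι → SmoothSection n F E) (x : X) :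
    (∑ i ∈ t, s i) x = ∑ i ∈ t, s i x := by
  have h0 : ∀ u : SmoothSection n F E,
      u x = ContMDiffSection.coeAddHom (RealModel n) F ∞ E u x := fun _ => rfl
  rw [h0, map_sum, Finset.sum_apply]
  rfl

variable [IsManifold (RealModel n) ∞ X] [ContMDiffVectorBundle ∞ F E (RealModel n)] [T2Space X]
  [FiniteDimensional ℂ F]

/-- Near every point, the identity of `E` is a sum of rank one endomorphisms `⟨tₖ, ·⟩ sₖ` with
globally smooth sections `sₖ`, `tₖ`: multiply a local frame by the inverse of its Gram matrix. -/
theorem exists_local_resolution (hE : IsSmoothHermitian n F E) (x₀ : X) :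
    ∃ (s t : Fin (Module.finrank ℂ F) × Fin (Module.finrank ℂ F) → SmoothSection n F E),
      ∀ᶠ x in nhds x₀, ∀ e : E x, ∑ k, (inner ℂ (t k x) e : ℂ) • s k x = e := by
  set r := Module.finrank ℂ F
  let b : Module.Basis (Fin r) ℂ F := Module.finBasis ℂ F
  set e := trivializationAt F E x₀ with he
  have hx₀ : x₀ ∈ e.baseSet := FiberBundle.mem_baseSet_trivializationAt F E x₀
  obtain ⟨χ, -, hχ⟩ := (SmoothBumpFunction.nhds_basis_tsupport (I := RealModel n) x₀).mem_iff.1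
    (e.open_baseSet.mem_nhds hx₀)
  have hfr : ∀ f : F, ContMDiffOn (RealModel n) ((RealModel n).prod 𝓘(ℝ, F)) ∞
      (fun x => TotalSpace.mk' F x (e.symm x f)) e.baseSet := fun f => by
    rw [e.contMDiffOn_section_baseSet_iff]
    refine (contMDiffOn_const (c := f)).congr fun y hy => ?_
    rw [e.apply_mk_symm hy]
  let σ : Fin r → SmoothSection n F E := fun i =>
    ⟨_, ContMDiffOn.smul_section_of_tsupport χ.contMDiff.contMDiffOn e.open_baseSet hχ (hfr (b i))⟩
  have hσ : ∀ i x, σ i x = χ x • e.symm x (b i) := fun _ _ => rfl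
  let G : X → Matrix (Fin r) (Fin r) ℂ := fun x => Matrix.gram ℂ fun i => σ i x
  have hG : ∀ i j, IsSmoothFun n fun x => G x i j := fun i j => hE (σ i) (σ j)
  have hd : IsSmoothFun n fun x => (G x).det := .det hG
  have hbasis : ∀ x ∈ e.baseSet, χ x = 1 → ∃ B : Module.Basis (Fin r) ℂ (E x), ∀ i, B i = σ i x :=
    fun x hx h1 => ⟨b.map (e.continuousLinearEquivAt ℂ x hx).symm.toLinearEquiv, fun i => by
      rw [hσ, h1, one_smul]
      rfl⟩
  have hdet : ∀ x ∈ e.baseSet, χ x = 1 → (G x).det ≠ 0 := fun x hx h1 => by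
    obtain ⟨B, hB⟩ := hbasis x hx h1
    refine Matrix.det_gram_ne_zero_iff_linearIndependent.2 ?_
    have := B.linearIndependent
    rwa [show ⇑B = fun i => σ i x from funext hB] at this
  obtain ⟨χ', -, hχ'⟩ := (SmoothBumpFunction.nhds_basis_tsupport (I := RealModel n) x₀).mem_iff.1
    ((isOpen_ne.preimage hd.continuous).mem_nhds (hdet x₀ hx₀ χ.eq_one))
  -- the inverse Gram matrix, cut off where the determinant may vanish
  let w : Fin r → Fin r → X → ℂ := fun i j x => (χ' x : ℂ) * ((G x).det⁻¹ * (G x).adjugate i j)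
  have hw : ∀ i j, IsSmoothFun n (w i j) := fun i j => by
    refine contMDiff_of_tsupport fun x hx => ?_
    have hx' : (G x).det ≠ 0 := hχ' (closure_mono (by
      intro z hz
      simp only [w, Function.mem_support] at hz ⊢
      intro h
      exact hz (by rw [h]; simp)) hx)
    have h1 : ContMDiffAt (RealModel n) 𝓘(ℝ, ℂ) ∞ (fun x => (G x).det⁻¹) x :=
      (contDiffAt_inv ℝ hx').contMDiffAt.comp x (hd x)
    have hm : ∀ {f g : X → ℂ}, ContMDiffAt (RealModel n) 𝓘(ℝ, ℂ) ∞ f x →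
        ContMDiffAt (RealModel n) 𝓘(ℝ, ℂ) ∞ g x →
        ContMDiffAt (RealModel n) 𝓘(ℝ, ℂ) ∞ (fun y => f y * g y) x := fun hf hg =>
      (contDiff_mul (𝕜 := ℝ) (𝔸 := ℂ) (n := ∞)).contDiffAt.contMDiffAt.comp x (hf.prodMk_space hg)
    exact hm (IsSmoothFun.ofReal χ'.contMDiff x) (hm h1 (IsSmoothFun.adjugate hG i j x))
  refine ⟨fun k => complexSmul (w k.2 k.1) (hw _ _) (σ k.2), fun k => σ k.1, ?_⟩
  filter_upwards [χ.eventuallyEq_one, χ'.eventuallyEq_one, e.open_baseSet.mem_nhds hx₀]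
    with x h1 h2 hx v
  simp only [Pi.one_apply] at h1 h2
  obtain ⟨B, hB⟩ := hbasis x hx h1
  have hdx := hdet x hx h1
  have hinv : (G x)⁻¹ * G x = 1 := Matrix.nonsing_inv_mul _ (isUnit_iff_ne_zero.2 hdx)
  have hwx : ∀ i j, w i j x = (G x)⁻¹ i j := fun i j => by
    simp only [w, h2, Complex.ofReal_one, one_mul]
    rw [Matrix.inv_def, Ring.inverse_eq_inv', Matrix.smul_apply, smul_eq_mul]
  have hin : ∀ i, (inner ℂ (σ i x) v : ℂ) = ∑ l, G x i l * B.repr v l := fun i => by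
    conv_lhs => rw [← B.sum_repr v]
    rw [inner_sum]
    refine sum_congr rfl fun l _ => ?_
    rw [inner_smul_right, hB, mul_comm]
    rfl
  rw [Fintype.sum_prod_type, sum_comm]
  conv_rhs => rw [← B.sum_repr v]
  refine sum_congr rfl fun j _ => ?_
  have h3 : ∀ i, (inner ℂ (σ i x) v : ℂ) • (complexSmul (w j i) (hw _ _) (σ j)) x =
      ((G x)⁻¹ j i * inner ℂ (σ i x) v : ℂ) • B j := fun i => by
    change (inner ℂ (σ i x) v : ℂ) • (w j i x • σ j x) = _
    rw [smul_smul, hwx, hB, mul_comm]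
  rw [sum_congr rfl fun i _ => h3 i, ← sum_smul]
  congr 1
  simp only [hin, mul_sum, ← mul_assoc]
  rw [sum_comm]
  simp only [← sum_mul, ← Matrix.mul_apply, hinv]
  simp [Matrix.one_apply]

/-- A hermitian bundle over a compact manifold is a direct summand of a trivial bundle: there are
finitely many smooth sections `sₖ`, `tₖ` with `∑ₖ ⟨tₖ, ·⟩ sₖ = Id`. -/
theorem exists_resolution [CompactSpace X] (hE : IsSmoothHermitian n F E) :
    ∃ (N : ℕ) (s t : Fin N → SmoothSection n F E),
      ∀ x (e : E x), ∑ k, (inner ℂ (t k x) e : ℂ) • s k x = e := by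
  classical
  choose s t h using exists_local_resolution (n := n) (F := F) (E := E) hE
  choose U hU hUo hxU using fun x₀ => eventually_nhds_iff.1 (h x₀)
  obtain ⟨T, hT⟩ := isCompact_univ.elim_finite_subcover U hUo fun x _ => Set.mem_iUnion.2 ⟨x, hxU x⟩
  obtain ⟨ρ, hρ⟩ := SmoothPartitionOfUnity.exists_isSubordinate (RealModel n) isClosed_univ
    (fun i : T => U i) (fun i => hUo i) (fun x hx => by
      obtain ⟨i, hi, hxi⟩ := Set.mem_iUnion₂.1 (hT hx)
      exact Set.mem_iUnion.2 ⟨⟨i, hi⟩, hxi⟩)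
  let K := Fin (Module.finrank ℂ F) × Fin (Module.finrank ℂ F)
  let ε := Fintype.equivFin (T × K)
  refine ⟨Fintype.card (T × K), fun k => complexSmul (fun x => (ρ (ε.symm k).1 x : ℂ))
    (IsSmoothFun.ofReal (ρ (ε.symm k).1).contMDiff) (s (ε.symm k).1 (ε.symm k).2),
    fun k => t (ε.symm k).1 (ε.symm k).2, fun x e => ?_⟩
  rw [← Equiv.sum_comp ε, Fintype.sum_prod_type]
  simp only [Equiv.symm_apply_apply]
  have h1 : ∀ i : T, ∑ k, (inner ℂ (t i k x) e : ℂ) • (complexSmul (fun x => (ρ i x : ℂ))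
      (IsSmoothFun.ofReal (ρ i).contMDiff) (s i k)) x = (ρ i x : ℂ) • e := fun i => by
    by_cases hx : ρ i x = 0
    · rw [hx, Complex.ofReal_zero, zero_smul]
      refine sum_eq_zero fun k _ => ?_
      change _ • ((ρ i x : ℂ) • s i k x) = _
      rw [hx, Complex.ofReal_zero, zero_smul, smul_zero]
    · have hxi : x ∈ U i := hρ i (subset_tsupport _ hx)
      conv_rhs => rw [← hU i x hxi e, smul_sum]
      refine sum_congr rfl fun k _ => ?_
      exact smul_comm _ _ _
  rw [sum_congr rfl fun i _ => h1 i, ← sum_smul, ← Complex.ofReal_sum]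
  have h2 := ρ.sum_eq_one (Set.mem_univ x)
  rw [finsum_eq_sum_of_fintype] at h2
  rw [h2, Complex.ofReal_one, one_smul]

end Resolution

/-! ### Smooth endomorphisms and their covariant derivatives -/

section Endomorphisms

variable {n : ℕ} {X : Type*} [TopologicalSpace X] [ChartedSpace (Fin n → ℂ) X]
  {F : Type*} [NormedAddCommGroup F] [NormedSpace ℂ F]
  {E : X → Type*} [TopologicalSpace (TotalSpace F E)] [∀ x, NormedAddCommGroup (E x)]
  [∀ x, InnerProductSpace ℂ (E x)] [FiberBundle F E] [VectorBundle ℂ F E] [VectorBundle ℝ F E]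

theorem mvfderiv_sum {ι : Type*} (u : Finset ι) {f : ι → X → ℂ} (x : X)
    (h : ∀ i ∈ u, MDifferentiableAt (RealModel n) 𝓘(ℝ, ℂ) (f i) x) :
    mvfderiv (RealModel n) (fun y => ∑ i ∈ u, f i y) x = ∑ i ∈ u, mvfderiv (RealModel n) (f i) x := by
  classical
  have key : MDifferentiableAt (RealModel n) 𝓘(ℝ, ℂ) (fun y => ∑ i ∈ u, f i y) x ∧
      mvfderiv (RealModel n) (fun y => ∑ i ∈ u, f i y) x =
        ∑ i ∈ u, mvfderiv (RealModel n) (f i) x := by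
    induction u using Finset.induction_on with
    | empty => exact ⟨by simpa using mdifferentiableAt_const, by
        simp only [sum_empty]
        exact mvfderiv_const 0⟩
    | insert a s ha ih =>
      have h1 := ih fun i hi => h i (mem_insert_of_mem hi)
      have h2 := h a (mem_insert_self a s)
      simp only [sum_insert ha]
      refine ⟨h2.add h1.1, ?_⟩
      rw [← h1.2]
      exact mvfderiv_add h2 h1.1
  exact key.2

theorem IsSmoothFun.mdifferentiableAt {f : X → ℂ} (hf : IsSmoothFun n f) (x : X) :
    MDifferentiableAt (RealModel n) 𝓘(ℝ, ℂ) f x :=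
  ContMDiff.mdifferentiableAt hf (by simp)

variable (n F E) in
/-- Finitely many global sections with `∑ₖ ⟨tₖ, ·⟩ sₖ = Id`, exhibiting `E` as a direct summand of
a trivial bundle. -/
structure Resolution where
  N : ℕ
  s : Fin N → SmoothSection n F E
  t : Fin N → SmoothSection n F E
  sum_eq : ∀ x (e : E x), ∑ k, (inner ℂ (t k x) e : ℂ) • s k x = e

variable (n F) in
/-- An endomorphism of `E` is smooth if it maps smooth sections to smooth sections. -/
def IsSmoothEnd (T : ∀ x, E x →ₗ[ℂ] E x) : Prop :=
  ∀ s : SmoothSection n F E, IsSmooth n F fun x => T x (s x)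

/-- The action of a smooth endomorphism on sections. -/
def endAct (T : ∀ x, E x →ₗ[ℂ] E x) (hT : IsSmoothEnd n F T) (s : SmoothSection n F E) :
    SmoothSection n F E := ⟨fun x => T x (s x), hT s⟩

theorem IsSmoothEnd.comp {S T : ∀ x, E x →ₗ[ℂ] E x} (hS : IsSmoothEnd n F S)
    (hT : IsSmoothEnd n F T) : IsSmoothEnd n F fun x => S x ∘ₗ T x := fun s =>
  hS (endAct T hT s)

namespace Resolution

variable (R : Resolution n F E)

include R in
theorem finite (x : X) : Module.Finite ℂ (E x) :=
  Module.Finite.of_surjective (∑ k, (LinearMap.proj k).smulRight (R.s k x) : (Fin R.N → ℂ) →ₗ[ℂ] E x)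
    fun e => ⟨fun k => inner ℂ (R.t k x) e, by
      simpa [LinearMap.sum_apply] using R.sum_eq x e⟩

/-- The trace of an endomorphism is `∑ₖ ⟨tₖ, T sₖ⟩`. -/
theorem trace_eq (x : X) (T : E x →ₗ[ℂ] E x) :
    LinearMap.trace ℂ (E x) T = ∑ k, (inner ℂ (R.t k x) (T (R.s k x)) : ℂ) := by
  have := R.finite x
  have h : T = ∑ k, ((innerₛₗ ℂ (R.t k x)).smulRight (T (R.s k x)) : E x →ₗ[ℂ] E x) := by
    ext e
    conv_lhs => rw [← R.sum_eq x e]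
    simp [LinearMap.sum_apply, map_sum]
  conv_lhs => rw [h, map_sum]
  refine sum_congr rfl fun k _ => ?_
  rw [LinearMap.trace_smulRight]
  rfl

/-- Every section is a combination of the `sₖ` with smooth coefficients. -/
theorem section_eq (hE : IsSmoothHermitian n F E) (s : SmoothSection n F E) :
    s = ∑ k, complexSmul (fun x => inner ℂ (R.t k x) (s x)) (hE (R.t k) s) (R.s k) := by
  ext x
  rw [sum_apply_section]
  exact (R.sum_eq x (s x)).symm

include R in
theorem isSmooth_trace (hE : IsSmoothHermitian n F E) {T : ∀ x, E x →ₗ[ℂ] E x}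
    (hT : IsSmoothEnd n F T) : IsSmoothFun n fun x => LinearMap.trace ℂ (E x) (T x) := by
  simp only [R.trace_eq]
  exact .sum _ fun k _ => hE (R.t k) (endAct T hT (R.s k))

end Resolution

theorem nonempty_resolution [IsManifold (RealModel n) ∞ X]
    [ContMDiffVectorBundle ∞ F E (RealModel n)] [T2Space X] [FiniteDimensional ℂ F]
    [CompactSpace X] (hE : IsSmoothHermitian n F E) : Nonempty (Resolution n F E) := by
  obtain ⟨N, s, t, h⟩ := exists_resolution hE
  exact ⟨⟨N, s, t, h⟩⟩

variable [IsManifold (RealModel n) ∞ X] [ContMDiffVectorBundle ∞ F E (RealModel n)]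

theorem isSmoothEnd_gauge (ζ : gaugeLieAlgebra n X F E) : IsSmoothEnd n F ζ.1 := ζ.2.2

theorem isSmoothEnd_oneForm (a : unitaryOneForms n X F E) (V : SmoothVectorField n X) :
    IsSmoothEnd n F fun x => a.1 x (V x) := a.2.2 V

theorem toFun_complexSmul (A : UnitaryConnection n X F E) {f : X → ℂ} (hf : IsSmoothFun n f)
    (s : SmoothSection n F E) (x : X) (v : TangentSpace (RealModel n) x) :
    A.toFun (complexSmul f hf s) x v = mvfderiv (RealModel n) f x v • s x + f x • A.toFun s x v :=
  A.leibniz f hf s x v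

theorem toFun_sum (A : UnitaryConnection n X F E) {ι : Type*} (u : Finset ι)
    (s : ι → SmoothSection n F E) (x : X) (v : TangentSpace (RealModel n) x) :
    A.toFun (∑ i ∈ u, s i) x v = ∑ i ∈ u, A.toFun (s i) x v := by
  let φ : SmoothSection n F E →+ E x := AddMonoidHom.mk' (fun s => A.toFun s x v) fun s t => by
    rw [A.add]
    rfl
  exact map_sum φ s u

variable (R : Resolution n F E) (hE : IsSmoothHermitian n F E)

include hE in
/-- The connection expressed through a resolution of the identity. -/
theorem toFun_eq_sum (A : UnitaryConnection n X F E) (s : SmoothSection n F E) (x : X)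
    (v : TangentSpace (RealModel n) x) :
    A.toFun s x v = ∑ k, (mvfderiv (RealModel n) (fun y => (inner ℂ (R.t k y) (s y) : ℂ)) x v • R.s k x +
      (inner ℂ (R.t k x) (s x) : ℂ) • A.toFun (R.s k) x v) := by
  conv_lhs => rw [R.section_eq hE s]
  rw [toFun_sum]
  exact sum_congr rfl fun k _ => toFun_complexSmul A _ _ x v

/-- The covariant derivative `[∇, T]` of a smooth endomorphism `T`, as an endomorphism-valued
one-form. -/
def covEnd (A : UnitaryConnection n X F E) (T : ∀ x, E x →ₗ[ℂ] E x) (hT : IsSmoothEnd n F T)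
    (x : X) : TangentSpace (RealModel n) x →ₗ[ℝ] (E x →ₗ[ℂ] E x) where
  toFun v := ∑ k, (innerₛₗ ℂ (R.t k x)).smulRight
    (A.toFun (endAct T hT (R.s k)) x v - T x (A.toFun (R.s k) x v))
  map_add' v w := by
    ext e
    simp only [map_add, LinearMap.add_apply, LinearMap.sum_apply, LinearMap.smulRight_apply,
      ← sum_add_distrib, ← smul_add]
    refine sum_congr rfl fun k _ => ?_
    congr 1
    abel
  map_smul' c v := by
    ext e
    simp only [map_smul, LinearMap.smul_apply, LinearMap.sum_apply, LinearMap.smulRight_apply,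
      smul_sum, RingHom.id_apply, LinearMap.map_smul_of_tower, ← smul_sub]
    exact sum_congr rfl fun k _ => smul_comm _ _ _

include hE in
/-- On sections `covEnd` is the commutator `[∇, T]`, because `Id = ∑ₖ ⟨tₖ, ·⟩ sₖ`. -/
theorem covEnd_apply (A : UnitaryConnection n X F E) {T : ∀ x, E x →ₗ[ℂ] E x}
    (hT : IsSmoothEnd n F T) (s : SmoothSection n F E) (x : X) (v : TangentSpace (RealModel n) x) :
    covEnd R A T hT x v (s x) = A.toFun (endAct T hT s) x v - T x (A.toFun s x v) := by
  have h1 : endAct T hT s = ∑ k, complexSmul (fun x => inner ℂ (R.t k x) (s x)) (hE (R.t k) s)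
      (endAct T hT (R.s k)) := by
    ext y
    rw [sum_apply_section]
    change T y (s y) = ∑ k, (inner ℂ (R.t k y) (s y) : ℂ) • T y (R.s k y)
    conv_lhs => rw [← R.sum_eq y (s y)]
    simp only [map_sum, map_smul]
  rw [h1, toFun_sum, toFun_eq_sum R hE A s, map_sum, ← sum_sub_distrib]
  change (∑ k, (innerₛₗ ℂ (R.t k x)).smulRight
    (A.toFun (endAct T hT (R.s k)) x v - T x (A.toFun (R.s k) x v))) (s x) = _
  rw [LinearMap.sum_apply]
  refine sum_congr rfl fun k _ => ?_
  rw [toFun_complexSmul, map_add, map_smul, map_smul]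
  change (inner ℂ (R.t k x) (s x) : ℂ) • (_ - _) = _ • T x (R.s k x) + _ - _
  rw [smul_sub]
  abel

variable [T2Space X] [FiniteDimensional ℂ F]

theorem exists_smoothSection_eq (x : X) (e : E x) : ∃ s : SmoothSection n F E, s x = e := by
  have : FiniteDimensional ℝ F := FiniteDimensional.complexToReal F
  exact exists_section_eq (n := n) (G := F) x e

include hE in
theorem covEnd_comp (A : UnitaryConnection n X F E) {S T : ∀ x, E x →ₗ[ℂ] E x}
    (hS : IsSmoothEnd n F S) (hT : IsSmoothEnd n F T) (x : X) (v : TangentSpace (RealModel n) x) :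
    covEnd R A _ (hS.comp hT) x v = covEnd R A S hS x v ∘ₗ T x + S x ∘ₗ covEnd R A T hT x v := by
  ext e
  obtain ⟨s, rfl⟩ := exists_smoothSection_eq (n := n) (F := F) x e
  have h1 := covEnd_apply R hE A hS (endAct T hT s) x v
  rw [LinearMap.add_apply, LinearMap.comp_apply, LinearMap.comp_apply, covEnd_apply R hE,
    covEnd_apply R hE, map_sub]
  change _ = covEnd R A S hS x v (endAct T hT s x) + _
  rw [h1]
  change A.toFun (endAct S hS (endAct T hT s)) x v - S x (T x (A.toFun s x v)) = _
  abel

include hE in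
/-- `d(tr T) = tr [∇, T]`. With `Id = ∑ ⟨tₖ, ·⟩ sₖ` the terms in which `∇` falls on `sₖ` or `tₖ` sum
to `tr(T ∘ ∇ Id) = 0`. -/
theorem mvfderiv_trace (A : UnitaryConnection n X F E) {T : ∀ x, E x →ₗ[ℂ] E x}
    (hT : IsSmoothEnd n F T) (x : X) (v : TangentSpace (RealModel n) x) :
    mvfderiv (RealModel n) (fun y => LinearMap.trace ℂ (E y) (T y)) x v =
      LinearMap.trace ℂ (E x) (covEnd R A T hT x v) := by
  have := R.finite x
  have h1 : (fun y => LinearMap.trace ℂ (E y) (T y)) =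
      fun y => ∑ k, (inner ℂ (R.t k y) (endAct T hT (R.s k) y) : ℂ) :=
    funext fun y => R.trace_eq y (T y)
  have h2 : mvfderiv (RealModel n) (fun y => LinearMap.trace ℂ (E y) (T y)) x v =
      ∑ k, ((inner ℂ (A.toFun (R.t k) x v) (T x (R.s k x)) : ℂ) +
        inner ℂ (R.t k x) (A.toFun (endAct T hT (R.s k)) x v)) := by
    rw [h1, mvfderiv_sum _ x fun k _ =>
      IsSmoothFun.mdifferentiableAt (hE (R.t k) (endAct T hT (R.s k))) x]
    refine (_root_.sum_apply _ _ _).trans (sum_congr rfl fun k _ => ?_)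
    exact A.metric (R.t k) (endAct T hT (R.s k)) x v
  have h3 : ∑ k, ((innerₛₗ ℂ (A.toFun (R.t k) x v)).smulRight (R.s k x) +
      (innerₛₗ ℂ (R.t k x)).smulRight (A.toFun (R.s k) x v) : E x →ₗ[ℂ] E x) = 0 := by
    ext e
    obtain ⟨s, rfl⟩ := exists_smoothSection_eq (n := n) (F := F) x e
    have h4 := toFun_eq_sum R hE A s x v
    have h5 := R.sum_eq x (A.toFun s x v)
    rw [LinearMap.zero_apply, ← sub_eq_zero.2 h4.symm, ← h5, LinearMap.sum_apply,
      ← sum_sub_distrib]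
    refine sum_congr rfl fun k _ => ?_
    rw [A.metric]
    simp only [LinearMap.add_apply, LinearMap.smulRight_apply, innerₛₗ_apply_apply, add_smul]
    abel
  have h7 : ∀ (f : E x →ₗ[ℂ] ℂ) (e : E x),
      LinearMap.trace ℂ (E x) (T x ∘ₗ f.smulRight e) = f (T x e) := fun f e => by
    have : T x ∘ₗ f.smulRight e = f.smulRight (T x e) := by
      ext
      simp
    rw [this, LinearMap.trace_smulRight]
  let φ : (E x →ₗ[ℂ] E x) →ₗ[ℂ] ℂ := LinearMap.trace ℂ (E x) ∘ₗ LinearMap.mulLeft ℂ (T x)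
  have h8 : ∀ f e, φ (LinearMap.smulRight f e) = f (T x e) := h7
  have h6 := congrArg φ h3
  rw [map_zero, map_sum] at h6
  simp only [map_add, h8, innerₛₗ_apply_apply] at h6
  rw [h2, R.trace_eq, ← sub_eq_zero, ← h6, ← sum_sub_distrib]
  refine sum_congr rfl fun k _ => ?_
  rw [covEnd_apply R hE, inner_sub_right]
  abel

end Endomorphisms

/-! ### Curvature -/

section Curvature

variable {n : ℕ} {X : Type*} [TopologicalSpace X] [ChartedSpace (Fin n → ℂ) X]
  {F : Type*} [NormedAddCommGroup F] [NormedSpace ℂ F]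
  {E : X → Type*} [TopologicalSpace (TotalSpace F E)] [∀ x, NormedAddCommGroup (E x)]
  [∀ x, InnerProductSpace ℂ (E x)] [FiberBundle F E] [VectorBundle ℂ F E] [VectorBundle ℝ F E]
  [IsManifold (RealModel n) ∞ X] [ContMDiffVectorBundle ∞ F E (RealModel n)]
  [T2Space X] [FiniteDimensional ℂ F]

theorem exists_smoothVectorField_eq (x : X) (v : TangentSpace (RealModel n) x) :
    ∃ V : SmoothVectorField n X, V x = v :=
  exists_section_eq (n := n) (G := Fin n → ℂ) x v

/-- The Lie bracket of two smooth vector fields. -/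
def bracket (V W : SmoothVectorField n X) : SmoothVectorField n X :=
  ⟨VectorField.mlieBracket (RealModel n) V W, fun x => by
    have i4 : IsManifold (RealModel n) (((⊤ : ℕ∞) : WithTop ℕ∞) + 1) X :=
      inferInstanceAs (IsManifold (RealModel n) ∞ X)
    have i3 : IsManifold (RealModel n) (minSmoothness ℝ 2) X := by
      rw [minSmoothness_of_isRCLikeNormedField]
      exact IsManifold.of_le (n := ∞) (WithTop.coe_le_coe.2 (le_top : (2 : ℕ∞) ≤ ⊤))
    exact ContMDiffAt.mlieBracket_vectorField (m := ⊤) (n := ⊤) (V.contMDiff x) (W.contMDiff x)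
      (by rw [minSmoothness_of_isRCLikeNormedField]; exact le_rfl)⟩

theorem curvature_apply (A : UnitaryConnection n X F E) (V W : SmoothVectorField n X)
    (s : SmoothSection n F E) (x : X) :
    A.curvature x (V x) (W x) (s x) = A.curvatureOp V W s x :=
  Classical.choose_spec A.exists_isCurvature V W s x

/-- The curvature as a bilinear map on the tangent space. -/
def curvatureBilin (A : UnitaryConnection n X F E) (x : X) :
    TangentSpace (RealModel n) x →ₗ[ℝ] TangentSpace (RealModel n) x →ₗ[ℝ] (E x →ₗ[ℂ] E x) := by
  have swap : ∀ v w, A.curvature x v w = -A.curvature x w v := fun v w => by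
    obtain ⟨V, rfl⟩ := exists_smoothVectorField_eq x v
    obtain ⟨W, rfl⟩ := exists_smoothVectorField_eq x w
    ext e
    obtain ⟨s, rfl⟩ := exists_smoothSection_eq (n := n) (F := F) x e
    rw [LinearMap.neg_apply, curvature_apply, curvature_apply, A.curvatureOp_swap]
  have hadd : ∀ v v' w, A.curvature x (v + v') w = A.curvature x v w + A.curvature x v' w :=
    fun v v' w => by
      obtain ⟨V, rfl⟩ := exists_smoothVectorField_eq x v
      obtain ⟨V', rfl⟩ := exists_smoothVectorField_eq x v'
      obtain ⟨W, rfl⟩ := exists_smoothVectorField_eq x w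
      ext e
      obtain ⟨s, rfl⟩ := exists_smoothSection_eq (n := n) (F := F) x e
      rw [LinearMap.add_apply, curvature_apply, curvature_apply, ← A.curvatureOp_add_left,
        ← curvature_apply]
      rfl
  have hsmul : ∀ (c : ℝ) v w, A.curvature x (c • v) w = c • A.curvature x v w :=
    fun c v w => by
      obtain ⟨V, rfl⟩ := exists_smoothVectorField_eq x v
      obtain ⟨W, rfl⟩ := exists_smoothVectorField_eq x w
      ext e
      obtain ⟨s, rfl⟩ := exists_smoothSection_eq (n := n) (F := F) x e
      rw [LinearMap.smul_apply, curvature_apply,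
        ← A.curvatureOp_functionSmul_left V W (f := fun _ => c) contMDiff_const s x,
        ← curvature_apply]
      rfl
  exact LinearMap.mk₂ ℝ (A.curvature x) hadd hsmul
    (fun v w w' => by rw [swap, hadd, neg_add, ← swap, ← swap])
    (fun c v w => by rw [swap, hsmul, ← smul_neg, ← swap])

theorem curvature_swap (A : UnitaryConnection n X F E) (x : X)
    (v w : TangentSpace (RealModel n) x) : A.curvature x v w = -A.curvature x w v := by
  obtain ⟨V, rfl⟩ := exists_smoothVectorField_eq x v
  obtain ⟨W, rfl⟩ := exists_smoothVectorField_eq x w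
  ext e
  obtain ⟨s, rfl⟩ := exists_smoothSection_eq (n := n) (F := F) x e
  rw [LinearMap.neg_apply, curvature_apply, curvature_apply, A.curvatureOp_swap]

theorem isSmooth_curvature (A : UnitaryConnection n X F E) (V W : SmoothVectorField n X) :
    IsSmoothEnd n F fun x => A.curvature x (V x) (W x) := fun s => by
  have h : (fun x => A.curvature x (V x) (W x) (s x)) = fun x =>
      (A.covariant V (A.covariant W s) - A.covariant W (A.covariant V s) -
        A.covariant (bracket V W) s) x := funext fun x => curvature_apply A V W s x
  unfold IsSmooth
  rw [h]
  exact ContMDiffSection.contMDiff _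

/-- It suffices to test skew-hermitian endomorphisms on real parts of inner products, by complex
linearity. -/
theorem isSkewHermitian_of_re {H : Type*} [NormedAddCommGroup H] [InnerProductSpace ℂ H]
    {T : H →ₗ[ℂ] H}
    (h : ∀ e f : H, (inner ℂ (T e) f : ℂ).re + (inner ℂ e (T f) : ℂ).re = 0) :
    IsSkewHermitian T := fun e f => by
  apply Complex.ext
  · rw [Complex.neg_re]
    linarith [h e f]
  · have h1 := h (Complex.I • e) f
    rw [map_smul, inner_smul_left, inner_smul_left] at h1
    simp at h1
    rw [Complex.neg_im]
    linarith

/-- The curvature of a unitary connection is skew-hermitian. -/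
theorem isSkewHermitian_curvature (hE : IsSmoothHermitian n F E) (A : UnitaryConnection n X F E)
    (x : X) (v w : TangentSpace (RealModel n) x) : IsSkewHermitian (A.curvature x v w) := by
  obtain ⟨V, rfl⟩ := exists_smoothVectorField_eq x v
  obtain ⟨W, rfl⟩ := exists_smoothVectorField_eq x w
  refine isSkewHermitian_of_re fun e e' => ?_
  obtain ⟨s, rfl⟩ := exists_smoothSection_eq (n := n) (F := F) x e
  obtain ⟨t, rfl⟩ := exists_smoothSection_eq (n := n) (F := F) x e'
  let B : SmoothSection n F E → SmoothSection n F E → X → ℝ := fun s t y => (inner ℂ (s y) (t y) : ℂ).re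
  have hB : ∀ s t, ContMDiff (RealModel n) 𝓘(ℝ, ℝ) ∞ (B s t) := fun s t =>
    Complex.reCLM.contDiff.contMDiff.comp (hE s t)
  have dB : ∀ s t y (u : TangentSpace (RealModel n) y), mvfderiv (RealModel n) (B s t) y u =
      (inner ℂ (A.toFun s y u) (t y) : ℂ).re + (inner ℂ (s y) (A.toFun t y u) : ℂ).re :=
    fun s t y u => by
      have h2 := mfderiv_comp_apply (I := RealModel n) (I' := 𝓘(ℝ, ℂ)) (I'' := 𝓘(ℝ, ℝ))
        (g := (Complex.reCLM : ℂ → ℝ)) (f := fun y => (inner ℂ (s y) (t y) : ℂ)) y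
        Complex.reCLM.mdifferentiableAt ((hE s t).mdifferentiableAt (by simp)) u
      rw [mfderiv_eq_fderiv, ContinuousLinearMap.fderiv] at h2
      have h3 := congrArg Complex.re (A.metric s t y u)
      rw [Complex.add_re] at h3
      exact h2.trans h3
  have ddB : ∀ U V : SmoothVectorField n X,
      mvfderiv (RealModel n) (fun y => mvfderiv (RealModel n) (B s t) y (V y)) x (U x) =
      (B (A.covariant U (A.covariant V s)) t x + B (A.covariant V s) (A.covariant U t) x) +
      (B (A.covariant U s) (A.covariant V t) x + B s (A.covariant U (A.covariant V t)) x) := fun U V => by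
    have h1 : (fun y => mvfderiv (RealModel n) (B s t) y (V y)) =
        fun y => B (A.covariant V s) t y + B s (A.covariant V t) y := funext fun y => dB s t y (V y)
    rw [h1, mvfderiv_fun_add ((hB _ _).mdifferentiableAt (by simp))
      ((hB _ _).mdifferentiableAt (by simp))]
    rw [_root_.add_apply, dB, dB]
    rfl
  have key := mvfderiv_mlieBracket (hB s t) V W x
  rw [ddB, ddB, dB] at key
  rw [curvature_apply, curvature_apply]
  unfold UnitaryConnection.curvatureOp
  simp only [inner_sub_left, inner_sub_right, Complex.sub_re]
  simp only [B] at key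
  linarith

variable (R : Resolution n F E) (hE : IsSmoothHermitian n F E)

/-- The covariant derivative `d_A ζ` of an element of the gauge Lie algebra. -/
def covGauge (A : UnitaryConnection n X F E) (ζ : gaugeLieAlgebra n X F E) :
    unitaryOneForms n X F E :=
  ⟨covEnd R A ζ.1 (isSmoothEnd_gauge ζ), fun x v e f => by
    obtain ⟨s, rfl⟩ := exists_smoothSection_eq (n := n) (F := F) x e
    obtain ⟨t, rfl⟩ := exists_smoothSection_eq (n := n) (F := F) x f
    have h1 := A.metric (endAct ζ.1 (isSmoothEnd_gauge ζ) s) t x v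
    have h2 := A.metric s (endAct ζ.1 (isSmoothEnd_gauge ζ) t) x v
    have h3 : (fun y => (inner ℂ (endAct ζ.1 (isSmoothEnd_gauge ζ) s y) (t y) : ℂ)) =
        -fun y => inner ℂ (s y) (endAct ζ.1 (isSmoothEnd_gauge ζ) t y) :=
      funext fun y => ζ.2.1 y (s y) (t y)
    rw [h3, mvfderiv_neg, _root_.neg_apply, h2] at h1
    have h4 := ζ.2.1 x (A.toFun s x v) (t x)
    have h5 := ζ.2.1 x (s x) (A.toFun t x v)
    rw [covEnd_apply R hE, covEnd_apply R hE, inner_sub_left, inner_sub_right, h4]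
    change -(inner ℂ (A.toFun s x v) (ζ.1 x (t x)) + _) = _ + inner ℂ (ζ.1 x (s x)) _ at h1
    rw [h5] at h1
    linear_combination -h1, fun V s => by
    have h : (fun x => covEnd R A ζ.1 (isSmoothEnd_gauge ζ) x (V x) (s x)) = fun x =>
        (A.covariant V (endAct ζ.1 (isSmoothEnd_gauge ζ) s) -
          endAct ζ.1 (isSmoothEnd_gauge ζ) (A.covariant V s)) x :=
      funext fun x => covEnd_apply R hE A _ s x (V x)
    unfold IsSmooth
    rw [h]
    exact ContMDiffSection.contMDiff _⟩

theorem covGauge_apply (A : UnitaryConnection n X F E) (ζ : gaugeLieAlgebra n X F E)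
    (s : SmoothSection n F E) (x : X) (v : TangentSpace (RealModel n) x) :
    (covGauge R hE A ζ).1 x v (s x) =
      A.toFun (endAct ζ.1 (isSmoothEnd_gauge ζ) s) x v - ζ.1 x (A.toFun s x v) :=
  covEnd_apply R hE A _ s x v

/-- `a ∧ a`, that is `(v, w) ↦ a(v) a(w) - a(w) a(v)`. -/
def oneFormSq (a : unitaryOneForms n X F E) (x : X) :
    TangentSpace (RealModel n) x →ₗ[ℝ] TangentSpace (RealModel n) x →ₗ[ℝ] (E x →ₗ[ℂ] E x) :=
  LinearMap.mk₂ ℝ (fun v w => a.1 x v ∘ₗ a.1 x w - a.1 x w ∘ₗ a.1 x v)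
    (fun v v' w => by rw [map_add, LinearMap.add_comp, LinearMap.comp_add]; abel)
    (fun c v w => by rw [map_smul, LinearMap.smul_comp, LinearMap.comp_smul, smul_sub])
    (fun v w w' => by rw [map_add, LinearMap.add_comp, LinearMap.comp_add]; abel)
    (fun c v w => by rw [map_smul, LinearMap.smul_comp, LinearMap.comp_smul, smul_sub])

/-- The exterior covariant derivative `d_A a` of an endomorphism-valued one-form, obtained as the
part of `F_(A + a)` linear in `a`. -/
def covOneForm (A : UnitaryConnection n X F E) (a : unitaryOneForms n X F E) (x : X) :
    TangentSpace (RealModel n) x →ₗ[ℝ] TangentSpace (RealModel n) x →ₗ[ℝ] (E x →ₗ[ℂ] E x) :=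
  curvatureBilin (a +ᵥ A) x - curvatureBilin A x - oneFormSq a x

include hE in
/-- The curvature of `A + a` is `F_A + d_A a + a ∧ a`, where `d_A a` is given by Cartan's
formula. -/
theorem curvature_vadd (A : UnitaryConnection n X F E) (a : unitaryOneForms n X F E)
    (V W : SmoothVectorField n X) (x : X) :
    (a +ᵥ A).curvature x (V x) (W x) = A.curvature x (V x) (W x) +
      (covEnd R A _ (isSmoothEnd_oneForm a W) x (V x) -
        covEnd R A _ (isSmoothEnd_oneForm a V) x (W x) -
        a.1 x (VectorField.mlieBracket (RealModel n) V W x)) + oneFormSq a x (V x) (W x) := by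
  ext e
  obtain ⟨s, rfl⟩ := exists_smoothSection_eq (n := n) (F := F) x e
  have h1 : ∀ (U : SmoothVectorField n X) (t : SmoothSection n F E),
      (a +ᵥ A).covariant U t = A.covariant U t + endAct _ (isSmoothEnd_oneForm a U) t :=
    fun U t => rfl
  have h2 : ∀ (U : SmoothVectorField n X) (t u : SmoothSection n F E),
      A.covariant U (t + u) x = A.covariant U t x + A.covariant U u x := fun U t u => by
    rw [A.covariant_add_right]
    rfl
  have h3 : ∀ t u : SmoothSection n F E, (t + u) x = t x + u x := fun _ _ => rfl
  have h4 : ∀ (U : SmoothVectorField n X) (t : SmoothSection n F E),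
      endAct _ (isSmoothEnd_oneForm a U) t x = a.1 x (U x) (t x) := fun _ _ => rfl
  have h5 : ∀ (t : SmoothSection n F E) (u : TangentSpace (RealModel n) x),
      (a +ᵥ A).toFun t x u = A.toFun t x u + a.1 x u (t x) := fun _ _ => rfl
  have h6 : ∀ (U : SmoothVectorField n X) (t : SmoothSection n F E),
      A.covariant U t x = A.toFun t x (U x) := fun _ _ => rfl
  have h7 : oneFormSq a x (V x) (W x) (s x) =
      a.1 x (V x) (a.1 x (W x) (s x)) - a.1 x (W x) (a.1 x (V x) (s x)) := rfl
  simp only [LinearMap.add_apply, LinearMap.sub_apply, covEnd_apply R hE, h7]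
  rw [curvature_apply, curvature_apply]
  unfold UnitaryConnection.curvatureOp
  rw [h5]
  simp only [h1, h2, h3, h4, map_add]
  simp only [h6]
  abel

include hE in
/-- Cartan's formula for the exterior covariant derivative `d_A a`. -/
theorem covOneForm_apply (A : UnitaryConnection n X F E) (a : unitaryOneForms n X F E)
    (V W : SmoothVectorField n X) (x : X) :
    covOneForm A a x (V x) (W x) = covEnd R A _ (isSmoothEnd_oneForm a W) x (V x) -
        covEnd R A _ (isSmoothEnd_oneForm a V) x (W x) -
        a.1 x (VectorField.mlieBracket (RealModel n) V W x) := by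
  change (a +ᵥ A).curvature x (V x) (W x) - A.curvature x (V x) (W x) -
    oneFormSq a x (V x) (W x) = _
  rw [curvature_vadd R hE]
  abel

include hE in
theorem covEnd_smul (A : UnitaryConnection n X F E) (a : unitaryOneForms n X F E) (r : ℝ)
    (W : SmoothVectorField n X) (x : X) (v : TangentSpace (RealModel n) x) :
    covEnd R A _ (isSmoothEnd_oneForm (r • a) W) x v =
      r • covEnd R A _ (isSmoothEnd_oneForm a W) x v := by
  ext e
  obtain ⟨s, rfl⟩ := exists_smoothSection_eq (n := n) (F := F) x e
  have h1 : endAct _ (isSmoothEnd_oneForm (r • a) W) s =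
      complexSmul (fun _ => (r : ℂ)) (IsSmoothFun.const _) (endAct _ (isSmoothEnd_oneForm a W) s) := by
    ext y
    exact (Complex.coe_smul r _).symm
  have h2 : ∀ u : E x, (r • a).1 x (W x) u = r • a.1 x (W x) u := fun _ => rfl
  rw [LinearMap.smul_apply, covEnd_apply R hE, covEnd_apply R hE, h1, toFun_complexSmul,
    mvfderiv_const, h2, smul_sub, ← Complex.coe_smul r, ← Complex.coe_smul r]
  simp

include R hE in
/-- `F_(A + ta) = F_A + t d_A a + t² a ∧ a`. -/
theorem curvature_smul_vadd (A : UnitaryConnection n X F E) (a : unitaryOneForms n X F E) (r : ℝ)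
    (x : X) (v w : TangentSpace (RealModel n) x) :
    ((r • a) +ᵥ A).curvature x v w = A.curvature x v w + r • covOneForm A a x v w +
      (r ^ 2) • oneFormSq a x v w := by
  obtain ⟨V, rfl⟩ := exists_smoothVectorField_eq x v
  obtain ⟨W, rfl⟩ := exists_smoothVectorField_eq x w
  have h1 : ∀ u : TangentSpace (RealModel n) x, (r • a).1 x u = r • a.1 x u := fun _ => rfl
  have h2 : oneFormSq (r • a) x (V x) (W x) = (r ^ 2) • oneFormSq a x (V x) (W x) := by
    change (r • a.1 x (V x)) ∘ₗ (r • a.1 x (W x)) - (r • a.1 x (W x)) ∘ₗ (r • a.1 x (V x)) =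
      (r ^ 2) • (a.1 x (V x) ∘ₗ a.1 x (W x) - a.1 x (W x) ∘ₗ a.1 x (V x))
    simp only [LinearMap.smul_comp, LinearMap.comp_smul, smul_smul, smul_sub, sq]
  rw [curvature_vadd R hE, covOneForm_apply R hE, covEnd_smul R hE, covEnd_smul R hE, h1, h2,
    smul_sub, smul_sub]

/-- `F_(u · A) = u F_A u⁻¹`. -/
theorem curvature_smul (u : unitaryGaugeGroup n X F E) (A : UnitaryConnection n X F E) (x : X)
    (v w : TangentSpace (RealModel n) x) :
    (u • A).curvature x v w = (u.1 x).toLinearEquiv.conj (A.curvature x v w) := by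
  obtain ⟨V, rfl⟩ := exists_smoothVectorField_eq x v
  obtain ⟨W, rfl⟩ := exists_smoothVectorField_eq x w
  ext e
  obtain ⟨s, rfl⟩ := exists_smoothSection_eq (n := n) (F := F) x e
  have h1 : ∀ (U : SmoothVectorField n X) (t : SmoothSection n F E),
      (u • A).covariant U t = gaugeAct u (A.covariant U (gaugeAct u⁻¹ t)) := fun _ _ => rfl
  have h2 : ∀ t : SmoothSection n F E, gaugeAct u⁻¹ (gaugeAct u t) = t := fun t => by
    ext y
    exact (u.1 y).symm_apply_apply (t y)
  have h3 : ∀ (t : SmoothSection n F E), gaugeAct u t x = u.1 x (t x) := fun _ => rfl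
  have h4 : ∀ (t : SmoothSection n F E) (z : TangentSpace (RealModel n) x),
      (u • A).toFun t x z = u.1 x (A.toFun (gaugeAct u⁻¹ t) x z) := fun _ _ => rfl
  have h5 : (u.1 x).toLinearEquiv.conj (A.curvature x (V x) (W x)) (s x) =
      u.1 x (A.curvature x (V x) (W x) (gaugeAct u⁻¹ s x)) := rfl
  rw [h5, curvature_apply, curvature_apply]
  unfold UnitaryConnection.curvatureOp
  simp only [h1, h2, h3, h4, map_sub]

include hE in
/-- `d tr(ζ a) = tr(d_A ζ ∧ a) + tr(ζ d_A a)`, evaluated on vector fields. -/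
theorem traceWedge_covGauge_add (A : UnitaryConnection n X F E) (ζ : gaugeLieAlgebra n X F E)
    (a : unitaryOneForms n X F E) (V W : SmoothVectorField n X) (x : X) :
    traceWedge (covGauge R hE A ζ) a x ![V x, W x] +
        LinearMap.trace ℂ (E x) (ζ.1 x ∘ₗ covOneForm A a x (V x) (W x)) =
      mvfderiv (RealModel n) (fun y => LinearMap.trace ℂ (E y) (ζ.1 y ∘ₗ a.1 y (W y))) x (V x) -
      mvfderiv (RealModel n) (fun y => LinearMap.trace ℂ (E y) (ζ.1 y ∘ₗ a.1 y (V y))) x (W x) -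
      LinearMap.trace ℂ (E x) (ζ.1 x ∘ₗ a.1 x (VectorField.mlieBracket (RealModel n) V W x)) := by
  have h1 : ∀ U : SmoothVectorField n X, IsSmoothEnd n F fun y => ζ.1 y ∘ₗ a.1 y (U y) :=
    fun U => (isSmoothEnd_gauge ζ).comp (isSmoothEnd_oneForm a U)
  have h2 : traceWedge (covGauge R hE A ζ) a x ![V x, W x] =
      LinearMap.trace ℂ (E x) (covEnd R A ζ.1 (isSmoothEnd_gauge ζ) x (V x) ∘ₗ a.1 x (W x)) -
      LinearMap.trace ℂ (E x) (covEnd R A ζ.1 (isSmoothEnd_gauge ζ) x (W x) ∘ₗ a.1 x (V x)) := rfl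
  rw [mvfderiv_trace R hE A (h1 W), mvfderiv_trace R hE A (h1 V),
    covEnd_comp R hE A (isSmoothEnd_gauge ζ) (isSmoothEnd_oneForm a W),
    covEnd_comp R hE A (isSmoothEnd_gauge ζ) (isSmoothEnd_oneForm a V), h2,
    covOneForm_apply R hE]
  simp only [LinearMap.comp_sub, map_sub, map_add]
  ring

end Curvature

theorem differentiableAt_fderiv_smul {V V' : Type*} [NormedAddCommGroup V] [NormedSpace ℝ V]
    [NormedAddCommGroup V'] [NormedSpace ℝ V'] {f : V → V'} (hf : ContDiff ℝ ∞ f) (z q : V) :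
    DifferentiableAt ℝ (fun t : ℝ => fderiv ℝ f (t • z) q) 0 := by
  have h6 : Differentiable ℝ (fderiv ℝ f) :=
    (hf.fderiv_right (m := 1) (WithTop.coe_le_coe.2 (le_top : (1 + 1 : ℕ∞) ≤ ⊤))).differentiable
      (by simp)
  have h7 : DifferentiableAt ℝ (fun t : ℝ => fderiv ℝ f (t • z)) 0 :=
    DifferentiableAt.comp (𝕜 := ℝ) (0 : ℝ) (h6 _) (by fun_prop)
  exact h7.clm_apply (differentiableAt_const q)

/-! ### Exponentials of endomorphisms -/

section Exponential

variable {H : Type*} [NormedAddCommGroup H] [NormedSpace ℂ H] [CompleteSpace H]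

theorem exp_add_smul (z : H →L[ℂ] H) (s t : ℝ) :
    NormedSpace.exp ((s + t) • z) = NormedSpace.exp (s • z) * NormedSpace.exp (t • z) := by
  let _ : NormedAlgebra ℚ (H →L[ℂ] H) := NormedAlgebra.restrictScalars ℚ ℝ (H →L[ℂ] H)
  rw [add_smul]
  exact NormedSpace.exp_add_of_commute (((Commute.refl z).smul_left s).smul_right t)

theorem exp_zero_smul (z : H →L[ℂ] H) : NormedSpace.exp ((0 : ℝ) • z) = 1 := by
  rw [zero_smul, NormedSpace.exp_zero]

theorem exp_smul_exp_neg_smul (z : H →L[ℂ] H) (t : ℝ) (e : H) :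
    NormedSpace.exp (t • z) (NormedSpace.exp ((-t) • z) e) = e := by
  have h := exp_add_smul z t (-t)
  rw [add_neg_cancel, exp_zero_smul] at h
  exact (DFunLike.congr_fun h e).symm

theorem exp_neg_smul_exp_smul (z : H →L[ℂ] H) (t : ℝ) (e : H) :
    NormedSpace.exp ((-t) • z) (NormedSpace.exp (t • z) e) = e := by
  have h := exp_smul_exp_neg_smul z (-t) e
  rwa [neg_neg] at h

theorem hasDerivAt_exp_smul_apply (z : H →L[ℂ] H) (e : H) (t : ℝ) :
    HasDerivAt (fun t : ℝ => NormedSpace.exp (t • z) e) (z (NormedSpace.exp (t • z) e)) t :=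
  (((ContinuousLinearMap.apply ℂ H e).restrictScalars ℝ).hasFDerivAt).comp_hasDerivAt t
    (hasDerivAt_exp_smul_const' z t)

/-- The solutions of `y' = z y` are `y(t) = exp(tz) y(0)`. -/
theorem eq_exp_smul_apply (z : H →L[ℂ] H) {y : ℝ → H} (hy : ∀ t, HasDerivAt y (z (y t)) t)
    (t : ℝ) : y t = NormedSpace.exp (t • z) (y 0) := by
  have h := ODE_solution_unique_univ (v := fun _ e => z e) (s := fun _ => Set.univ)
    (K := ‖z‖₊) (t₀ := 0) (f := y) (g := fun t => NormedSpace.exp (t • z) (y 0))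
    (fun _ => z.lipschitz.lipschitzOnWith) (fun t => ⟨hy t, trivial⟩)
    (fun t => ⟨hasDerivAt_exp_smul_apply z (y 0) t, trivial⟩) (by
      rw [exp_zero_smul]
      rfl)
  exact congrFun h t

/-- Regard complex linear endomorphisms as real linear ones. -/
abbrev realEnd (H : Type*) [NormedAddCommGroup H] [NormedSpace ℂ H] :
    (H →L[ℂ] H) →L[ℝ] (H →L[ℝ] H) :=
  ContinuousLinearMap.restrictScalarsL ℂ H H ℝ ℝ

theorem contDiff_exp : ContDiff ℝ ∞ (NormedSpace.exp : (H →L[ℂ] H) → (H →L[ℂ] H)) := by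
  have : AnalyticOnNhd ℝ (NormedSpace.exp : (H →L[ℂ] H) → (H →L[ℂ] H)) Set.univ :=
    fun x _ => NormedSpace.exp_analytic x
  exact this.contDiff

/-- The map `(z, w) ↦ exp(tz) w`. -/
def expApply (H : Type*) [NormedAddCommGroup H] [NormedSpace ℂ H] (t : ℝ)
    (p : (H →L[ℂ] H) × H) : H :=
  realEnd H (NormedSpace.exp (t • p.1)) p.2

/-- The map `(z, w) ↦ zw`. -/
def endApply (H : Type*) [NormedAddCommGroup H] [NormedSpace ℂ H] (p : (H →L[ℂ] H) × H) : H :=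
  realEnd H p.1 p.2

theorem contDiff_expApply (t : ℝ) : ContDiff ℝ ∞ (expApply H t) := by
  have h1 : ContDiff ℝ ∞ fun p : (H →L[ℂ] H) × H => NormedSpace.exp (t • p.1) :=
    contDiff_exp.comp (contDiff_fst.const_smul t)
  exact ((realEnd H).contDiff.comp h1).clm_apply contDiff_snd

theorem contDiff_endApply : ContDiff ℝ ∞ (endApply H) :=
  ((realEnd H).contDiff.comp contDiff_fst).clm_apply contDiff_snd

theorem fderiv_endApply (p q : (H →L[ℂ] H) × H) :
    fderiv ℝ (endApply H) p q = q.1 p.2 + p.1 q.2 := by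
  have h1 : HasFDerivAt (fun p : (H →L[ℂ] H) × H => realEnd H p.1)
      ((realEnd H) ∘L (ContinuousLinearMap.fst ℝ (H →L[ℂ] H) H)) p :=
    ((realEnd H) ∘L (ContinuousLinearMap.fst ℝ (H →L[ℂ] H) H)).hasFDerivAt
  have h := h1.clm_apply (hasFDerivAt_snd (𝕜 := ℝ) (p := p))
  have h2 := h.fderiv
  change fderiv ℝ (endApply H) p = _ at h2
  rw [h2]
  exact add_comm _ _

/-- At `t = 0` the derivative of the differential of `(z, w) ↦ exp(tz) w` is the differential of
`(z, w) ↦ zw`. -/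
theorem hasDerivAt_fderiv_expApply (p q : (H →L[ℂ] H) × H) :
    HasDerivAt (fun t : ℝ => fderiv ℝ (expApply H t) p q) (fderiv ℝ (endApply H) p q) 0 := by
  have hexp : ∀ z : H →L[ℂ] H, DifferentiableAt ℝ NormedSpace.exp z := fun z =>
    (contDiff_exp (H := H)).differentiable (by simp) z
  have h1 : ∀ t : ℝ, fderiv ℝ (expApply H t) p q =
      t • realEnd H (fderiv ℝ NormedSpace.exp (t • p.1) q.1) p.2 +
        NormedSpace.exp (t • p.1) q.2 := fun t => by
    have h2 : HasFDerivAt (fun p : (H →L[ℂ] H) × H => NormedSpace.exp (t • p.1))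
        ((fderiv ℝ NormedSpace.exp (t • p.1)) ∘L (t • ContinuousLinearMap.fst ℝ (H →L[ℂ] H) H)) p :=
      HasFDerivAt.comp p (hexp _).hasFDerivAt
        (t • ContinuousLinearMap.fst ℝ (H →L[ℂ] H) H).hasFDerivAt
    have h3 := ((realEnd H).hasFDerivAt.comp p h2).clm_apply (hasFDerivAt_snd (𝕜 := ℝ) (p := p))
    have h4 := h3.fderiv
    change fderiv ℝ (expApply H t) p = _ at h4
    rw [h4]
    change NormedSpace.exp (t • p.1) q.2 +
      realEnd H (fderiv ℝ NormedSpace.exp (t • p.1) (t • q.1)) p.2 = _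
    rw [map_smul, map_smul, add_comm]
    rfl
  have h5 : DifferentiableAt ℝ (fun t : ℝ =>
      realEnd H (fderiv ℝ NormedSpace.exp (t • p.1) q.1) p.2) 0 := by
    have h8 := differentiableAt_fderiv_smul (contDiff_exp (H := H)) p.1 q.1
    exact ((realEnd H).differentiableAt.comp (0 : ℝ) h8).clm_apply (differentiableAt_const p.2)
  have h9 := ((hasDerivAt_id (0 : ℝ)).smul h5.hasDerivAt).add
    (hasDerivAt_exp_smul_apply p.1 q.2 0)
  rw [fderiv_endApply]
  simp only [h1]
  convert! h9 using 1
  have h10 : fderiv ℝ (NormedSpace.exp : (H →L[ℂ] H) → (H →L[ℂ] H)) 0 = 1 :=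
    hasFDerivAt_exp_zero.fderiv
  rw [exp_zero_smul]
  simp only [id_eq, zero_smul, h10, one_smul, zero_add]
  rfl

end Exponential

section Unitary

variable {H : Type*} [NormedAddCommGroup H] [InnerProductSpace ℂ H] [CompleteSpace H]

/-- The exponential of a skew-hermitian endomorphism is unitary. -/
theorem inner_exp_smul {z : H →L[ℂ] H} (hz : IsSkewHermitian (z : H →ₗ[ℂ] H)) (t : ℝ) (e f : H) :
    (inner ℂ (NormedSpace.exp (t • z) e) (NormedSpace.exp (t • z) f) : ℂ) = inner ℂ e f := by
  have h : ∀ t, HasDerivAt (fun t : ℝ =>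
      (inner ℂ (NormedSpace.exp (t • z) e) (NormedSpace.exp (t • z) f) : ℂ)) 0 t := fun t => by
    have h1 := (hasDerivAt_exp_smul_apply z e t).inner ℂ (hasDerivAt_exp_smul_apply z f t)
    convert! h1 using 1
    have h2 := hz (NormedSpace.exp (t • z) e) (NormedSpace.exp (t • z) f)
    change inner ℂ (z _) _ = -inner ℂ _ (z _) at h2
    rw [h2, add_neg_cancel]
  have h3 := is_const_of_deriv_eq_zero (fun t => (h t).differentiableAt)
    (fun t => (h t).deriv) t 0
  simp only [exp_zero_smul] at h3
  exact h3

/-- The exponential of a skew-hermitian endomorphism as a unitary transformation. -/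
def expIsometry (z : H →L[ℂ] H) (hz : IsSkewHermitian (z : H →ₗ[ℂ] H)) (t : ℝ) : H ≃ₗᵢ[ℂ] H where
  toLinearEquiv := LinearEquiv.ofLinearMap (NormedSpace.exp (t • z) : H →L[ℂ] H).toLinearMap
    (NormedSpace.exp ((-t) • z) : H →L[ℂ] H).toLinearMap
    (LinearMap.ext fun e => exp_smul_exp_neg_smul z t e)
    (LinearMap.ext fun e => exp_neg_smul_exp_smul z t e)
  norm_map' e := by
    have h := inner_exp_smul hz t e e
    rw [inner_self_eq_norm_sq_to_K, inner_self_eq_norm_sq_to_K] at h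
    have h1 : ‖NormedSpace.exp (t • z) e‖ ^ 2 = ‖e‖ ^ 2 := by exact_mod_cast h
    exact (sq_eq_sq₀ (norm_nonneg _) (norm_nonneg _)).1 h1

end Unitary

/-! ### One-parameter subgroups of the gauge group -/

section OneParameterSubgroups

variable {n : ℕ} {X : Type*} [TopologicalSpace X] [ChartedSpace (Fin n → ℂ) X]
  {F : Type*} [NormedAddCommGroup F] [NormedSpace ℂ F]
  {E : X → Type*} [TopologicalSpace (TotalSpace F E)] [∀ x, NormedAddCommGroup (E x)]
  [∀ x, InnerProductSpace ℂ (E x)] [FiberBundle F E] [VectorBundle ℂ F E] [VectorBundle ℝ F E]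
  [IsManifold (RealModel n) ∞ X] [ContMDiffVectorBundle ∞ F E (RealModel n)]

namespace Resolution

variable (R : Resolution n F E)

include R in
theorem completeSpace (x : X) : CompleteSpace (E x) :=
  have := R.finite x
  FiniteDimensional.complete ℂ (E x)

/-- The embedding `e ↦ (⟨tₖ, e⟩)ₖ` of `E` into a trivial bundle. -/
def emb (x : X) : E x →L[ℂ] (Fin R.N → ℂ) :=
  ContinuousLinearMap.pi fun k => innerSL ℂ (R.t k x)

theorem emb_apply (x : X) (e : E x) (k : Fin R.N) : R.emb x e k = inner ℂ (R.t k x) e := rfl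

/-- Matrices as operators, a real linear map. -/
def matrixOperator (N : ℕ) : (Fin N → Fin N → ℂ) →L[ℝ] ((Fin N → ℂ) →L[ℂ] (Fin N → ℂ)) :=
  LinearMap.toContinuousLinearMap
    { toFun := fun M => LinearMap.toContinuousLinearMap (Matrix.toLin' (Matrix.of M))
      map_add' := fun M M' => by
        rw [← map_add, ← map_add]
        rfl
      map_smul' := fun c M => by
        ext w
        simp [Matrix.mulVec, dotProduct, Finset.mul_sum, mul_assoc] }

theorem matrixOperator_apply {N : ℕ} (M : Fin N → Fin N → ℂ) (w : Fin N → ℂ) (k : Fin N) :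
    matrixOperator N M w k = ∑ l, M k l * w l := rfl

/-- The endomorphism `w ↦ ∑ₗ wₗ ⟨tₖ, T sₗ⟩` of the trivial bundle induced by an endomorphism `T` of
`E`. It extends `T` along the embedding `emb`. -/
def operator (T : ∀ x, E x →ₗ[ℂ] E x) (x : X) : (Fin R.N → ℂ) →L[ℂ] (Fin R.N → ℂ) :=
  matrixOperator R.N fun k l => inner ℂ (R.t k x) (T x (R.s l x))

theorem operator_emb (T : ∀ x, E x →ₗ[ℂ] E x) (x : X) (e : E x) :
    R.operator T x (R.emb x e) = R.emb x (T x e) := by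
  ext k
  rw [operator, matrixOperator_apply, emb_apply]
  conv_rhs => rw [← R.sum_eq x e]
  rw [map_sum, inner_sum]
  refine sum_congr rfl fun l _ => ?_
  rw [map_smul, inner_smul_right, emb_apply, mul_comm]

theorem isSmooth_operator (hE : IsSmoothHermitian n F E) {T : ∀ x, E x →ₗ[ℂ] E x}
    (hT : IsSmoothEnd n F T) :
    ContMDiff (RealModel n) 𝓘(ℝ, (Fin R.N → ℂ) →L[ℂ] (Fin R.N → ℂ)) ∞ (R.operator T) :=
  (matrixOperator R.N).contDiff.contMDiff.comp
    (contMDiff_pi_space.2 fun k => contMDiff_pi_space.2 fun l => hE (R.t k) (endAct T hT (R.s l)))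

theorem isSmooth_emb (hE : IsSmoothHermitian n F E) (s : SmoothSection n F E) :
    ContMDiff (RealModel n) 𝓘(ℝ, Fin R.N → ℂ) ∞ fun x => R.emb x (s x) :=
  contMDiff_pi_space.2 fun k => hE (R.t k) s

end Resolution

variable (R : Resolution n F E) (hE : IsSmoothHermitian n F E)

/-- The value of an element of the gauge Lie algebra as a continuous operator. -/
def gaugeCLM (ζ : gaugeLieAlgebra n X F E) (x : X) : E x →L[ℂ] E x :=
  haveI := R.finite x
  LinearMap.toContinuousLinearMap (ζ.1 x)

/-- The embedding into the trivial bundle intertwines `exp(tζ)` with the exponential of a smooth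
family of matrices. -/
theorem emb_exp (ζ : gaugeLieAlgebra n X F E) (x : X) (t : ℝ) (e : E x) :
    R.emb x (NormedSpace.exp (t • gaugeCLM R ζ x) e) =
      expApply (Fin R.N → ℂ) t (R.operator ζ.1 x, R.emb x e) := by
  have := R.completeSpace x
  have h := eq_exp_smul_apply (R.operator ζ.1 x)
    (y := fun t : ℝ => R.emb x (NormedSpace.exp (t • gaugeCLM R ζ x) e)) (fun t => by
      have h1 := (((R.emb x).restrictScalars ℝ).hasFDerivAt).comp_hasDerivAt t
        (hasDerivAt_exp_smul_apply (gaugeCLM R ζ x) e t)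
      rw [R.operator_emb]
      exact h1) t
  simp only [exp_zero_smul] at h
  exact h

include hE in
/-- The coefficients of `exp(tζ) s` with respect to the `sₖ` are smooth functions by `emb_exp`. -/
theorem isSmooth_exp_gauge (ζ : gaugeLieAlgebra n X F E) (t : ℝ) (s : SmoothSection n F E) :
    IsSmooth n F fun x => NormedSpace.exp (t • gaugeCLM R ζ x) (s x) := by
  have h1 : ContMDiff (RealModel n) 𝓘(ℝ, Fin R.N → ℂ) ∞ fun x =>
      expApply (Fin R.N → ℂ) t (R.operator ζ.1 x, R.emb x (s x)) :=
    (contDiff_expApply t).contMDiff.comp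
      ((R.isSmooth_operator hE (isSmoothEnd_gauge ζ)).prodMk_space (R.isSmooth_emb hE s))
  have h2 : (fun x => NormedSpace.exp (t • gaugeCLM R ζ x) (s x)) =
      (∑ k, complexSmul _ (contMDiff_pi_space.1 h1 k) (R.s k) : SmoothSection n F E) := by
    funext x
    rw [sum_apply_section, ← R.sum_eq x (NormedSpace.exp (t • gaugeCLM R ζ x) (s x))]
    refine sum_congr rfl fun k _ => ?_
    rw [← R.emb_apply, emb_exp]
    rfl
  unfold IsSmooth
  rw [h2]
  exact ContMDiffSection.contMDiff _

/-- The one-parameter subgroup `exp(tζ)` of the gauge group. -/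
def gaugeExp (ζ : gaugeLieAlgebra n X F E) (t : ℝ) : unitaryGaugeGroup n X F E :=
  ⟨fun x =>
    haveI := R.completeSpace x
    expIsometry (gaugeCLM R ζ x) (ζ.2.1 x) t,
    fun s => isSmooth_exp_gauge R hE ζ t s, fun s => isSmooth_exp_gauge R hE ζ (-t) s⟩

theorem isOneParameterSubgroup_gaugeExp (ζ : gaugeLieAlgebra n X F E) :
    IsOneParameterSubgroup (gaugeExp R hE ζ) ζ := by
  refine ⟨fun s t => ?_, fun x e => ?_⟩
  · refine Subtype.ext (funext fun x => LinearIsometryEquiv.ext fun e => ?_)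
    have := R.completeSpace x
    exact DFunLike.congr_fun (exp_add_smul (gaugeCLM R ζ x) s t) e
  · have := R.completeSpace x
    have h := hasDerivAt_exp_smul_apply (gaugeCLM R ζ x) e 0
    rw [exp_zero_smul] at h
    exact h

theorem IsOneParameterSubgroup.map_zero {γ : ℝ → unitaryGaugeGroup n X F E}
    {ζ : gaugeLieAlgebra n X F E} (hγ : IsOneParameterSubgroup γ ζ) : γ 0 = 1 := by
  have h := hγ.1 0 0
  rw [add_zero] at h
  exact (mul_eq_left.1 h.symm)

/-- A one-parameter subgroup is determined by its velocity. -/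
theorem IsOneParameterSubgroup.eq_exp {γ : ℝ → unitaryGaugeGroup n X F E}
    {ζ : gaugeLieAlgebra n X F E} (hγ : IsOneParameterSubgroup γ ζ) (t : ℝ) (x : X) (e : E x) :
    (γ t).1 x e = NormedSpace.exp (t • gaugeCLM R ζ x) e := by
  have := R.completeSpace x
  have h := eq_exp_smul_apply (gaugeCLM R ζ x) (y := fun t => (γ t).1 x e) (fun t => by
    have h1 := hγ.2 x ((γ t).1 x e)
    rw [← sub_self t] at h1
    have h2 := h1.comp_sub_const t t
    refine h2.congr_of_eventuallyEq (Filter.Eventually.of_forall fun r => ?_)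
    have h3 := hγ.1 (r - t) t
    rw [sub_add_cancel] at h3
    change (γ r).1 x e = _
    rw [h3]
    rfl) t
  rw [h, hγ.map_zero]
  rfl

theorem IsOneParameterSubgroup.inv_apply {γ : ℝ → unitaryGaugeGroup n X F E}
    {ζ : gaugeLieAlgebra n X F E} (hγ : IsOneParameterSubgroup γ ζ) (t : ℝ) :
    (γ t)⁻¹ = γ (-t) := by
  have h := hγ.1 t (-t)
  rw [add_neg_cancel, hγ.map_zero] at h
  exact inv_eq_of_mul_eq_one_right h.symm

variable [T2Space X] [FiniteDimensional ℂ F]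

include R hE in
/-- The curve `t ↦ d_A(exp(tζ) s)` has velocity `d_A(ζ s)` at `t = 0`. -/
theorem hasDerivAt_toFun_gaugeAct (A : UnitaryConnection n X F E)
    {γ : ℝ → unitaryGaugeGroup n X F E} {ζ : gaugeLieAlgebra n X F E}
    (hγ : IsOneParameterSubgroup γ ζ) (s : SmoothSection n F E) (x : X)
    (v : TangentSpace (RealModel n) x) :
    HasDerivAt (fun t => A.toFun (gaugeAct (γ t) s) x v)
      (A.toFun (endAct ζ.1 (isSmoothEnd_gauge ζ) s) x v) 0 := by
  let W := Fin R.N → ℂ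
  -- the coefficients of `exp(tζ) s` are components of `exp(tz) w`, where `(z, w)` is a smooth map
  -- on `X` independent of `t`, so only the map `(z, w) ↦ exp(tz) w` is differentiated in `t`
  let P : X → (W →L[ℂ] W) × W := fun y => (R.operator ζ.1 y, R.emb y (s y))
  have hP : ContMDiff (RealModel n) 𝓘(ℝ, (W →L[ℂ] W) × W) ∞ P :=
    (R.isSmooth_operator hE (isSmoothEnd_gauge ζ)).prodMk_space (R.isSmooth_emb hE s)
  have hPd : MDifferentiableAt (RealModel n) 𝓘(ℝ, (W →L[ℂ] W) × W) P x :=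
    hP.mdifferentiableAt (by simp)
  let q : (W →L[ℂ] W) × W := mfderiv (RealModel n) 𝓘(ℝ, (W →L[ℂ] W) × W) P x v
  let pr : Fin R.N → W →L[ℝ] ℂ := fun k => ContinuousLinearMap.proj k
  have hchain : ∀ (Φ : (W →L[ℂ] W) × W → W), ContDiff ℝ ∞ Φ → ∀ k,
      mvfderiv (RealModel n) (fun y => Φ (P y) k) x v = pr k (fderiv ℝ Φ (P x) q) := by
    intro Φ hΦ k
    have hd : DifferentiableAt ℝ Φ (P x) := hΦ.differentiable (by simp) _
    have hk : HasFDerivAt (fun p => pr k (Φ p)) (pr k ∘L fderiv ℝ Φ (P x)) (P x) :=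
      (pr k).hasFDerivAt.comp (P x) hd.hasFDerivAt
    have h2 := mfderiv_comp_apply (I := RealModel n) (I' := 𝓘(ℝ, (W →L[ℂ] W) × W)) (I'' := 𝓘(ℝ, ℂ))
      (g := fun p => pr k (Φ p)) (f := P) x hk.differentiableAt.mdifferentiableAt hPd v
    rw [mfderiv_eq_fderiv, hk.fderiv] at h2
    exact h2
  have h1 : ∀ t, A.toFun (gaugeAct (γ t) s) x v = ∑ k, (pr k (fderiv ℝ (expApply W t) (P x) q) •
      R.s k x + (expApply W t (P x) k) • A.toFun (R.s k) x v) := fun t => by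
    have h3 : ∀ k y, (inner ℂ (R.t k y) (gaugeAct (γ t) s y) : ℂ) = expApply W t (P y) k :=
      fun k y => by
        rw [← R.emb_apply]
        change R.emb y ((γ t).1 y (s y)) k = _
        rw [hγ.eq_exp R, emb_exp]
    rw [toFun_eq_sum R hE]
    simp only [h3, hchain _ (contDiff_expApply t)]
  have h2 : A.toFun (endAct ζ.1 (isSmoothEnd_gauge ζ) s) x v =
      ∑ k, (pr k (fderiv ℝ (endApply W) (P x) q) • R.s k x +
        (endApply W (P x) k) • A.toFun (R.s k) x v) := by
    have h3 : ∀ k y, (inner ℂ (R.t k y) (endAct ζ.1 (isSmoothEnd_gauge ζ) s y) : ℂ) =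
        endApply W (P y) k := fun k y => by
      rw [← R.emb_apply]
      exact congrFun (R.operator_emb ζ.1 y (s y)).symm k
    rw [toFun_eq_sum R hE]
    simp only [h3, hchain _ contDiff_endApply]
  simp only [h1]
  rw [h2]
  refine HasDerivAt.fun_sum fun k _ => HasDerivAt.add ?_ ?_
  · exact (((pr k).hasFDerivAt).comp_hasDerivAt 0
      (hasDerivAt_fderiv_expApply (P x) q)).smul_const (R.s k x)
  · have h4 := hasDerivAt_exp_smul_apply (P x).1 (P x).2 0
    rw [exp_zero_smul] at h4
    exact (((pr k).hasFDerivAt).comp_hasDerivAt 0 h4).smul_const _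

/-- The infinitesimal gauge action is `A ↦ -d_A ζ`. -/
theorem isOrbitVelocity (A : UnitaryConnection n X F E)
    {γ : ℝ → unitaryGaugeGroup n X F E} {ζ : gaugeLieAlgebra n X F E}
    (hγ : IsOneParameterSubgroup γ ζ) : IsOrbitVelocity γ A (-covGauge R hE A ζ) := by
  intro s x v
  have := R.completeSpace x
  let Z : ℝ → (E x →L[ℂ] E x) := fun t => NormedSpace.exp (t • gaugeCLM R ζ x)
  have h1 : ∀ t, (γ t • A).toFun s x v = realEnd (E x) (Z t) (A.toFun (gaugeAct (γ (-t)) s) x v) :=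
    fun t => by
      rw [← hγ.inv_apply t]
      exact hγ.eq_exp R t x _
  have h2 : HasDerivAt (fun t => A.toFun (gaugeAct (γ (-t)) s) x v)
      (-A.toFun (endAct ζ.1 (isSmoothEnd_gauge ζ) s) x v) 0 := by
    have h := hasDerivAt_toFun_gaugeAct R hE A hγ s x v
    rw [← neg_zero] at h
    have h3 := h.scomp (0 : ℝ) (hasDerivAt_neg (0 : ℝ))
    rw [neg_one_smul] at h3
    exact h3
  have h4 : HasDerivAt Z (gaugeCLM R ζ x * Z 0) 0 := hasDerivAt_exp_smul_const' _ _
  have h5 := ((realEnd (E x)).hasFDerivAt.comp_hasDerivAt 0 h4).clm_apply h2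
  simp only [h1]
  convert! h5 using 1
  have h6 : Z 0 = 1 := exp_zero_smul _
  have h7 : gaugeAct (γ (-0)) s = s := by
    rw [neg_zero, hγ.map_zero]
    rfl
  change _ = realEnd (E x) (gaugeCLM R ζ x * Z 0) _ + realEnd (E x) (Z 0) _
  rw [h6, h7]
  change -(covGauge R hE A ζ).1 x v (s x) = ζ.1 x (A.toFun s x v) + -A.toFun _ x v
  rw [covGauge_apply]
  abel

end OneParameterSubgroups

/-! ### Holomorphic charts -/

section Charts

variable {n : ℕ} {X : Type*} [TopologicalSpace X] [ChartedSpace (Fin n → ℂ) X]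

/-- The differential of the inverse of the chart centred at `c`. -/
def chartDeriv (c : X) (y : Fin n → ℂ) : (Fin n → ℂ) →L[ℝ] (Fin n → ℂ) :=
  (mfderiv (RealModel n) (RealModel n) (chartAt (Fin n → ℂ) c).symm y :
      (Fin n → ℂ) →L[ℝ] (Fin n → ℂ))

theorem chartForm_apply {k : ℕ} (c : X) (α : DForm n X k) (y : Fin n → ℂ)
    (v : Fin k → Fin n → ℂ) : chartForm c α y v =
      α ((chartAt (Fin n → ℂ) c).symm y) fun i => chartDeriv c y (v i) := rfl

/-- The change of coordinates from the chart centred at `c'` to the chart centred at `c`. -/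
def transition (c' c : X) (y : Fin n → ℂ) : Fin n → ℂ :=
  chartAt (Fin n → ℂ) c ((chartAt (Fin n → ℂ) c').symm y)

theorem mdifferentiableAt_chart_symm [IsManifold (RealModel n) ∞ X] (c : X) {y : Fin n → ℂ}
    (hy : y ∈ (chartAt (Fin n → ℂ) c).target) :
    MDifferentiableAt (RealModel n) (RealModel n) (chartAt (Fin n → ℂ) c).symm y :=
  ((contMDiffOn_chart_symm (n := ∞) (x := c)).contMDiffAt
    ((chartAt (Fin n → ℂ) c).open_target.mem_nhds hy)).mdifferentiableAt (by simp)

theorem chartDeriv_eq_fderiv [IsManifold (RealModel n) ∞ X] (c : X) {y : Fin n → ℂ}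
    (hy : y ∈ (chartAt (Fin n → ℂ) c).target) :
    chartDeriv c y = fderiv ℝ (transition c ((chartAt (Fin n → ℂ) c).symm y)) y := by
  refine (mdifferentiableAt_chart_symm c hy).mfderiv.trans ?_
  change fderivWithin ℝ _ (Set.range id) _ = _
  rw [Set.range_id, fderivWithin_univ]
  rfl

/-- The changes of coordinates are holomorphic. -/
theorem differentiableAt_transition [IsManifold (ComplexModel n) ω X] (c' c : X) {y : Fin n → ℂ}
    (hy : y ∈ (chartAt (Fin n → ℂ) c').target)
    (hc : (chartAt (Fin n → ℂ) c').symm y ∈ (chartAt (Fin n → ℂ) c).source) :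
    DifferentiableAt ℂ (transition c' c) y := by
  have h := HasGroupoid.compatible (G := contDiffGroupoid ω (ComplexModel n))
    (chart_mem_atlas (Fin n → ℂ) c') (chart_mem_atlas (Fin n → ℂ) c)
  rw [contDiffGroupoid, mem_groupoid_of_pregroupoid] at h
  have h1 := h.1
  simp only [contDiffPregroupoid, modelWithCornersSelf_coe, modelWithCornersSelf_coe_symm] at h1
  have h2 : ContDiffOn ℂ ω (transition c' c)
      ((chartAt (Fin n → ℂ) c').symm ≫ₕ chartAt (Fin n → ℂ) c).source := by
    simp only [CompTriple.comp_eq, Set.range_id, Set.preimage_id, Set.inter_univ] at h1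
    exact h1
  exact (h2.contDiffAt (((chartAt (Fin n → ℂ) c').symm ≫ₕ
    chartAt (Fin n → ℂ) c).open_source.mem_nhds (by simp [hy, hc]))).differentiableAt (by simp)

theorem fderiv_transition [IsManifold (ComplexModel n) ω X] (c' c : X) {y : Fin n → ℂ}
    (hy : y ∈ (chartAt (Fin n → ℂ) c').target)
    (hc : (chartAt (Fin n → ℂ) c').symm y ∈ (chartAt (Fin n → ℂ) c).source) :
    fderiv ℝ (transition c' c) y = (fderiv ℂ (transition c' c) y).restrictScalars ℝ :=
  (differentiableAt_transition c' c hy hc).fderiv_restrictScalars ℝ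

/-- The inverse charts are holomorphic. -/
theorem chartDeriv_I_smul [IsManifold (ComplexModel n) ω X] (c : X) {y : Fin n → ℂ}
    (hy : y ∈ (chartAt (Fin n → ℂ) c).target) (v : Fin n → ℂ) :
    chartDeriv c y (Complex.I • v) = Complex.I • chartDeriv c y v := by
  rw [chartDeriv_eq_fderiv c hy, fderiv_transition c _ hy (mem_chart_source _ _)]
  exact map_smul (fderiv ℂ _ y) _ _

theorem isInvertible_chartDeriv [IsManifold (RealModel n) ∞ X] (c : X) {y : Fin n → ℂ}
    (hy : y ∈ (chartAt (Fin n → ℂ) c).target) : (chartDeriv c y).IsInvertible := by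
  have i1 : IsManifold (RealModel n) 1 X :=
    IsManifold.of_le (n := ∞) (WithTop.coe_le_coe.2 (le_top : (1 : ℕ∞) ≤ ⊤))
  have h := isInvertible_mfderivWithin_extChartAt_symm (I := RealModel n) (x := c) (y := y)
    (by simpa using hy)
  simp only [extChartAt, mfld_simps, mfderivWithin_univ] at h
  exact h

/-- The real determinant of a complex linear map is the squared modulus of its complex
determinant. -/
theorem det_restrictScalars_nonneg (L : (Fin n → ℂ) →ₗ[ℂ] (Fin n → ℂ)) :
    0 ≤ LinearMap.det (L.restrictScalars ℝ) := by
  rw [LinearMap.det_restrictScalars, Algebra.norm_complex_apply]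
  exact Complex.normSq_nonneg _

/-- Holomorphic charts are orientation preserving. -/
theorem det_chartDeriv_pos [IsManifold (ComplexModel n) ω X] (c : X) {y : Fin n → ℂ}
    (hy : y ∈ (chartAt (Fin n → ℂ) c).target) :
    0 < LinearMap.det (chartDeriv c y : (Fin n → ℂ) →ₗ[ℝ] (Fin n → ℂ)) := by
  refine lt_of_le_of_ne ?_ (Ne.symm ?_)
  · rw [chartDeriv_eq_fderiv c hy, fderiv_transition c _ hy (mem_chart_source _ _)]
    exact det_restrictScalars_nonneg _
  · obtain ⟨e, he⟩ := isInvertible_chartDeriv c hy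
    rw [← he]
    exact (LinearEquiv.isUnit_det' e.toLinearEquiv).ne_zero

/-- The chain rule for the inverse charts. -/
theorem chartDeriv_transition [IsManifold (ComplexModel n) ω X] (c' c : X) {y : Fin n → ℂ}
    (hy : y ∈ (chartAt (Fin n → ℂ) c').target)
    (hc : (chartAt (Fin n → ℂ) c').symm y ∈ (chartAt (Fin n → ℂ) c).source) :
    chartDeriv c' y = chartDeriv c (transition c' c y) ∘L fderiv ℝ (transition c' c) y := by
  have h1 : DifferentiableAt ℝ (transition c' c) y :=
    (differentiableAt_transition c' c hy hc).restrictScalars ℝ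
  have h2 : transition c' c y ∈ (chartAt (Fin n → ℂ) c).target :=
    (chartAt (Fin n → ℂ) c).map_source hc
  have h3 := mfderiv_comp (I := RealModel n) (I' := RealModel n) (I'' := RealModel n) y
    (g := (chartAt (Fin n → ℂ) c).symm) (f := transition c' c)
    (mdifferentiableAt_chart_symm c h2) h1.mdifferentiableAt
  have h4 : ((chartAt (Fin n → ℂ) c).symm ∘ transition c' c) =ᶠ[nhds y]
      (chartAt (Fin n → ℂ) c').symm := by
    have h5 : ∀ᶠ z in nhds y, (chartAt (Fin n → ℂ) c').symm z ∈ (chartAt (Fin n → ℂ) c).source :=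
      ((chartAt (Fin n → ℂ) c').continuousAt_symm hy).eventually
        ((chartAt (Fin n → ℂ) c).open_source.mem_nhds hc)
    filter_upwards [h5] with z hz
    exact (chartAt (Fin n → ℂ) c).left_inv hz
  rw [h4.mfderiv_eq, mfderiv_eq_fderiv] at h3
  exact h3

variable [IsManifold (RealModel n) ∞ X]

/-- The coordinate vector fields are the frame of the tangent bundle defined by a chart. -/
theorem symm_trivializationAt_tangent (c : X) {x : X} (hx : x ∈ (chartAt (Fin n → ℂ) c).source)
    (v : Fin n → ℂ) :
    (trivializationAt (Fin n → ℂ) (TangentSpace (RealModel n) : X → Type _) c).symm x v =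
      chartDeriv c (chartAt (Fin n → ℂ) c x) v := by
  have i1 : IsManifold (RealModel n) 1 X :=
    IsManifold.of_le (n := ∞) (WithTop.coe_le_coe.2 (le_top : (1 : ℕ∞) ≤ ⊤))
  set e := trivializationAt (Fin n → ℂ) (TangentSpace (RealModel n) : X → Type _) c with he
  have h2 := TangentBundle.symmL_trivializationAt (I := RealModel n) (x₀ := c) (x := x) hx
  have h3 : e.symm x v = e.symmL ℝ x v := (e.symmL_apply (R := ℝ) hx v).symm
  simp only [extChartAt, mfld_simps, mfderivWithin_univ] at h2
  exact h3.trans (DFunLike.congr_fun h2 v)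

/-- Coordinate vector fields extend, near each point, to global smooth vector fields. -/
theorem exists_coordinateField [T2Space X] (c : X) {x₀ : X}
    (hx₀ : x₀ ∈ (chartAt (Fin n → ℂ) c).source) (v : Fin n → ℂ) :
    ∃ V : SmoothVectorField n X, ∀ᶠ x in nhds x₀,
      V x = chartDeriv c (chartAt (Fin n → ℂ) c x) v := by
  set e := trivializationAt (Fin n → ℂ) (TangentSpace (RealModel n) : X → Type _) c with he
  obtain ⟨χ, -, hχ⟩ := (SmoothBumpFunction.nhds_basis_tsupport (I := RealModel n) x₀).mem_iff.1
    ((chartAt (Fin n → ℂ) c).open_source.mem_nhds hx₀)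
  have hfr : ContMDiffOn (RealModel n) ((RealModel n).prod 𝓘(ℝ, Fin n → ℂ)) ∞
      (fun x => TotalSpace.mk' (Fin n → ℂ) x (e.symm x v)) e.baseSet := by
    rw [e.contMDiffOn_section_baseSet_iff]
    refine (contMDiffOn_const (c := v)).congr fun y hy => ?_
    rw [e.apply_mk_symm hy]
  refine ⟨⟨_, ContMDiffOn.smul_section_of_tsupport χ.contMDiff.contMDiffOn e.open_baseSet hχ hfr⟩, ?_⟩
  filter_upwards [χ.eventuallyEq_one, (chartAt (Fin n → ℂ) c).open_source.mem_nhds hx₀] with x h1 hx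
  change χ x • e.symm x v = _
  rw [h1, Pi.one_apply, one_smul]
  exact symm_trivializationAt_tangent c hx v

/-- A tensorial expression which is smooth on smooth vector fields has smooth components in every
chart. -/
theorem contDiffOn_chart_of_smooth [T2Space X] {k : ℕ}
    (Ψ : ∀ x : X, (Fin k → TangentSpace (RealModel n) x) → ℂ)
    (hΨ : ∀ V : Fin k → SmoothVectorField n X, IsSmoothFun n fun x => Ψ x fun i => V i x)
    (c : X) (v : Fin k → Fin n → ℂ) :
    ContDiffOn ℝ ∞ (fun y => Ψ ((chartAt (Fin n → ℂ) c).symm y) fun i => chartDeriv c y (v i))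
      (chartAt (Fin n → ℂ) c).target := by
  intro y hy
  have hx := (chartAt (Fin n → ℂ) c).map_target hy
  choose V hV using fun i => exists_coordinateField c hx (v i)
  have h1 : ContMDiffAt (RealModel n) 𝓘(ℝ, ℂ) ∞
      ((fun x => Ψ x fun i => V i x) ∘ (chartAt (Fin n → ℂ) c).symm) y :=
    (hΨ V _).comp y ((contMDiffOn_chart_symm (n := ∞) (x := c)).contMDiffAt
      ((chartAt (Fin n → ℂ) c).open_target.mem_nhds hy))
  refine ContDiffAt.contDiffWithinAt (contMDiffAt_iff_contDiffAt.1 (h1.congr_of_eventuallyEq ?_))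
  have h2 := ((chartAt (Fin n → ℂ) c).continuousAt_symm hy).eventually
    (Filter.eventually_all.2 hV)
  filter_upwards [h2, (chartAt (Fin n → ℂ) c).open_target.mem_nhds hy] with z hz hz'
  simp only [Function.comp_apply]
  congr 1
  funext i
  rw [hz i, (chartAt (Fin n → ℂ) c).right_inv hz']

/-- Coordinate vector fields commute. -/
theorem mlieBracket_coordinateField [T2Space X] (c : X) {x₀ : X}
    (hx₀ : x₀ ∈ (chartAt (Fin n → ℂ) c).source) {v w : Fin n → ℂ} (V W : SmoothVectorField n X)
    (hV : ∀ᶠ x in nhds x₀, V x = chartDeriv c (chartAt (Fin n → ℂ) c x) v)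
    (hW : ∀ᶠ x in nhds x₀, W x = chartDeriv c (chartAt (Fin n → ℂ) c x) w) :
    VectorField.mlieBracket (RealModel n) V W x₀ = 0 := by
  have i3 : IsManifold (RealModel n) (minSmoothness ℝ 3) X := by
    rw [minSmoothness_of_isRCLikeNormedField]
    infer_instance
  have i2 : IsManifold (RealModel n) (minSmoothness ℝ 2) X := by
    rw [minSmoothness_of_isRCLikeNormedField]
    exact IsManifold.of_le (n := ∞) (WithTop.coe_le_coe.2 (le_top : (2 : ℕ∞) ≤ ⊤))
  set φ := chartAt (Fin n → ℂ) c
  set y := φ x₀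
  have hy : y ∈ φ.target := φ.map_source hx₀
  have hxy : φ.symm y = x₀ := φ.left_inv hx₀
  have h1 := VectorField.mpullback_mlieBracket (I := RealModel n) (I' := RealModel n)
    (f := φ.symm) (V := V) (W := W) (x₀ := y) (n := ∞) V.mdifferentiableAt W.mdifferentiableAt
    ((contMDiffOn_chart_symm (n := ∞) (x := c)).contMDiffAt (φ.open_target.mem_nhds hy))
    (by rw [minSmoothness_of_isRCLikeNormedField]; exact WithTop.coe_le_coe.2 (le_top : (2 : ℕ∞) ≤ ⊤))
  have h2 : ∀ (U : SmoothVectorField n X) (u : Fin n → ℂ),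
      (∀ᶠ x in nhds x₀, U x = chartDeriv c (φ x) u) →
      VectorField.mpullback (RealModel n) (RealModel n) φ.symm U =ᶠ[nhds y] fun _ => u := by
    intro U u hU
    have h3 := (φ.continuousAt_symm hy).eventually (hxy.symm ▸ hU)
    filter_upwards [h3, φ.open_target.mem_nhds hy] with z hz hz'
    change (chartDeriv c z).inverse (U (φ.symm z)) = u
    rw [hz, φ.right_inv hz']
    exact (isInvertible_chartDeriv c hz').inverse_apply_self _
  have h5 : VectorField.mlieBracket (RealModel n) (fun _ : Fin n → ℂ => v) (fun _ => w) y =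
      VectorField.lieBracket ℝ (fun _ : Fin n → ℂ => v) (fun _ => w) y :=
    (congrFun VectorField.mlieBracketWithin_univ y).symm.trans
      ((congrFun VectorField.mlieBracketWithin_eq_lieBracketWithin y).trans
        (congrFun VectorField.lieBracketWithin_univ y))
  rw [(h2 V v hV).mlieBracket_vectorField_eq (h2 W w hW)] at h1
  have h1 := h1.trans h5
  have h4 : VectorField.lieBracket ℝ (fun _ : Fin n → ℂ => v) (fun _ => w) y = 0 := by
    simp [VectorField.lieBracket]
  rw [h4] at h1
  change (chartDeriv c y).inverse (VectorField.mlieBracket (RealModel n) V W (φ.symm y)) = 0 at h1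
  rw [hxy] at h1
  obtain ⟨e, he⟩ := isInvertible_chartDeriv c hy
  rw [← he, ContinuousLinearMap.inverse_equiv] at h1
  exact (map_eq_zero_iff e.symm e.symm.injective).1 h1

/-- The derivative of a function along a coordinate vector field, in coordinates. -/
theorem mvfderiv_chart (c : X) {f : X → ℂ} (hf : IsSmoothFun n f) {y : Fin n → ℂ}
    (hy : y ∈ (chartAt (Fin n → ℂ) c).target) (v : Fin n → ℂ) :
    mvfderiv (RealModel n) f ((chartAt (Fin n → ℂ) c).symm y) (chartDeriv c y v) =
      fderiv ℝ (fun z => f ((chartAt (Fin n → ℂ) c).symm z)) y v := by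
  have h := mfderiv_comp_apply (I := RealModel n) (I' := RealModel n) (I'' := 𝓘(ℝ, ℂ)) y
    (g := f) (f := (chartAt (Fin n → ℂ) c).symm) (hf.mdifferentiableAt _)
    (mdifferentiableAt_chart_symm c hy) v
  rw [mfderiv_eq_fderiv] at h
  exact h.symm

/-- The local coordinate formula `dθ(∂ᵥ, ∂_w) = ∂ᵥ(θ(∂_w)) - ∂_w(θ(∂ᵥ))` for the exterior
derivative of a one-form given invariantly. -/
theorem chart_extDeriv_oneForm [T2Space X]
    (θ : ∀ x : X, TangentSpace (RealModel n) x →ₗ[ℝ] ℂ)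
    (dθ : ∀ x : X, TangentSpace (RealModel n) x → TangentSpace (RealModel n) x → ℂ)
    (hθ : ∀ V : SmoothVectorField n X, IsSmoothFun n fun x => θ x (V x))
    (hd : ∀ (V W : SmoothVectorField n X) (x : X), dθ x (V x) (W x) =
      mvfderiv (RealModel n) (fun y => θ y (W y)) x (V x) -
        mvfderiv (RealModel n) (fun y => θ y (V y)) x (W x) -
        θ x (VectorField.mlieBracket (RealModel n) V W x))
    (c : X) {y : Fin n → ℂ} (hy : y ∈ (chartAt (Fin n → ℂ) c).target) (v w : Fin n → ℂ) :
    dθ ((chartAt (Fin n → ℂ) c).symm y) (chartDeriv c y v) (chartDeriv c y w) =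
      fderiv ℝ (fun z => θ ((chartAt (Fin n → ℂ) c).symm z) (chartDeriv c z w)) y v -
      fderiv ℝ (fun z => θ ((chartAt (Fin n → ℂ) c).symm z) (chartDeriv c z v)) y w := by
  set φ := chartAt (Fin n → ℂ) c
  have hx := φ.map_target hy
  obtain ⟨V, hV⟩ := exists_coordinateField c hx v
  obtain ⟨W, hW⟩ := exists_coordinateField c hx w
  have h1 : ∀ (U : SmoothVectorField n X) (u : Fin n → ℂ),
      (∀ᶠ x in nhds (φ.symm y), U x = chartDeriv c (φ x) u) →
      U (φ.symm y) = chartDeriv c y u ∧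
      (fun z => θ (φ.symm z) (U (φ.symm z))) =ᶠ[nhds y] fun z => θ (φ.symm z) (chartDeriv c z u) := by
    intro U u hU
    refine ⟨by rw [hU.self_of_nhds, φ.right_inv hy], ?_⟩
    filter_upwards [(φ.continuousAt_symm hy).eventually hU, φ.open_target.mem_nhds hy] with z hz hz'
    rw [hz, φ.right_inv hz']
  have h2 := hd V W (φ.symm y)
  rw [mlieBracket_coordinateField c hx V W hV hW, map_zero, sub_zero, (h1 V v hV).1,
    (h1 W w hW).1, mvfderiv_chart c (hθ W) hy, mvfderiv_chart c (hθ V) hy,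
    (h1 V v hV).2.fderiv_eq, (h1 W w hW).2.fderiv_eq] at h2
  exact h2

end Charts

/-! ### Stokes' theorem on open subsets of `ℂⁿ` -/

section FlatStokes

open Equiv MeasureTheory

/-- If `B` is a cocycle then the antisymmetrization of `c ⊗ B` vanishes: average over the cyclic
permutations of the arguments of `B`. -/
theorem sum_sign_mul_cocycle_eq_zero {V : Type*} {q : ℕ} (c : V → ℂ) (B : V → (Fin q → V) → ℂ)
    (hB : ∀ u : Fin (q + 1) → V, ∑ k : Fin (q + 1), (-1 : ℤ) ^ (k : ℕ) • B (u k) (k.removeNth u) = 0)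
    (v : Fin (q + 1 + 1) → V) :
    ∑ σ : Perm (Fin (q + 1 + 1)), (Perm.sign σ : ℤ) •
      (c (v (σ 0)) * B (v (σ 1)) fun i => v (σ i.succ.succ)) = 0 := by
  let G : Perm (Fin (q + 1 + 1)) → ℂ := fun σ => (Perm.sign σ : ℤ) •
      (c (v (σ 0)) * B (v (σ 1)) fun i => v (σ i.succ.succ))
  let d : Fin (q + 1) → Perm (Fin (q + 1 + 1)) := fun k =>
    Perm.decomposeFin.symm (0, k.cycleRange.symm)
  have hd : ∀ k σ, G (σ * d k) = (Perm.sign σ : ℤ) • (c (v (σ 0)) *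
      ((-1 : ℤ) ^ (k : ℕ) • B (v (σ k.succ)) (k.removeNth fun i => v (σ i.succ)))) := fun k σ => by
    have h0 : d k 0 = 0 := Perm.decomposeFin_symm_apply_zero _ _
    have h1 : ∀ i : Fin (q + 1), d k i.succ = (k.cycleRange.symm i).succ := fun i => by
      simp [d, Perm.decomposeFin_symm_apply_succ]
    have h2 := Fin.cons_removeNth_eq_comp_cycleRange_symm (fun i => v (σ i.succ)) k
    have h3 : ∀ i : Fin (q + 1), v ((σ * d k) i.succ) =
        (Fin.cons (v (σ k.succ)) (k.removeNth fun i => v (σ i.succ)) : Fin (q + 1) → V) i :=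
      fun i => by
        rw [h2, Perm.mul_apply, h1]
        rfl
    have h4 : Perm.sign (d k) = (-1) ^ (k : ℕ) := by
      rw [Perm.decomposeFin.symm_sign, if_pos rfl, one_mul, Perm.sign_symm, Fin.sign_cycleRange]
    have h5 : v ((σ * d k) 1) = v (σ k.succ) := h3 0
    have h6 : (fun i : Fin q => v ((σ * d k) i.succ.succ)) =
        k.removeNth fun i => v (σ i.succ) := funext fun i => h3 i.succ
    simp only [G]
    rw [h5, h6, Perm.mul_apply, h0, Perm.sign_mul, h4, mul_smul_comm, smul_smul]
    simp
  have h1 : ∀ k, ∑ σ, G (σ * d k) = ∑ σ, G σ := fun k =>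
    Fintype.sum_equiv (Equiv.mulRight (d k)) _ _ fun _ => rfl
  have h2 : ((q + 1 : ℕ) : ℂ) * ∑ σ, G σ = 0 := by
    have h3 : ∑ k : Fin (q + 1), ∑ σ, G (σ * d k) = ((q + 1 : ℕ) : ℂ) * ∑ σ, G σ := by
      simp only [h1]
      simp
    rw [← h3, sum_comm]
    refine sum_eq_zero fun σ _ => ?_
    simp only [hd]
    rw [← smul_sum, ← mul_sum, hB fun i => v (σ i.succ), mul_zero, smul_zero]
  exact (mul_eq_zero.1 h2).resolve_left (Nat.cast_ne_zero.2 (Nat.succ_ne_zero q))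

/-- The antisymmetrized Leibniz rule `d(η ∧ β) = dη ∧ β` for a closed form `β`, with the
derivatives of `η` and `β` at a point given by `a` and `B`. -/
theorem factorial_mul_wedge_eq_sum {n q : ℕ} (ψ : (Fin n → ℂ) [⋀^Fin 2]→L[ℝ] ℂ)
    (β : (Fin n → ℂ) [⋀^Fin q]→L[ℝ] ℂ) (a : (Fin n → ℂ) → (Fin n → ℂ) → ℂ) (c : (Fin n → ℂ) → ℂ)
    (B : (Fin n → ℂ) → (Fin q → Fin n → ℂ) → ℂ)
    (hψ : ∀ u w, ψ ![u, w] = a u w - a w u)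
    (hB : ∀ u : Fin (q + 1) → Fin n → ℂ,
      ∑ k : Fin (q + 1), (-1 : ℤ) ^ (k : ℕ) • B (u k) (k.removeNth u) = 0)
    (v : Fin (2 + q) → Fin n → ℂ) :
    ((q.factorial : ℕ) : ℂ) * wedge ψ β v = ∑ σ : Perm (Fin 2 ⊕ Fin q), (Perm.sign σ : ℤ) •
      (a (v (finSumFinEquiv (σ (Sum.inl 0)))) (v (finSumFinEquiv (σ (Sum.inl 1)))) *
        β (fun i => v (finSumFinEquiv (σ (Sum.inr i)))) +
      c (v (finSumFinEquiv (σ (Sum.inl 1)))) * B (v (finSumFinEquiv (σ (Sum.inl 0))))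
        fun i => v (finSumFinEquiv (σ (Sum.inr i)))) := by
  set w : Fin 2 ⊕ Fin q → Fin n → ℂ := fun i => v (finSumFinEquiv i) with hw
  let s : Perm (Fin 2 ⊕ Fin q) := swap (Sum.inl 0) (Sum.inl 1)
  have hs0 : s (Sum.inl 0) = Sum.inl 1 := swap_apply_left _ _
  have hs1 : s (Sum.inl 1) = Sum.inl 0 := swap_apply_right _ _
  have hsr : ∀ i, s (Sum.inr i) = Sum.inr i := fun i =>
    swap_apply_of_ne_of_ne (by simp) (by simp)
  have hsign : Perm.sign s = -1 := Perm.sign_swap (by simp)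
  -- the two terms of `ψ` contribute equally
  have h1 : ((2 * q.factorial : ℕ) : ℂ) * wedge ψ β v = 2 * ∑ σ : Perm (Fin 2 ⊕ Fin q),
      (Perm.sign σ : ℤ) • (a (w (σ (Sum.inl 0))) (w (σ (Sum.inl 1))) *
        β fun i => w (σ (Sum.inr i))) := by
    have h2 := factorial_smul_wedge_apply ψ β v
    rw [Nat.factorial_two] at h2
    rw [h2]
    have h3 : ∀ σ : Perm (Fin 2 ⊕ Fin q), ψ (fun i => w (σ (Sum.inl i))) =
        a (w (σ (Sum.inl 0))) (w (σ (Sum.inl 1))) - a (w (σ (Sum.inl 1))) (w (σ (Sum.inl 0))) :=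
      fun σ => by
        rw [← hψ]
        congr 1
        funext i
        fin_cases i <;> rfl
    have h4 : ∑ σ : Perm (Fin 2 ⊕ Fin q), (Perm.sign σ : ℤ) •
        (a (w (σ (Sum.inl 1))) (w (σ (Sum.inl 0))) * β fun i => w (σ (Sum.inr i))) =
        -∑ σ : Perm (Fin 2 ⊕ Fin q), (Perm.sign σ : ℤ) •
        (a (w (σ (Sum.inl 0))) (w (σ (Sum.inl 1))) * β fun i => w (σ (Sum.inr i))) := by
      rw [← sum_neg_distrib]
      refine Fintype.sum_equiv (Equiv.mulRight s) _ _ fun σ => ?_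
      simp only [Equiv.coe_mulRight, Perm.mul_apply, hs0, hs1, hsr, Perm.sign_mul, hsign]
      simp
    change ∑ σ : Perm (Fin 2 ⊕ Fin q), (Perm.sign σ : ℤ) •
      (ψ (fun i => w (σ (Sum.inl i))) * β fun i => w (σ (Sum.inr i))) = _
    simp only [h3, sub_mul, smul_sub, sum_sub_distrib, h4]
    ring
  have h5 : ∑ σ : Perm (Fin 2 ⊕ Fin q), (Perm.sign σ : ℤ) •
      (c (w (σ (Sum.inl 1))) * B (w (σ (Sum.inl 0))) fun i => w (σ (Sum.inr i))) = 0 := by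
    let ε : Fin 2 ⊕ Fin q ≃ Fin (q + 1 + 1) :=
      ((Equiv.sumCongr (swap 0 1) (Equiv.refl _)).trans finSumFinEquiv).trans
        (finCongr (add_comm 2 q))
    have e0 : ε (Sum.inl 1) = 0 := rfl
    have e1 : ε (Sum.inl 0) = 1 := by
      apply Fin.ext
      simp [ε]
    have er : ∀ i, ε (Sum.inr i) = i.succ.succ := fun i => by
      apply Fin.ext
      change (finSumFinEquiv (Sum.inr i : Fin 2 ⊕ Fin q)).val = i.val + 1 + 1
      rw [finSumFinEquiv_apply_right, Fin.val_natAdd]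
      omega
    rw [← sum_sign_mul_cocycle_eq_zero c B hB fun i => w (ε.symm i)]
    refine Fintype.sum_equiv ε.permCongr _ _ fun σ => ?_
    rw [Perm.sign_permCongr]
    have h6 : ∀ i, w (ε.symm (ε.permCongr σ (ε i))) = w (σ i) := fun i => by
      simp [Equiv.permCongr_apply]
    rw [← e0, ← e1]
    simp only [← er, h6]
  have h7 : ((2 * q.factorial : ℕ) : ℂ) = 2 * (q.factorial : ℂ) := by push_cast; ring
  rw [h7, mul_assoc] at h1
  have h8 := mul_left_cancel₀ two_ne_zero h1
  rw [h8]
  simp only [smul_add, sum_add_distrib]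
  exact (add_eq_left.2 h5).symm

/-- The integral of a directional derivative of a compactly supported function vanishes. -/
theorem integral_fderiv_apply_eq_zero {V : Type*} [NormedAddCommGroup V] [NormedSpace ℝ V]
    [FiniteDimensional ℝ V] [MeasurableSpace V] [BorelSpace V] (μ : Measure V)
    [μ.IsAddHaarMeasure] {h : V → ℂ} (hh : ContDiff ℝ 1 h) (hc : HasCompactSupport h) (u : V) :
    ∫ y, fderiv ℝ h y u ∂μ = 0 := by
  have h1 : Integrable (fun y => fderiv ℝ h y u) μ :=
    ((hh.continuous_fderiv (by simp)).clm_apply continuous_const).integrable_of_hasCompactSupport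
      ((hc.fderiv ℝ).comp_left (g := fun L : V →L[ℝ] ℂ => L u) rfl)
  have h2 := integral_mul_fderiv_eq_neg_fderiv_mul_of_integrable (μ := μ) (f := fun _ : V => (1 : ℂ))
    (g := h) (v := u) (by simp) (by simpa using h1)
    (by simpa using hh.continuous.integrable_of_hasCompactSupport hc)
    (fun x _ => differentiableAt_const _) (fun x _ => hh.differentiable (by simp) x)
  simpa using h2

/-- A function on an open set which vanishes outside a compact subset extends smoothly by zero. -/
theorem contDiff_indicator {V : Type*} [NormedAddCommGroup V] [NormedSpace ℝ V] {U K : Set V}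
    (hU : IsOpen U) (hK : IsCompact K) (hKU : K ⊆ U) {f : V → ℂ} {m : WithTop ℕ∞}
    (hf : ContDiffOn ℝ m f U) (h0 : ∀ y ∈ U \ K, f y = 0) :
    ContDiff ℝ m (U.indicator f) ∧ tsupport (U.indicator f) ⊆ K := by
  have hsupp : tsupport (U.indicator f) ⊆ K := by
    refine closure_minimal (fun y hy => ?_) hK.isClosed
    by_contra hyK
    refine hy ?_
    by_cases hyU : y ∈ U
    · rw [Set.indicator_of_mem hyU, h0 y ⟨hyU, hyK⟩]
    · exact Set.indicator_of_notMem hyU f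
  refine ⟨contDiff_iff_contDiffAt.2 fun y => ?_, hsupp⟩
  by_cases hy : y ∈ tsupport (U.indicator f)
  swap
  · exact contDiffAt_const.congr_of_eventuallyEq (notMem_tsupport_iff_eventuallyEq.1 hy)
  have hyU := hU.mem_nhds (hKU (hsupp hy))
  refine (hf.contDiffAt hyU).congr_of_eventuallyEq ?_
  filter_upwards [hyU] with z hz
  exact Set.indicator_of_mem hz f

/-- Stokes' theorem on an open subset of `ℂⁿ`: if `η` is a compactly supported one-form and `β` is
closed, then `∫ dη ∧ β = 0`. -/
theorem setIntegral_wedge_eq_zero {n q : ℕ} {U K : Set (Fin n → ℂ)} (hU : IsOpen U)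
    (hK : IsCompact K) (hKU : K ⊆ U) (η : (Fin n → ℂ) → (Fin n → ℂ) → ℂ)
    (β : (Fin n → ℂ) → (Fin n → ℂ) [⋀^Fin q]→L[ℝ] ℂ)
    (ψ : (Fin n → ℂ) → (Fin n → ℂ) [⋀^Fin 2]→L[ℝ] ℂ)
    (hη : ∀ w, ContDiffOn ℝ 1 (fun y => η y w) U) (hη0 : ∀ w, ∀ y ∈ U \ K, η y w = 0)
    (hβ : ∀ m, ContDiffOn ℝ 1 (fun y => β y m) U)
    (hdβ : ∀ y ∈ U, ∀ u : Fin (q + 1) → Fin n → ℂ, ∑ k : Fin (q + 1), (-1 : ℤ) ^ (k : ℕ) •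
      fderiv ℝ (fun z => β z (k.removeNth u)) y (u k) = 0)
    (hψ : ∀ y ∈ U, ∀ u w, ψ y ![u, w] =
      fderiv ℝ (fun z => η z w) y u - fderiv ℝ (fun z => η z u) y w)
    (v : Fin (2 + q) → Fin n → ℂ) : ∫ y in U, wedge (ψ y) (β y) v = 0 := by
  -- `dη ∧ β` is the antisymmetrization of the derivatives of the functions `η(v₁) β(v₂, …)`
  let h : Perm (Fin 2 ⊕ Fin q) → (Fin n → ℂ) → ℂ := fun σ => U.indicator fun y =>
    η y (v (finSumFinEquiv (σ (Sum.inl 1)))) * β y fun i => v (finSumFinEquiv (σ (Sum.inr i)))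
  have hh : ∀ σ, ContDiff ℝ 1 (h σ) ∧ tsupport (h σ) ⊆ K := fun σ =>
    contDiff_indicator hU hK hKU ((hη _).mul (hβ _)) fun y hy => by rw [hη0 _ y hy, zero_mul]
  have hc : ∀ σ, HasCompactSupport (h σ) := fun σ => hK.of_isClosed_subset (isClosed_tsupport _) (hh σ).2
  have h1 : ∀ y ∈ U, wedge (ψ y) (β y) v = ((q.factorial : ℕ) : ℂ)⁻¹ *
      ∑ σ : Perm (Fin 2 ⊕ Fin q), (Perm.sign σ : ℤ) •
        fderiv ℝ (h σ) y (v (finSumFinEquiv (σ (Sum.inl 0)))) := fun y hy => by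
    have h2 := factorial_mul_wedge_eq_sum (ψ y) (β y) (fun u w => fderiv ℝ (fun z => η z w) y u)
      (η y) (fun u m => fderiv ℝ (fun z => β z m) y u) (hψ y hy) (hdβ y hy) v
    rw [eq_inv_mul_iff_mul_eq₀ (Nat.cast_ne_zero.2 (Nat.factorial_ne_zero q)), h2]
    refine sum_congr rfl fun σ _ => ?_
    have hyU := hU.mem_nhds hy
    have h3 : h σ =ᶠ[nhds y] fun y => η y (v (finSumFinEquiv (σ (Sum.inl 1)))) *
        β y fun i => v (finSumFinEquiv (σ (Sum.inr i))) := by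
      filter_upwards [hyU] with z hz
      exact Set.indicator_of_mem hz _
    rw [h3.fderiv_eq, fderiv_fun_mul (((hη _).contDiffAt hyU).differentiableAt (by simp))
      (((hβ _).contDiffAt hyU).differentiableAt (by simp))]
    simp only [_root_.add_apply, _root_.smul_apply, smul_eq_mul]
    congr 1
    ring
  simp only [zsmul_eq_mul] at h1
  rw [setIntegral_congr_fun hU.measurableSet h1, integral_const_mul]
  have h4 : ∀ σ, (fun y => fderiv ℝ (h σ) y (v (finSumFinEquiv (σ (Sum.inl 0))))).support ⊆ U := by
    intro σ y hy
    refine hKU ((hh σ).2 (support_fderiv_subset ℝ fun h5 => hy ?_))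
    simp only [h5]
    rfl
  have h6 : ∀ σ, Integrable fun y => fderiv ℝ (h σ) y (v (finSumFinEquiv (σ (Sum.inl 0)))) :=
    fun σ => (((hh σ).1.continuous_fderiv (by simp)).clm_apply
      continuous_const).integrable_of_hasCompactSupport
      (((hc σ).fderiv ℝ).comp_left (g := fun L : (Fin n → ℂ) →L[ℝ] ℂ => L _) rfl)
  rw [integral_finsetSum _ fun σ _ => ((h6 σ).const_mul _).integrableOn]
  refine mul_eq_zero_of_right _ (sum_eq_zero fun σ _ => ?_)
  rw [integral_const_mul, setIntegral_eq_integral_of_forall_compl_eq_zero fun y hy => ?_,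
    integral_fderiv_apply_eq_zero _ (hh σ).1 (hc σ), mul_zero]
  by_contra h7
  exact hy (h4 σ h7)

end FlatStokes

/-! ### Smooth families of forms on `ℂⁿ` -/

section SmoothForms

theorem contDiffOn_wedge {n p q : ℕ} {m : WithTop ℕ∞} {U : Set (Fin n → ℂ)}
    {α : (Fin n → ℂ) → (Fin n → ℂ) [⋀^Fin p]→L[ℝ] ℂ} {β : (Fin n → ℂ) → (Fin n → ℂ) [⋀^Fin q]→L[ℝ] ℂ}
    (hα : ∀ v, ContDiffOn ℝ m (fun y => α y v) U) (hβ : ∀ v, ContDiffOn ℝ m (fun y => β y v) U)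
    (v : Fin (p + q) → Fin n → ℂ) : ContDiffOn ℝ m (fun y => wedge (α y) (β y) v) U := by
  have h : (fun y => wedge (α y) (β y) v) = fun y => ((p.factorial * q.factorial : ℕ) : ℂ)⁻¹ *
      ∑ σ : Equiv.Perm (Fin p ⊕ Fin q), ((Equiv.Perm.sign σ : ℤ) : ℂ) *
        (α y (fun i => v (finSumFinEquiv (σ (Sum.inl i)))) *
          β y (fun i => v (finSumFinEquiv (σ (Sum.inr i))))) := by
    funext y
    rw [eq_inv_mul_iff_mul_eq₀ (factorial_mul_ne_zero p q), factorial_smul_wedge_apply]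
    simp only [zsmul_eq_mul]
  rw [h]
  exact contDiffOn_const.mul (ContDiffOn.sum fun σ _ => contDiffOn_const.mul ((hα _).mul (hβ _)))

theorem contDiffOn_wedgePow {n : ℕ} {m : WithTop ℕ∞} {U : Set (Fin n → ℂ)}
    {α : (Fin n → ℂ) → (Fin n → ℂ) [⋀^Fin 2]→L[ℝ] ℂ}
    (hα : ∀ v, ContDiffOn ℝ m (fun y => α y v) U) (k : ℕ) (v : Fin (2 * k) → Fin n → ℂ) :
    ContDiffOn ℝ m (fun y => wedgePow (α y) k v) U := by
  induction k with
  | zero => exact contDiffOn_const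
  | succ k ih => exact contDiffOn_wedge ih hα v

/-- A family of alternating forms is differentiable if its values on fixed vectors are: the form
depends linearly on its finitely many values on basis vectors. -/
theorem differentiableAt_of_apply {n k : ℕ} {α : (Fin n → ℂ) → (Fin n → ℂ) [⋀^Fin k]→L[ℝ] ℂ}
    {y : Fin n → ℂ} (h : ∀ v, DifferentiableAt ℝ (fun z => α z v) y) : DifferentiableAt ℝ α y := by
  let b := realBasis n
  let T : ((Fin n → ℂ) [⋀^Fin k]→L[ℝ] ℂ) →ₗ[ℝ] ((Fin k → Fin (2 * n)) → ℂ) :=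
    { toFun := fun f i => f fun j => b (i j)
      map_add' := fun _ _ => rfl
      map_smul' := fun _ _ => rfl }
  have hT : LinearMap.ker T = ⊥ := LinearMap.ker_eq_bot.2 fun f g hfg => by
    apply ContinuousAlternatingMap.toAlternatingMap_injective
    apply AlternatingMap.coe_multilinearMap_injective
    exact Module.Basis.ext_multilinear (fun _ => b) fun i => congrFun hfg i
  obtain ⟨S, hS⟩ := T.exists_leftInverse_of_injective hT
  have h1 : α = fun z => LinearMap.toContinuousLinearMap S (T (α z)) :=
    funext fun z => (DFunLike.congr_fun hS (α z)).symm
  rw [h1]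
  exact (LinearMap.toContinuousLinearMap S).differentiableAt.comp y
    (differentiableAt_pi.2 fun i => h _)

/-- In top degree the pull-back is multiplication by the determinant. -/
theorem topForm_map_cast {n k : ℕ} (hk : k = 2 * n) (f : (Fin n → ℂ) [⋀^Fin k]→L[ℝ] ℂ)
    (T : (Fin n → ℂ) →ₗ[ℝ] (Fin n → ℂ)) :
    f (fun i => T (realFrame n (i.cast hk))) =
      ((LinearMap.det T : ℝ) : ℂ) * f fun i => realFrame n (i.cast hk) := by
  subst hk
  exact topForm_map f T (realFrame n)

end SmoothForms

/-! ### Integration against the volume form of a hermitian metric -/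

section Volume

open MeasureTheory

variable {n : ℕ} {X : Type*} [TopologicalSpace X] [ChartedSpace (Fin n → ℂ) X]

section Metric

variable [IsManifold (RealModel n) ∞ X]

/-- The metric on a tangent space as a bilinear form on `ℂⁿ`. -/
def metricBilin (g : HermitianMetric n X) (x : X) :
    (Fin n → ℂ) →ₗ[ℝ] (Fin n → ℂ) →ₗ[ℝ] ℝ :=
  LinearMap.mk₂ ℝ (fun v w : TangentSpace (RealModel n) x => g.inner x v w)
    (fun _ _ _ => DFunLike.congr_fun (map_add (g.inner x) _ _) _)
    (fun _ _ _ => DFunLike.congr_fun (map_smul (g.inner x) _ _) _)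
    (fun _ _ _ => map_add (g.inner x _) _ _) (fun _ _ _ => map_smul (g.inner x _) _ _)

theorem metricBilin_symm (g : HermitianMetric n X) (x : X) (v w : Fin n → ℂ) :
    metricBilin g x v w = metricBilin g x w v := g.symm x v w

theorem metricBilin_pos (g : HermitianMetric n X) (x : X) (v : Fin n → ℂ) (hv : v ≠ 0) :
    0 < metricBilin g x v v := g.pos x v hv

theorem metricBilin_I (g : HermitianMetric n X) (x : X) (v w : Fin n → ℂ) :
    metricBilin g x (Complex.I • v) (Complex.I • w) = metricBilin g x v w := g.hermitian x v w

theorem kahlerMatrix_apply (g : HermitianMetric n X) (x : X) (i j : Fin (2 * n)) :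
    g.kahlerMatrix x i j = metricBilin g x (Complex.I • realFrame n i) (realFrame n j) := rfl

/-- `ωⁿ` is positive with respect to the orientation given by the complex structure. -/
theorem exists_kahlerForm_pow_pos (g : HermitianMetric n X) (x : X) :
    ∃ r : ℝ, 0 < r ∧ wedgePow (g.kahlerForm x) n (realFrame n) = r :=
  exists_wedgePow_eq_pos (metricBilin_symm g x) (metricBilin_pos g x) (metricBilin_I g x) _ _
    fun _ _ => rfl

theorem isSmooth_metric (g : HermitianMetric n X) (V W : SmoothVectorField n X) :
    IsSmoothFun n fun x => ((g.inner x (V x) (W x) : ℝ) : ℂ) := by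
  refine IsSmoothFun.ofReal fun x => ?_
  have h : ContMDiffAt (RealModel n) ((RealModel n).prod 𝓘(ℝ)) ∞
      (fun m => TotalSpace.mk' ℝ (E := Bundle.Trivial X ℝ) m (g.inner m (V m) (W m))) x := by
    apply ContMDiffAt.clm_bundle_apply₂ (F₁ := Fin n → ℂ) (F₂ := Fin n → ℂ)
    · exact g.contMDiff x
    · exact V.contMDiff x
    · exact W.contMDiff x
  simp only [contMDiffAt_totalSpace] at h
  exact h.2

theorem chartForm_wedgePow (g : HermitianMetric n X) (c : X) (y : Fin n → ℂ) (k : ℕ) :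
    chartForm c (fun x => wedgePow (g.kahlerForm x) k) y = wedgePow (chartForm c g.kahlerForm y) k :=
  wedgePow_compContinuousLinearMap _ _ _

/-- The coefficient of `ωⁿ` in the chart centred at `c`. -/
def volDensity (g : HermitianMetric n X) (c : X) (y : Fin n → ℂ) : ℝ :=
  (chartForm c (fun x => wedgePow (g.kahlerForm x) n) y (realFrame n)).re

end Metric

variable [IsManifold (ComplexModel n) ω X]

theorem contDiffOn_chartForm_kahlerForm [T2Space X] (g : HermitianMetric n X) (c : X) (v : Fin 2 → Fin n → ℂ) :
    ContDiffOn ℝ ∞ (fun y => chartForm c g.kahlerForm y v) (chartAt (Fin n → ℂ) c).target := by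
  have h := contDiffOn_chart_of_smooth (n := n) (X := X) (k := 2)
    (fun x u => ((g.inner x (u 0) (u 1) : ℝ) : ℂ)) (fun V => isSmooth_metric g (V 0) (V 1)) c
    ![Complex.I • v 0, v 1]
  refine h.congr fun y hy => ?_
  have h1 := chartDeriv_I_smul c hy (v 0)
  simp only [Matrix.cons_val_zero, Matrix.cons_val_one]
  rw [h1]
  rfl

theorem contDiffOn_chartForm_wedgePow [T2Space X] (g : HermitianMetric n X) (c : X) (k : ℕ)
    (v : Fin (2 * k) → Fin n → ℂ) : ContDiffOn ℝ ∞
      (fun y => chartForm c (fun x => wedgePow (g.kahlerForm x) k) y v)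
      (chartAt (Fin n → ℂ) c).target := by
  simp only [chartForm_wedgePow]
  exact contDiffOn_wedgePow (contDiffOn_chartForm_kahlerForm g c) k v

/-- The coefficient of a form of top degree in a chart is its coefficient in the frame
`realFrame n` of the tangent space, times the Jacobian of the inverse chart. -/
theorem chartForm_frame {k : ℕ} (hk : k = 2 * n) (α : DForm n X k) (c : X) (y : Fin n → ℂ) :
    chartForm c α y (fun i => realFrame n (i.cast hk)) =
      ((LinearMap.det (chartDeriv c y : (Fin n → ℂ) →ₗ[ℝ] (Fin n → ℂ)) : ℝ) : ℂ) *
        α ((chartAt (Fin n → ℂ) c).symm y) fun i => realFrame n (i.cast hk) :=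
  topForm_map_cast hk (α ((chartAt (Fin n → ℂ) c).symm y)) (chartDeriv c y : (Fin n → ℂ) →ₗ[ℝ] (Fin n → ℂ))

theorem ofReal_volDensity (g : HermitianMetric n X) (c : X) (y : Fin n → ℂ) :
    ((volDensity g c y : ℝ) : ℂ) =
      chartForm c (fun x => wedgePow (g.kahlerForm x) n) y (realFrame n) := by
  obtain ⟨r, -, hr⟩ := exists_kahlerForm_pow_pos g ((chartAt (Fin n → ℂ) c).symm y)
  have h := chartForm_frame rfl (fun x => wedgePow (g.kahlerForm x) n) c y
  simp only [Fin.cast_eq_self, hr] at h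
  unfold volDensity
  rw [h, ← Complex.ofReal_mul, Complex.ofReal_re]

theorem volDensity_pos (g : HermitianMetric n X) (c : X) {y : Fin n → ℂ}
    (hy : y ∈ (chartAt (Fin n → ℂ) c).target) : 0 < volDensity g c y := by
  obtain ⟨r, hr0, hr⟩ := exists_kahlerForm_pow_pos g ((chartAt (Fin n → ℂ) c).symm y)
  have h := chartForm_frame rfl (fun x => wedgePow (g.kahlerForm x) n) c y
  simp only [Fin.cast_eq_self, hr] at h
  unfold volDensity
  rw [h, ← Complex.ofReal_mul, Complex.ofReal_re]
  exact mul_pos (det_chartDeriv_pos c hy) hr0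

/-- In a chart, a form of top degree which is `f ωⁿ` on `X` is `f` times the volume density. -/
theorem chartForm_eq_mul_volDensity (g : HermitianMetric n X) {k : ℕ} (hk : k = 2 * n)
    (α : DForm n X k) (f : X → ℂ)
    (h : ∀ x, α x (fun i => realFrame n (i.cast hk)) =
      f x * wedgePow (g.kahlerForm x) n (realFrame n)) (c : X) (y : Fin n → ℂ) :
    chartForm c α y (fun i => realFrame n (i.cast hk)) =
      f ((chartAt (Fin n → ℂ) c).symm y) * (volDensity g c y : ℂ) := by
  have h1 := chartForm_frame rfl (fun x => wedgePow (g.kahlerForm x) n) c y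
  simp only [Fin.cast_eq_self] at h1
  rw [chartForm_frame, h, ofReal_volDensity, h1]
  ring

theorem continuousOn_volDensity [T2Space X] (g : HermitianMetric n X) (c : X) :
    ContinuousOn (volDensity g c) (chartAt (Fin n → ℂ) c).target :=
  Complex.continuous_re.comp_continuousOn (contDiffOn_chartForm_wedgePow g c n _).continuousOn

/-- Transformation of the volume density under a change of charts. The Jacobian of a holomorphic
map is nonnegative. -/
theorem volDensity_transition (g : HermitianMetric n X) (c' c : X) {y : Fin n → ℂ}
    (hy : y ∈ (chartAt (Fin n → ℂ) c').target)
    (hc : (chartAt (Fin n → ℂ) c').symm y ∈ (chartAt (Fin n → ℂ) c).source) :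
    volDensity g c' y = |(fderiv ℝ (transition c' c) y).det| * volDensity g c (transition c' c y) := by
  have h1 : (chartAt (Fin n → ℂ) c).symm (transition c' c y) = (chartAt (Fin n → ℂ) c').symm y :=
    (chartAt (Fin n → ℂ) c).left_inv hc
  have h2 : chartForm c' (fun x => wedgePow (g.kahlerForm x) n) y (realFrame n) =
      chartForm c (fun x => wedgePow (g.kahlerForm x) n) (transition c' c y)
        fun i => (fderiv ℝ (transition c' c) y : (Fin n → ℂ) →ₗ[ℝ] (Fin n → ℂ)) (realFrame n i) := by
    rw [chartForm_apply, chartForm_apply, h1, chartDeriv_transition c' c hy hc]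
    rfl
  have h3 : 0 ≤ (fderiv ℝ (transition c' c) y).det := by
    rw [fderiv_transition c' c hy hc]
    exact det_restrictScalars_nonneg _
  rw [topForm_map, ← ofReal_volDensity, ← ofReal_volDensity, ← Complex.ofReal_mul] at h2
  rw [abs_of_nonneg h3]
  exact_mod_cast h2

/-- The integral of `u ωⁿ` over the coordinate domain of the chart centred at `c`. -/
def chartIntegral (g : HermitianMetric n X) (c : X) (u : X → ℝ) : ℝ :=
  ∫ y in (chartAt (Fin n → ℂ) c).target, u ((chartAt (Fin n → ℂ) c).symm y) * volDensity g c y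

/-- The integral of a function supported in two coordinate domains does not depend on the chart,
by the change of variables formula. -/
theorem chartIntegral_eq (g : HermitianMetric n X) (c' c : X) {u : X → ℝ}
    (hc' : Function.support u ⊆ (chartAt (Fin n → ℂ) c').source)
    (hc : Function.support u ⊆ (chartAt (Fin n → ℂ) c).source) :
    chartIntegral g c' u = chartIntegral g c u := by
  let Φ := (chartAt (Fin n → ℂ) c').symm ≫ₕ chartAt (Fin n → ℂ) c
  have hsrc : ∀ y, y ∈ Φ.source ↔ y ∈ (chartAt (Fin n → ℂ) c').target ∧
      (chartAt (Fin n → ℂ) c').symm y ∈ (chartAt (Fin n → ℂ) c).source := fun y => by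
    simp [Φ]
  have htgt : ∀ y, y ∈ Φ.target ↔ y ∈ (chartAt (Fin n → ℂ) c).target ∧
      (chartAt (Fin n → ℂ) c).symm y ∈ (chartAt (Fin n → ℂ) c').source := fun y => by
    simp [Φ]
  have h1 : chartIntegral g c' u = ∫ y in Φ.source,
      u ((chartAt (Fin n → ℂ) c').symm y) * volDensity g c' y := by
    refine setIntegral_eq_of_subset_of_forall_sdiff_eq_zero
      (chartAt (Fin n → ℂ) c').open_target.measurableSet (fun y hy => ((hsrc y).1 hy).1) ?_
    rintro y ⟨hy, hy'⟩
    have : u ((chartAt (Fin n → ℂ) c').symm y) = 0 := by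
      by_contra h
      exact hy' ((hsrc y).2 ⟨hy, hc h⟩)
    rw [this, zero_mul]
  have h2 : chartIntegral g c u = ∫ y in Φ.target,
      u ((chartAt (Fin n → ℂ) c).symm y) * volDensity g c y := by
    refine setIntegral_eq_of_subset_of_forall_sdiff_eq_zero
      (chartAt (Fin n → ℂ) c).open_target.measurableSet (fun y hy => ((htgt y).1 hy).1) ?_
    rintro y ⟨hy, hy'⟩
    have : u ((chartAt (Fin n → ℂ) c).symm y) = 0 := by
      by_contra h
      exact hy' ((htgt y).2 ⟨hy, hc' h⟩)
    rw [this, zero_mul]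
  rw [h1, h2, ← Φ.image_source_eq_target]
  have h3 := integral_image_eq_integral_abs_det_fderiv_smul volume Φ.open_source.measurableSet
    (f := transition c' c) (f' := fun y => fderiv ℝ (transition c' c) y)
    (fun y hy => ((differentiableAt_transition c' c ((hsrc y).1 hy).1
      ((hsrc y).1 hy).2).restrictScalars ℝ).hasFDerivAt.hasFDerivWithinAt) Φ.injOn
    (fun y => u ((chartAt (Fin n → ℂ) c).symm y) * volDensity g c y)
  refine Eq.trans ?_ h3.symm
  refine setIntegral_congr_fun Φ.open_source.measurableSet fun y hy => ?_
  have h4 : (chartAt (Fin n → ℂ) c).symm (transition c' c y) = (chartAt (Fin n → ℂ) c').symm y :=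
    (chartAt (Fin n → ℂ) c).left_inv ((hsrc y).1 hy).2
  simp only [smul_eq_mul]
  rw [h4, volDensity_transition g c' c ((hsrc y).1 hy).1 ((hsrc y).1 hy).2]
  ring

section Integrability

variable [T2Space X] [CompactSpace X]

theorem isCompact_image_tsupport (c : X) {u : X → ℝ}
    (hc : tsupport u ⊆ (chartAt (Fin n → ℂ) c).source) :
    IsCompact (chartAt (Fin n → ℂ) c '' tsupport u) :=
  (isClosed_tsupport u).isCompact.image_of_continuousOn
    ((chartAt (Fin n → ℂ) c).continuousOn.mono hc)

theorem continuousOn_chart_mul_volDensity (g : HermitianMetric n X) (c : X) {u : X → ℝ}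
    (hu : Continuous u) : ContinuousOn
      (fun y => u ((chartAt (Fin n → ℂ) c).symm y) * volDensity g c y)
      (chartAt (Fin n → ℂ) c).target :=
  (hu.comp_continuousOn (chartAt (Fin n → ℂ) c).continuousOn_symm).mul
    (continuousOn_volDensity g c)

theorem integrableOn_chart (g : HermitianMetric n X) (c : X) {u : X → ℝ} (hu : Continuous u)
    (hc : tsupport u ⊆ (chartAt (Fin n → ℂ) c).source) :
    IntegrableOn (fun y => u ((chartAt (Fin n → ℂ) c).symm y) * volDensity g c y)
      (chartAt (Fin n → ℂ) c).target := by
  have hK := isCompact_image_tsupport c hc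
  have hKU : chartAt (Fin n → ℂ) c '' tsupport u ⊆ (chartAt (Fin n → ℂ) c).target := by
    rintro _ ⟨x, hx, rfl⟩
    exact (chartAt (Fin n → ℂ) c).map_source (hc hx)
  refine IntegrableOn.of_forall_sdiff_eq_zero
    (((continuousOn_chart_mul_volDensity g c hu).mono hKU).integrableOn_compact hK)
    (chartAt (Fin n → ℂ) c).open_target.measurableSet ?_
  rintro y ⟨hy, hy'⟩
  have : u ((chartAt (Fin n → ℂ) c).symm y) = 0 := by
    by_contra h
    exact hy' ⟨_, subset_tsupport u h, (chartAt (Fin n → ℂ) c).right_inv hy⟩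
  rw [this, zero_mul]

/-- Only finitely many functions of the partition of unity are nonzero, by compactness. -/
theorem exists_chartPartition_finset :
    ∃ S : Finset X, ∀ c ∉ S, ∀ x : X, chartPartition n X c x = 0 := by
  have h := (chartPartition n X).locallyFinite.finite_nonempty_of_compact
  refine ⟨h.toFinset, fun c hc x => ?_⟩
  by_contra hx
  exact hc (h.mem_toFinset.2 ⟨x, hx⟩)

theorem tsupport_chartPartition (c : X) :
    tsupport (chartPartition n X c) ⊆ (chartAt (Fin n → ℂ) c).source :=
  Classical.choose_spec
    (SmoothPartitionOfUnity.exists_isSubordinate_chartAt_source (RealModel n) X) c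

theorem continuous_chartPartition (c : X) : Continuous (chartPartition n X c) :=
  (chartPartition n X c).contMDiff.continuous

/-- The integral of `f ωⁿ` over `X`. -/
def volIntegral (g : HermitianMetric n X) (f : X → ℝ) : ℝ :=
  ∑ᶠ c : X, chartIntegral g c fun x => chartPartition n X c x * f x

theorem volIntegral_eq_sum (g : HermitianMetric n X) {S : Finset X}
    (hS : ∀ c ∉ S, ∀ x : X, chartPartition n X c x = 0) (f : X → ℝ) :
    volIntegral g f = ∑ c ∈ S, chartIntegral g c fun x => chartPartition n X c x * f x := by
  refine finsum_eq_sum_of_support_subset _ fun c hc => ?_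
  by_contra h
  refine hc ?_
  simp [chartIntegral, hS c h]

/-- The integral of the form `f ωⁿ` is the real number `volIntegral g f`. -/
theorem formIntegral_eq_volIntegral (g : HermitianMetric n X) {k : ℕ} (hk : k = 2 * n)
    (α : DForm n X k) (f : X → ℝ)
    (h : ∀ x, α x (fun i => realFrame n (i.cast hk)) =
      (f x : ℂ) * wedgePow (g.kahlerForm x) n (realFrame n)) :
    formIntegral hk α = (volIntegral g f : ℂ) := by
  obtain ⟨S, hS⟩ := exists_chartPartition_finset (n := n) (X := X)
  have h1 : ∀ c : X, ∫ y in (chartAt (Fin n → ℂ) c).target,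
      (chartPartition n X c ((chartAt (Fin n → ℂ) c).symm y) : ℂ) *
        chartForm c α y (fun i => realFrame n (i.cast hk)) =
      ((chartIntegral g c fun x => chartPartition n X c x * f x : ℝ) : ℂ) := fun c => by
    unfold chartIntegral
    refine Eq.trans ?_ integral_complex_ofReal
    refine setIntegral_congr_fun (chartAt (Fin n → ℂ) c).open_target.measurableSet fun y _ => ?_
    simp only [chartForm_eq_mul_volDensity g hk α (fun x => (f x : ℂ)) h]
    push_cast
    ring
  unfold formIntegral
  simp only [h1]
  rw [volIntegral_eq_sum g hS, finsum_eq_sum_of_support_subset (s := S), Complex.ofReal_sum]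
  intro c hc
  by_contra h2
  refine hc ?_
  simp [chartIntegral, hS c h2]

theorem tsupport_partition_mul_subset (c : X) (f : X → ℝ) :
    tsupport (fun x => chartPartition n X c x * f x) ⊆ (chartAt (Fin n → ℂ) c).source :=
  (closure_mono (Function.support_mul_subset_left _ _)).trans (tsupport_chartPartition c)

theorem integrableOn_partition (g : HermitianMetric n X) (c : X) {f : X → ℝ} (hf : Continuous f) :
    IntegrableOn (fun y => (chartPartition n X c ((chartAt (Fin n → ℂ) c).symm y) *
      f ((chartAt (Fin n → ℂ) c).symm y)) * volDensity g c y) (chartAt (Fin n → ℂ) c).target :=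
  integrableOn_chart g c ((continuous_chartPartition c).mul hf) (tsupport_partition_mul_subset c f)

theorem volIntegral_add (g : HermitianMetric n X) {f f' : X → ℝ} (hf : Continuous f)
    (hf' : Continuous f') :
    volIntegral g (fun x => f x + f' x) = volIntegral g f + volIntegral g f' := by
  obtain ⟨S, hS⟩ := exists_chartPartition_finset (n := n) (X := X)
  simp only [volIntegral_eq_sum g hS]
  rw [← sum_add_distrib]
  refine sum_congr rfl fun c _ => ?_
  unfold chartIntegral
  rw [← integral_add (integrableOn_partition g c hf) (integrableOn_partition g c hf')]
  congr 1
  funext y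
  ring

theorem volIntegral_smul (g : HermitianMetric n X) (r : ℝ) (f : X → ℝ) :
    volIntegral g (fun x => r * f x) = r * volIntegral g f := by
  obtain ⟨S, hS⟩ := exists_chartPartition_finset (n := n) (X := X)
  simp only [volIntegral_eq_sum g hS]
  rw [mul_sum]
  refine sum_congr rfl fun c _ => ?_
  unfold chartIntegral
  rw [← integral_const_mul]
  congr 1
  funext y
  ring

/-- Integration against `ωⁿ` is bounded for the sup norm, since the density of `ωⁿ` is positive. -/
theorem exists_volIntegral_bound (g : HermitianMetric n X) :
    ∃ C : ℝ, ∀ (f : X → ℝ) (M : ℝ), Continuous f → (∀ x, |f x| ≤ M) → |volIntegral g f| ≤ C * M := by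
  obtain ⟨S, hS⟩ := exists_chartPartition_finset (n := n) (X := X)
  refine ⟨∑ c ∈ S, chartIntegral g c fun x => chartPartition n X c x * 1, fun f M hf hM => ?_⟩
  rw [volIntegral_eq_sum g hS, sum_mul]
  refine (abs_sum_le_sum_abs _ _).trans (sum_le_sum fun c _ => ?_)
  unfold chartIntegral
  rw [← integral_mul_const]
  have h1 := integrableOn_partition g c (f := fun _ => 1) continuous_const
  rw [← Real.norm_eq_abs]
  refine norm_integral_le_of_norm_le (h1.mul_const M) ?_
  refine (ae_restrict_iff' (chartAt (Fin n → ℂ) c).open_target.measurableSet).2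
    (Filter.Eventually.of_forall fun y hy => ?_)
  have h2 : 0 ≤ chartPartition n X c ((chartAt (Fin n → ℂ) c).symm y) :=
    (chartPartition n X).nonneg c _
  rw [Real.norm_eq_abs, abs_mul, abs_mul, abs_of_nonneg h2, abs_of_pos (volDensity_pos g c hy),
    mul_right_comm]
  simp only [mul_one]
  exact mul_le_mul_of_nonneg_left (hM _) (mul_nonneg h2 (volDensity_pos g c hy).le)

/-- A nonnegative continuous function with integral zero vanishes. -/
theorem eq_zero_of_volIntegral_eq_zero (g : HermitianMetric n X) {f : X → ℝ} (hf : Continuous f)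
    (h0 : ∀ x, 0 ≤ f x) (h : volIntegral g f = 0) (x : X) : f x = 0 := by
  obtain ⟨S, hS⟩ := exists_chartPartition_finset (n := n) (X := X)
  have hnn : ∀ c, ∀ y ∈ (chartAt (Fin n → ℂ) c).target,
      0 ≤ (chartPartition n X c ((chartAt (Fin n → ℂ) c).symm y) *
        f ((chartAt (Fin n → ℂ) c).symm y)) * volDensity g c y := fun c y hy =>
    mul_nonneg (mul_nonneg ((chartPartition n X).nonneg c _) (h0 _)) (volDensity_pos g c hy).le
  have hnn' : ∀ c, 0 ≤ chartIntegral g c fun x => chartPartition n X c x * f x := fun c =>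
    setIntegral_nonneg (chartAt (Fin n → ℂ) c).open_target.measurableSet (hnn c)
  rw [volIntegral_eq_sum g hS, sum_eq_zero_iff_of_nonneg fun c _ => hnn' c] at h
  obtain ⟨c, hc⟩ : ∃ c, 0 < chartPartition n X c x := by
    by_contra hcon
    push Not at hcon
    have h1 : ∀ c, chartPartition n X c x = 0 := fun c =>
      le_antisymm (hcon c) ((chartPartition n X).nonneg c x)
    have h2 := (chartPartition n X).sum_eq_one (Set.mem_univ x)
    simp [h1] at h2
  have hcS : c ∈ S := by
    by_contra h1
    rw [hS c h1] at hc
    exact lt_irrefl _ hc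
  have hx : x ∈ (chartAt (Fin n → ℂ) c).source :=
    tsupport_chartPartition c (subset_tsupport _ hc.ne')
  have hae := (setIntegral_eq_zero_iff_of_nonneg_ae
    ((ae_restrict_iff' (chartAt (Fin n → ℂ) c).open_target.measurableSet).2
      (Filter.Eventually.of_forall (hnn c))) (integrableOn_partition g c hf)).1 (h c hcS)
  have hEq := Measure.eqOn_open_of_ae_eq hae (chartAt (Fin n → ℂ) c).open_target
    (continuousOn_chart_mul_volDensity g c ((continuous_chartPartition c).mul hf))
    continuousOn_const
  have h3 := hEq ((chartAt (Fin n → ℂ) c).map_source hx)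
  simp only [(chartAt (Fin n → ℂ) c).left_inv hx, Pi.zero_apply] at h3
  have h4 := (mul_eq_zero.1 h3).resolve_right
    (volDensity_pos g c ((chartAt (Fin n → ℂ) c).map_source hx)).ne'
  exact (mul_eq_zero.1 h4).resolve_left hc.ne'

/-- The integral of a function supported in a coordinate domain can be computed in that chart. -/
theorem volIntegral_eq_chartIntegral (g : HermitianMetric n X) (c' : X) {f : X → ℝ}
    (hf : Continuous f) (hc' : tsupport f ⊆ (chartAt (Fin n → ℂ) c').source) :
    volIntegral g f = chartIntegral g c' f := by
  obtain ⟨S, hS⟩ := exists_chartPartition_finset (n := n) (X := X)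
  have h1 : ∀ c, tsupport (fun x => chartPartition n X c x * f x) ⊆
      (chartAt (Fin n → ℂ) c').source := fun c =>
    (closure_mono (Function.support_mul_subset_right _ _)).trans hc'
  have h2 : ∀ c, chartIntegral g c (fun x => chartPartition n X c x * f x) =
      chartIntegral g c' fun x => chartPartition n X c x * f x := fun c =>
    chartIntegral_eq g c c' ((subset_tsupport _).trans (tsupport_partition_mul_subset c f))
      ((subset_tsupport _).trans (h1 c))
  rw [volIntegral_eq_sum g hS]
  simp only [h2]
  unfold chartIntegral
  refine (integral_finsetSum S fun c _ =>
    integrableOn_chart g c' ((continuous_chartPartition c).mul hf) (h1 c)).symm.trans ?_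
  congr 1
  funext y
  simp only [Pi.mul_apply]
  rw [← sum_mul, ← sum_mul]
  have h3 : ∑ c ∈ S, chartPartition n X c ((chartAt (Fin n → ℂ) c').symm y) = 1 := by
    rw [← (chartPartition n X).sum_eq_one (Set.mem_univ ((chartAt (Fin n → ℂ) c').symm y))]
    refine (finsum_eq_sum_of_support_subset _ fun c hc => ?_).symm
    by_contra h
    exact hc (hS c h _)
  rw [h3, one_mul]

/-- Stokes' theorem for a one-form `θ` supported in a coordinate domain: on a balanced manifold
`∫ dθ ∧ ω^(n-1) = 0`. Here `ψ = dθ` and `f` is the function with `ψ ∧ ω^(n-1) = f ωⁿ`. -/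
theorem volIntegral_eq_zero_of_exact (hn : 1 ≤ n) (g : HermitianMetric n X) (hg : g.IsBalanced)
    (θ : ∀ x : X, TangentSpace (RealModel n) x →ₗ[ℝ] ℂ) (ψ : DForm n X 2)
    (hθ : ∀ V : SmoothVectorField n X, IsSmoothFun n fun x => θ x (V x))
    (hd : ∀ (V W : SmoothVectorField n X) (x : X), ψ x ![V x, W x] =
      mvfderiv (RealModel n) (fun y => θ y (W y)) x (V x) -
        mvfderiv (RealModel n) (fun y => θ y (V y)) x (W x) -
        θ x (VectorField.mlieBracket (RealModel n) V W x))
    {f : X → ℝ} (hf : Continuous f)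
    (hψ : ∀ x, wedge (ψ x) (wedgePow (g.kahlerForm x) (n - 1))
      (fun i => realFrame n (i.cast (by omega))) =
        (f x : ℂ) * wedgePow (g.kahlerForm x) n (realFrame n))
    (c : X) {K : Set X} (hK : IsClosed K) (hKc : K ⊆ (chartAt (Fin n → ℂ) c).source)
    (hθK : ∀ x ∉ K, θ x = 0) (hfK : ∀ x ∉ K, f x = 0) : volIntegral g f = 0 := by
  set φ := chartAt (Fin n → ℂ) c with hφ
  have hfs : tsupport f ⊆ K := closure_minimal (fun x hx => by
    by_contra h
    exact hx (hfK x h)) hK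
  rw [volIntegral_eq_chartIntegral g c hf (hfs.trans hKc)]
  have hk : 2 + 2 * (n - 1) = 2 * n := by omega
  have h1 : ((chartIntegral g c f : ℝ) : ℂ) = ∫ y in φ.target,
      wedge (chartForm c ψ y) (wedgePow (chartForm c g.kahlerForm y) (n - 1))
        fun i => realFrame n (i.cast hk) := by
    unfold chartIntegral
    refine integral_complex_ofReal.symm.trans ?_
    refine setIntegral_congr_fun φ.open_target.measurableSet fun y _ => ?_
    have h2 := chartForm_eq_mul_volDensity g hk
      (fun x => wedge (ψ x) (wedgePow (g.kahlerForm x) (n - 1))) (fun x => (f x : ℂ)) hψ c y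
    have h3 : chartForm c (fun x => wedge (ψ x) (wedgePow (g.kahlerForm x) (n - 1))) y =
        wedge (chartForm c ψ y) (wedgePow (chartForm c g.kahlerForm y) (n - 1)) := by
      rw [← chartForm_wedgePow]
      exact wedge_compContinuousLinearMap _ _ _
    rw [h3] at h2
    rw [Complex.ofReal_mul]
    exact h2.symm
  have h4 : ∫ y in φ.target,
      wedge (chartForm c ψ y) (wedgePow (chartForm c g.kahlerForm y) (n - 1))
        (fun i => realFrame n (i.cast hk)) = 0 := by
    have hKi : φ '' K ⊆ φ.target := by
      rintro _ ⟨x, hx, rfl⟩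
      exact φ.map_source (hKc hx)
    refine setIntegral_wedge_eq_zero φ.open_target
      (hK.isCompact.image_of_continuousOn (φ.continuousOn.mono hKc)) hKi
      (fun y w => θ (φ.symm y) (chartDeriv c y w)) _ _ (fun w => ?_) (fun w y hy => ?_)
      (fun m => ?_) (fun y hy u => ?_) (fun y hy u w => ?_) _
    · exact (contDiffOn_chart_of_smooth (k := 1) (fun x u => θ x (u 0)) (fun V => hθ (V 0)) c
        fun _ => w).of_le (WithTop.coe_le_coe.2 (le_top : (1 : ℕ∞) ≤ ⊤))
    · rw [hθK _ fun h => hy.2 ⟨_, h, φ.right_inv hy.1⟩]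
      rfl
    · exact (contDiffOn_wedgePow (contDiffOn_chartForm_kahlerForm g c) (n - 1) m).of_le
        (WithTop.coe_le_coe.2 (le_top : (1 : ℕ∞) ≤ ⊤))
    · have h5 := hg c y hy
      have h6 : chartForm c (fun x => wedgePow (g.kahlerForm x) (n - 1)) =
          fun y => wedgePow (chartForm c g.kahlerForm y) (n - 1) :=
        funext fun y => chartForm_wedgePow g c y (n - 1)
      rw [h6] at h5
      have h7 := extDeriv_apply (differentiableAt_of_apply (α := fun y =>
        wedgePow (chartForm c g.kahlerForm y) (n - 1)) (y := y) fun v =>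
          ((contDiffOn_wedgePow (contDiffOn_chartForm_kahlerForm g c) (n - 1) v).contDiffAt
            (φ.open_target.mem_nhds hy)).differentiableAt (by simp)) u
      rw [h5] at h7
      exact h7.symm
    · exact chart_extDeriv_oneForm θ (fun x v w => ψ x ![v, w]) hθ hd c hy u w |>.symm ▸ (by
        rw [chartForm_apply]
        congr 1
        funext i
        fin_cases i <;> rfl)
  rw [h4] at h1
  exact_mod_cast h1

end Integrability

end Volume

/-! ### Contraction with the bivector dual to the fundamental form -/

section Contraction

variable {n : ℕ} {X : Type*} [TopologicalSpace X] [ChartedSpace (Fin n → ℂ) X]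
  [IsManifold (RealModel n) ∞ X]

theorem map_contract {M N : Type*} [AddCommGroup M] [Module ℝ M] [AddCommGroup N] [Module ℝ N]
    (g : HermitianMetric n X) (x : X) (L : M →ₗ[ℝ] N)
    (ψ : TangentSpace (RealModel n) x → TangentSpace (RealModel n) x → M) :
    L (g.contract x ψ) = g.contract x fun v w => L (ψ v w) := by
  simp only [HermitianMetric.contract, map_smul, map_sum]

theorem contract_add {M : Type*} [AddCommGroup M] [Module ℝ M]
    (g : HermitianMetric n X) (x : X)
    (ψ φ : TangentSpace (RealModel n) x → TangentSpace (RealModel n) x → M) :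
    g.contract x (fun v w => ψ v w + φ v w) = g.contract x ψ + g.contract x φ := by
  simp only [HermitianMetric.contract, smul_add, sum_add_distrib]

theorem contract_sum {M ι : Type*} [AddCommGroup M] [Module ℝ M]
    (g : HermitianMetric n X) (x : X) (s : Finset ι)
    (ψ : ι → TangentSpace (RealModel n) x → TangentSpace (RealModel n) x → M) :
    g.contract x (fun v w => ∑ i ∈ s, ψ i v w) = ∑ i ∈ s, g.contract x (ψ i) := by
  classical
  induction s using Finset.induction_on with
  | empty => simp [HermitianMetric.contract]
  | insert i s hi ih => simp only [sum_insert hi, contract_add, ih]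

theorem contract_const_smul {M : Type*} [AddCommGroup M] [Module ℝ M] (g : HermitianMetric n X)
    (x : X) (r : ℝ) (ψ : TangentSpace (RealModel n) x → TangentSpace (RealModel n) x → M) :
    g.contract x (fun v w => r • ψ v w) = r • g.contract x ψ := by
  have h := map_contract g x (LinearMap.lsmul ℝ M r) ψ
  simp only [LinearMap.lsmul_apply] at h
  exact h.symm

theorem contract_const_mul (g : HermitianMetric n X) (x : X) (c : ℂ)
    (ψ : TangentSpace (RealModel n) x → TangentSpace (RealModel n) x → ℂ) :
    g.contract x (fun v w => c * ψ v w) = c * g.contract x ψ :=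
  (map_contract g x (LinearMap.mulLeft ℝ c) ψ).symm

/-- The contraction `Λ_ω ψ` of a complex two-form. -/
def contractForm (g : HermitianMetric n X) (x : X) (ψ : (Fin n → ℂ) [⋀^Fin 2]→L[ℝ] ℂ) : ℂ :=
  g.contract x fun v w => ψ ![v, w]

theorem contractForm_add (g : HermitianMetric n X) (x : X) (ψ φ : (Fin n → ℂ) [⋀^Fin 2]→L[ℝ] ℂ) :
    contractForm g x (ψ + φ) = contractForm g x ψ + contractForm g x φ :=
  contract_add g x _ _

theorem contractForm_smul (g : HermitianMetric n X) (x : X) (r : ℝ)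
    (ψ : (Fin n → ℂ) [⋀^Fin 2]→L[ℝ] ℂ) : contractForm g x (r • ψ) = r * contractForm g x ψ :=
  (contract_const_smul g x r _).trans (Complex.real_smul)

theorem contractForm_re (g : HermitianMetric n X) (x : X)
    (ψ : (Fin n → ℂ) [⋀^Fin 2]→L[ℝ] ℂ) :
    (contractForm g x ψ).re = 1 / 2 * ∑ i, ∑ j, (g.kahlerMatrix x)⁻¹ j i *
      (ψ ![realFrame n i, realFrame n j]).re := by
  unfold contractForm
  have h := map_contract g x (Complex.reCLM : ℂ →ₗ[ℝ] ℝ) fun v w => ψ ![v, w]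
  exact h

theorem contractForm_im (g : HermitianMetric n X) (x : X)
    (ψ : (Fin n → ℂ) [⋀^Fin 2]→L[ℝ] ℂ) (h : ∀ v w, (ψ ![v, w]).im = 0) :
    (contractForm g x ψ).im = 0 := by
  have h1 := map_contract g x (Complex.imCLM : ℂ →ₗ[ℝ] ℝ) fun v w => ψ ![v, w]
  refine Eq.trans h1 ?_
  have h2 : (fun v w : TangentSpace (RealModel n) x =>
      (Complex.imCLM : ℂ →ₗ[ℝ] ℝ) (ψ ![v, w])) = fun _ _ => 0 :=
    funext fun v => funext fun w => h v w
  rw [h2]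
  simp [HermitianMetric.contract]

/-- `n ψ ∧ ω^(n-1) = (Λ_ω ψ) ωⁿ`. -/
theorem wedge_kahlerForm_pow (hn : 1 ≤ n) (g : HermitianMetric n X) (x : X)
    (ψ : (Fin n → ℂ) [⋀^Fin 2]→L[ℝ] ℂ) :
    wedge ψ (wedgePow (g.kahlerForm x) (n - 1)) (fun i => realFrame n (i.cast (by omega))) =
      contractForm g x ψ / n * wedgePow (g.kahlerForm x) n (realFrame n) := by
  -- the identity for real forms extends to complex ones by complex linearity
  have hreal : ∀ ψ : (Fin n → ℂ) [⋀^Fin 2]→L[ℝ] ℂ, (∀ v w, (ψ ![v, w]).im = 0) →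
      wedge ψ (wedgePow (g.kahlerForm x) (n - 1)) (fun i => realFrame n (i.cast (by omega))) =
      contractForm g x ψ / n * wedgePow (g.kahlerForm x) n (realFrame n) := fun ψ hψ => by
    have hW := kahler_matrix_isUnit (metricBilin_symm g x) (metricBilin_pos g x)
      (kahlerMatrix_apply g x)
    have hc : contractForm g x ψ = ((contractForm g x ψ).re : ℂ) :=
      Complex.ext rfl (contractForm_im g x ψ hψ)
    have hn0 : (n : ℂ) ≠ 0 := by exact_mod_cast (by omega : n ≠ 0)
    rw [hc, contractForm_re, div_mul_eq_mul_div, eq_div_iff hn0, mul_comm]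
    obtain ⟨k, rfl⟩ : ∃ k, n = k + 1 := ⟨n - 1, by omega⟩
    exact natCast_mul_wedge_wedgePow _ _ ψ (g.kahlerMatrix x)
      (Matrix.of fun i j => (ψ ![realFrame (k + 1) i, realFrame (k + 1) j]).re) hW (fun i j => rfl)
      fun i j => Complex.ext rfl (hψ _ _)
  let P : ℂ →L[ℝ] ℂ := Complex.ofRealCLM.comp Complex.reCLM
  let Q : ℂ →L[ℝ] ℂ := Complex.ofRealCLM.comp Complex.imCLM
  have hψ : ψ = P.compContinuousAlternatingMap ψ +
      Complex.I • Q.compContinuousAlternatingMap ψ := by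
    ext v
    have h := Complex.re_add_im (ψ v)
    rw [mul_comm] at h
    exact h.symm
  have hp := hreal (P.compContinuousAlternatingMap ψ) fun v w => Complex.ofReal_im _
  have hq := hreal (Q.compContinuousAlternatingMap ψ) fun v w => Complex.ofReal_im _
  have hI : contractForm g x (Complex.I • Q.compContinuousAlternatingMap ψ) =
      Complex.I * contractForm g x (Q.compContinuousAlternatingMap ψ) :=
    contract_const_mul g x Complex.I _
  rw [hψ, wedge_add_left, wedge_smul_left, contractForm_add, hI,
    ContinuousAlternatingMap.add_apply, ContinuousAlternatingMap.smul_apply, hp, hq, smul_eq_mul]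
  ring

end Contraction

section ContractionSmooth

variable {n : ℕ} {X : Type*} [TopologicalSpace X] [ChartedSpace (Fin n → ℂ) X]
  [IsManifold (ComplexModel n) ω X] [T2Space X]

/-- The contraction of a smooth two-form is continuous: in a chart it is a quotient of the
coefficients of `n ψ ∧ ω^(n-1)` and `ωⁿ`. -/
theorem continuous_contractForm (hn : 1 ≤ n) (g : HermitianMetric n X) (ψ : DForm n X 2)
    (hψ : ∀ V W : SmoothVectorField n X, IsSmoothFun n fun x => ψ x ![V x, W x]) :
    Continuous fun x => contractForm g x (ψ x) := by
  have hk : 2 + 2 * (n - 1) = 2 * n := by omega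
  have hn0 : (n : ℂ) ≠ 0 := by exact_mod_cast (by omega : n ≠ 0)
  rw [continuous_iff_continuousAt]
  intro c
  set φ := chartAt (Fin n → ℂ) c with hφ
  have h1 : ∀ v : Fin 2 → Fin n → ℂ, ContDiffOn ℝ ∞ (fun y => chartForm c ψ y v) φ.target := fun v => by
    refine (contDiffOn_chart_of_smooth (fun x u => ψ x u) (fun V => ?_) c v)
    have h := hψ (V 0) (V 1)
    have h' : (fun x => ψ x fun i => V i x) = fun x => ψ x ![V 0 x, V 1 x] := by
      funext x
      refine congrArg (ψ x) (funext fun i => ?_)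
      fin_cases i <;> rfl
    exact h'.symm ▸ h
  have h2 := (contDiffOn_wedge h1 (contDiffOn_chartForm_wedgePow g c (n - 1))
    fun i => realFrame n (i.cast hk)).continuousOn
  have h3 : ContinuousOn (fun y => contractForm g (φ.symm y) (ψ (φ.symm y))) φ.target := by
    have h4 : ContinuousOn (fun y => ((volDensity g c y : ℝ) : ℂ)) φ.target :=
      Complex.continuous_ofReal.comp_continuousOn (continuousOn_volDensity g c)
    refine ((h2.div h4 fun y hy => ?_).const_mul (n : ℂ) |>.congr fun y hy => ?_)
    · exact_mod_cast (volDensity_pos g c hy).ne'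
    · have h5 := chartForm_eq_mul_volDensity g hk
        (fun x => wedge (ψ x) (wedgePow (g.kahlerForm x) (n - 1)))
        (fun x => contractForm g x (ψ x) / n) (fun x => wedge_kahlerForm_pow hn g x (ψ x)) c y
      have h6 : chartForm c (fun x => wedge (ψ x) (wedgePow (g.kahlerForm x) (n - 1))) y =
          wedge (chartForm c ψ y) (chartForm c (fun x => wedgePow (g.kahlerForm x) (n - 1)) y) :=
        wedge_compContinuousLinearMap _ _ _
      rw [h6] at h5
      have hv : ((volDensity g c y : ℝ) : ℂ) ≠ 0 := by exact_mod_cast (volDensity_pos g c hy).ne'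
      refine Eq.trans ?_ (congrArg (fun z => (n : ℂ) * (z / (volDensity g c y : ℂ))) h5.symm)
      field_simp
      rfl
  have h6 : ContinuousOn ((fun y => contractForm g (φ.symm y) (ψ (φ.symm y))) ∘ φ) φ.source :=
    h3.comp φ.continuousOn fun x hx => φ.map_source hx
  have h7 : ContinuousOn (fun x => contractForm g x (ψ x)) φ.source :=
    h6.congr fun x hx => by
      change _ = contractForm g (φ.symm (φ x)) (ψ (φ.symm (φ x)))
      rw [φ.left_inv hx]
  exact h7.continuousAt (φ.open_source.mem_nhds (mem_chart_source _ c))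

/-- The complex structure preserves smooth vector fields. -/
theorem contMDiff_complexStructure (V : SmoothVectorField n X) :
    ContMDiff (RealModel n) ((RealModel n).prod 𝓘(ℝ, Fin n → ℂ)) ∞
      fun x => TotalSpace.mk' (Fin n → ℂ) (E := (TangentSpace (RealModel n) : X → Type _)) x
        (complexStructure x (V x)) := by
  intro c
  have h := V.contMDiff c
  rw [contMDiffAt_section] at h ⊢
  set e := trivializationAt (Fin n → ℂ) (TangentSpace (RealModel n) : X → Type _) c with he
  have hI : ContMDiff 𝓘(ℝ, Fin n → ℂ) 𝓘(ℝ, Fin n → ℂ) ∞ fun v : Fin n → ℂ => Complex.I • v :=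
    (contDiff_id.const_smul Complex.I).contMDiff
  have h2 := (hI _).comp c h
  refine h2.congr_of_eventuallyEq ?_
  filter_upwards [(chartAt (Fin n → ℂ) c).open_source.mem_nhds (mem_chart_source _ c)] with x hx
  have hxe : x ∈ e.baseSet := hx
  set u : Fin n → ℂ := (e ⟨x, V x⟩).2 with hu
  have hV : V x = e.symm x u := (e.symm_apply_apply_mk hxe (V x)).symm
  have h3 : complexStructure x (V x) = e.symm x (Complex.I • u) := by
    rw [hV]
    have h4 := symm_trivializationAt_tangent c hx u
    have h5 := symm_trivializationAt_tangent c hx (Complex.I • u)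
    refine Eq.trans ?_ h5.symm
    rw [chartDeriv_I_smul c ((chartAt (Fin n → ℂ) c).map_source hx)]
    exact congrArg (fun z : Fin n → ℂ => Complex.I • z) h4
  change (e ⟨x, complexStructure x (V x)⟩).2 = Complex.I • u
  rw [h3, e.apply_mk_symm hxe]

end ContractionSmooth

/-! ### Traces of products of skew-hermitian endomorphisms -/

section TraceForms

variable {H : Type*} [NormedAddCommGroup H] [InnerProductSpace ℂ H]

theorem IsSkewHermitian.sub {S T : H →ₗ[ℂ] H} (hS : IsSkewHermitian S) (hT : IsSkewHermitian T) :
    IsSkewHermitian (S - T) := by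
  have h := hS.add (hT.real_smul (-1))
  rwa [neg_one_smul, ← sub_eq_add_neg] at h

theorem IsSkewHermitian.commutator {S T : H →ₗ[ℂ] H} (hS : IsSkewHermitian S)
    (hT : IsSkewHermitian T) : IsSkewHermitian (S ∘ₗ T - T ∘ₗ S) := fun e f => by
  simp only [LinearMap.sub_apply, LinearMap.comp_apply, inner_sub_left, inner_sub_right, hS _ f,
    hT _ f, hS e, hT e, neg_neg]
  ring

variable [FiniteDimensional ℂ H]

/-- The trace of a product of two skew-hermitian endomorphisms is real. -/
theorem IsSkewHermitian.conj_trace_comp {S T : H →ₗ[ℂ] H} (hS : IsSkewHermitian S)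
    (hT : IsSkewHermitian T) : starRingEnd ℂ (LinearMap.trace ℂ H (S ∘ₗ T)) =
      LinearMap.trace ℂ H (S ∘ₗ T) := by
  have hb := stdOrthonormalBasis ℂ H
  rw [LinearMap.trace_eq_sum_inner (S ∘ₗ T) hb, map_sum]
  conv_rhs => rw [← LinearMap.trace_eq_sum_inner (S ∘ₗ T) hb, LinearMap.trace_comp_comm',
    LinearMap.trace_eq_sum_inner _ hb]
  refine sum_congr rfl fun i _ => ?_
  rw [inner_conj_symm, LinearMap.comp_apply, LinearMap.comp_apply, hS, hT, neg_neg]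

theorem IsSkewHermitian.trace_comp_im {S T : H →ₗ[ℂ] H} (hS : IsSkewHermitian S)
    (hT : IsSkewHermitian T) : (LinearMap.trace ℂ H (S ∘ₗ T)).im = 0 :=
  Complex.conj_eq_iff_im.1 (hS.conj_trace_comp hT)

/-- The trace of a skew-hermitian endomorphism is imaginary. -/
theorem IsSkewHermitian.I_mul_trace_im {S : H →ₗ[ℂ] H} (hS : IsSkewHermitian S) :
    (Complex.I * LinearMap.trace ℂ H S).im = 0 := by
  have hb := stdOrthonormalBasis ℂ H
  rw [LinearMap.trace_eq_sum_inner S hb]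
  simp only [Complex.mul_im, Complex.I_re, zero_mul, Complex.I_im, one_mul, zero_add, Complex.re_sum]
  refine sum_eq_zero fun i _ => ?_
  have h1 := congrArg Complex.re (hS (hb i) (hb i))
  rw [← inner_conj_symm, Complex.conj_re, Complex.neg_re] at h1
  linarith

/-- `-tr(S²)` is the squared Hilbert-Schmidt norm of `S`. -/
theorem IsSkewHermitian.re_trace_comp_self {S : H →ₗ[ℂ] H} (hS : IsSkewHermitian S) :
    -(LinearMap.trace ℂ H (S ∘ₗ S)).re = ∑ i, ‖S (stdOrthonormalBasis ℂ H i)‖ ^ 2 := by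
  rw [LinearMap.trace_eq_sum_inner (S ∘ₗ S) (stdOrthonormalBasis ℂ H), Complex.re_sum,
    ← sum_neg_distrib]
  refine sum_congr rfl fun i _ => ?_
  rw [LinearMap.comp_apply, ← Complex.neg_re, ← hS, inner_self_eq_norm_sq_to_K]
  norm_cast

theorem IsSkewHermitian.eq_zero_of_trace {S : H →ₗ[ℂ] H} (hS : IsSkewHermitian S)
    (h : (LinearMap.trace ℂ H (S ∘ₗ S)).re = 0) : S = 0 := by
  have h1 := hS.re_trace_comp_self
  rw [h, neg_zero, eq_comm, sum_eq_zero_iff_of_nonneg fun i _ => by positivity] at h1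
  refine (stdOrthonormalBasis ℂ H).toBasis.ext fun i => ?_
  simpa using h1 i (mem_univ i)

end TraceForms

/-! ### Integrals of two-forms -/

section TwoFormIntegral

variable {n : ℕ} {X : Type*} [TopologicalSpace X] [ChartedSpace (Fin n → ℂ) X]

/-- A two-form is smooth if its values on smooth vector fields are. -/
def IsSmoothTwoForm [IsManifold (RealModel n) ∞ X] (ψ : DForm n X 2) : Prop :=
  ∀ V W : SmoothVectorField n X, IsSmoothFun n fun x => ψ x ![V x, W x]

variable [IsManifold (ComplexModel n) ω X] [T2Space X] [CompactSpace X]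

/-- The integral `∫ Re(Λ_ω ψ) ωⁿ`, which is `n ∫ ψ ∧ ω^(n-1)` for a real two-form `ψ`. -/
def twoFormIntegral (g : HermitianMetric n X) (ψ : DForm n X 2) : ℝ :=
  volIntegral g fun x => (contractForm g x (ψ x)).re

theorem continuous_re_contractForm (hn : 1 ≤ n) (g : HermitianMetric n X) {ψ : DForm n X 2}
    (hψ : IsSmoothTwoForm ψ) : Continuous fun x => (contractForm g x (ψ x)).re :=
  Complex.continuous_re.comp (continuous_contractForm hn g ψ hψ)

theorem twoFormIntegral_add (hn : 1 ≤ n) (g : HermitianMetric n X) {ψ φ : DForm n X 2}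
    (hψ : IsSmoothTwoForm ψ) (hφ : IsSmoothTwoForm φ) :
    twoFormIntegral g (fun x => ψ x + φ x) = twoFormIntegral g ψ + twoFormIntegral g φ := by
  unfold twoFormIntegral
  rw [← volIntegral_add g (continuous_re_contractForm hn g hψ) (continuous_re_contractForm hn g hφ)]
  simp only [contractForm_add, Complex.add_re]

theorem twoFormIntegral_smul (g : HermitianMetric n X) (r : ℝ) (ψ : DForm n X 2) :
    twoFormIntegral g (fun x => r • ψ x) = r * twoFormIntegral g ψ := by
  unfold twoFormIntegral
  rw [← volIntegral_smul]
  simp only [contractForm_smul, Complex.re_ofReal_mul]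

/-- For a real two-form, `n ∫ ψ ∧ ω^(n-1) = ∫ (Λ_ω ψ) ωⁿ`. -/
theorem formIntegral_wedge_kahlerForm_pow (hn : 1 ≤ n) (g : HermitianMetric n X) {ψ : DForm n X 2}
    (hψ : ∀ x v w, (ψ x ![v, w]).im = 0) (hk : 2 + 2 * (n - 1) = 2 * n) :
    formIntegral hk (fun x => wedge (ψ x) (wedgePow (g.kahlerForm x) (n - 1))) =
      (((1 / n : ℝ) * twoFormIntegral g ψ : ℝ) : ℂ) := by
  rw [formIntegral_eq_volIntegral g hk _ (fun x => (1 / n : ℝ) * (contractForm g x (ψ x)).re),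
    volIntegral_smul]
  · rfl
  · intro x
    have h := wedge_kahlerForm_pow hn g x (ψ x)
    rw [show contractForm g x (ψ x) = ((contractForm g x (ψ x)).re : ℂ) from
      Complex.ext rfl (contractForm_im g x (ψ x) (hψ x))] at h
    rw [h]
    push_cast
    ring

end TwoFormIntegral

/-! ### Endomorphism-valued two-forms and their traces -/

section TraceTwoForms

variable {n : ℕ} {X : Type*} [TopologicalSpace X] [ChartedSpace (Fin n → ℂ) X]
  {F : Type*} [NormedAddCommGroup F] [NormedSpace ℂ F] [FiniteDimensional ℂ F]
  {E : X → Type*} [TopologicalSpace (TotalSpace F E)] [∀ x, NormedAddCommGroup (E x)]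
  [∀ x, InnerProductSpace ℂ (E x)] [FiberBundle F E] [VectorBundle ℂ F E] [VectorBundle ℝ F E]
  [IsManifold (RealModel n) ∞ X] [ContMDiffVectorBundle ∞ F E (RealModel n)]
  [T2Space X] [CompactSpace X]

theorem IsSmoothFun.sub {f g : X → ℂ} (hf : IsSmoothFun n f) (hg : IsSmoothFun n g) :
    IsSmoothFun n fun x => f x - g x := by
  have h := hf.add ((IsSmoothFun.const (-1)).mul hg)
  simpa [sub_eq_add_neg] using h

theorem IsSmoothEnd.sub {S T : ∀ x, E x →ₗ[ℂ] E x} (hS : IsSmoothEnd n F S)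
    (hT : IsSmoothEnd n F T) : IsSmoothEnd n F fun x => S x - T x := fun s =>
  (endAct S hS s - endAct T hT s).contMDiff

/-- A smooth two-form with values in the skew-hermitian endomorphisms of `E`. Only the bilinear
map is recorded, together with `B(v, v) = 0`. -/
structure IsEndTwoForm (B : ∀ x : X, TangentSpace (RealModel n) x →ₗ[ℝ]
    TangentSpace (RealModel n) x →ₗ[ℝ] (E x →ₗ[ℂ] E x)) : Prop where
  self_eq_zero : ∀ x v, B x v v = 0
  skew : ∀ x v w, IsSkewHermitian (B x v w)
  smooth : ∀ V W : SmoothVectorField n X, IsSmoothEnd n F fun x => B x (V x) (W x)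

theorem IsEndTwoForm.sub {B C : ∀ x : X, TangentSpace (RealModel n) x →ₗ[ℝ]
    TangentSpace (RealModel n) x →ₗ[ℝ] (E x →ₗ[ℂ] E x)}
    (hB : IsEndTwoForm (n := n) (F := F) B) (hC : IsEndTwoForm (n := n) (F := F) C) :
    IsEndTwoForm (n := n) (F := F) fun x => B x - C x where
  self_eq_zero x v := by
    rw [LinearMap.sub_apply, LinearMap.sub_apply, hB.1, hC.1, sub_zero]
  skew x v w := (hB.skew x v w).sub (hC.skew x v w)
  smooth V W := (hB.smooth V W).sub (hC.smooth V W)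

theorem isEndTwoForm_curvature (hE : IsSmoothHermitian n F E) (A : UnitaryConnection n X F E) :
    IsEndTwoForm (n := n) (F := F) (curvatureBilin A) where
  self_eq_zero x v := by
    have h : (2 : ℝ) • A.curvature x v v = 0 := by
      rw [two_smul]
      exact add_eq_zero_iff_eq_neg.2 (curvature_swap A x v v)
    exact (smul_eq_zero.1 h).resolve_left two_ne_zero
  skew := isSkewHermitian_curvature hE A
  smooth := isSmooth_curvature A

theorem isEndTwoForm_oneFormSq (a : unitaryOneForms n X F E) :
    IsEndTwoForm (n := n) (F := F) (oneFormSq a) where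
  self_eq_zero x v := sub_self (a.1 x v ∘ₗ a.1 x v)
  skew x v w := (a.2.1 x v).commutator (a.2.1 x w)
  smooth V W := ((isSmoothEnd_oneForm a V).comp (isSmoothEnd_oneForm a W)).sub
    ((isSmoothEnd_oneForm a W).comp (isSmoothEnd_oneForm a V))

theorem isEndTwoForm_covOneForm (hE : IsSmoothHermitian n F E)
    (A : UnitaryConnection n X F E) (a : unitaryOneForms n X F E) :
    IsEndTwoForm (n := n) (F := F) (covOneForm A a) :=
  ((isEndTwoForm_curvature hE (a +ᵥ A)).sub (isEndTwoForm_curvature hE A)).sub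
    (isEndTwoForm_oneFormSq a)

/-- The two-form `tr(ζ B)`. -/
def traceForm (ζ : gaugeLieAlgebra n X F E) (B : ∀ x : X, TangentSpace (RealModel n) x →ₗ[ℝ]
    TangentSpace (RealModel n) x →ₗ[ℝ] (E x →ₗ[ℂ] E x)) (hB : IsEndTwoForm (n := n) (F := F) B) :
    DForm n X 2 := fun x =>
  twoForm ((B x).compr₂ ((LinearMap.trace ℂ (E x) ∘ₗ LinearMap.mulLeft ℂ (ζ.1 x)).restrictScalars ℝ))
    fun v => (congrArg (LinearMap.trace ℂ (E x) ∘ₗ LinearMap.mulLeft ℂ (ζ.1 x))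
      (hB.self_eq_zero x v)).trans (map_zero _)

theorem twoForm_ext {x : X} {α β : (Fin n → ℂ) [⋀^Fin 2]→L[ℝ] ℂ}
    (h : ∀ v w : TangentSpace (RealModel n) x, α ![v, w] = β ![v, w]) : α = β := by
  ext u
  have hu : u = ![u 0, u 1] := by
    funext i
    fin_cases i <;> rfl
  rw [hu]
  exact h _ _

theorem traceWedge_apply (a b : unitaryOneForms n X F E) (x : X)
    (v w : TangentSpace (RealModel n) x) : traceWedge a b x ![v, w] =
      LinearMap.trace ℂ (E x) (a.1 x v ∘ₗ b.1 x w) -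
        LinearMap.trace ℂ (E x) (a.1 x w ∘ₗ b.1 x v) := rfl

variable (R : Resolution n F E) (hE : IsSmoothHermitian n F E)

include R in
theorem traceForm_im (ζ : gaugeLieAlgebra n X F E) {B : ∀ x : X, TangentSpace (RealModel n) x →ₗ[ℝ]
    TangentSpace (RealModel n) x →ₗ[ℝ] (E x →ₗ[ℂ] E x)} (hB : IsEndTwoForm (n := n) (F := F) B)
    (x : X) (v w : TangentSpace (RealModel n) x) : (traceForm ζ B hB x ![v, w]).im = 0 :=
  haveI := R.finite x
  (ζ.2.1 x).trace_comp_im (hB.skew x v w)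

include R hE in
theorem isSmooth_traceForm (ζ : gaugeLieAlgebra n X F E) {B : ∀ x : X, TangentSpace (RealModel n) x →ₗ[ℝ]
    TangentSpace (RealModel n) x →ₗ[ℝ] (E x →ₗ[ℂ] E x)} (hB : IsEndTwoForm (n := n) (F := F) B) :
    IsSmoothTwoForm (traceForm ζ B hB) := fun V W =>
  R.isSmooth_trace hE ((isSmoothEnd_gauge ζ).comp (hB.smooth V W))

include R in
theorem traceWedge_im (a b : unitaryOneForms n X F E) (x : X)
    (v w : TangentSpace (RealModel n) x) : (traceWedge a b x ![v, w]).im = 0 := by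
  have := R.finite x
  rw [traceWedge_apply, Complex.sub_im, (a.2.1 x v).trace_comp_im (b.2.1 x w),
    (a.2.1 x w).trace_comp_im (b.2.1 x v), sub_zero]

include R hE in
theorem isSmooth_traceWedge (a b : unitaryOneForms n X F E) : IsSmoothTwoForm (traceWedge a b) :=
  fun V W => (R.isSmooth_trace hE ((isSmoothEnd_oneForm a V).comp (isSmoothEnd_oneForm b W))).sub
    (R.isSmooth_trace hE ((isSmoothEnd_oneForm a W).comp (isSmoothEnd_oneForm b V)))

theorem traceWedge_add_left (a a' b : unitaryOneForms n X F E) :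
    traceWedge (a + a') b = fun x => traceWedge a b x + traceWedge a' b x := by
  funext x
  refine twoForm_ext (x := x) fun v w => ?_
  have h : ∀ u : TangentSpace (RealModel n) x, (a + a').1 x u = a.1 x u + a'.1 x u := fun _ => rfl
  refine (traceWedge_apply (a + a') b x v w).trans ?_
  rw [h, h, LinearMap.add_comp, LinearMap.add_comp, map_add, map_add]
  exact add_sub_add_comm _ _ _ _

theorem traceWedge_smul_left (r : ℝ) (a b : unitaryOneForms n X F E) :
    traceWedge (r • a) b = fun x => r • traceWedge a b x := by
  funext x
  refine twoForm_ext (x := x) fun v w => ?_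
  have h : ∀ u : TangentSpace (RealModel n) x, (r • a).1 x u = r • a.1 x u := fun _ => rfl
  refine (traceWedge_apply (r • a) b x v w).trans ?_
  rw [h, h, LinearMap.smul_comp, LinearMap.smul_comp, LinearMap.map_smul_of_tower,
    LinearMap.map_smul_of_tower, ← smul_sub]
  rfl

include R in
theorem traceWedge_swap (a b : unitaryOneForms n X F E) :
    traceWedge a b = fun x => (-1 : ℝ) • traceWedge b a x := by
  funext x
  have := R.finite x
  refine twoForm_ext (x := x) fun v w => ?_
  have h : ∀ u z : TangentSpace (RealModel n) x, LinearMap.trace ℂ (E x) (a.1 x u ∘ₗ b.1 x z) =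
      LinearMap.trace ℂ (E x) (b.1 x z ∘ₗ a.1 x u) := fun u z => LinearMap.trace_comp_comm' _ _
  refine (traceWedge_apply a b x v w).trans ?_
  refine Eq.trans ?_ (neg_one_smul ℝ (traceWedge b a x ![v, w])).symm
  rw [traceWedge_apply, h, h]
  ring

end TraceTwoForms

/-! ### The symplectic form -/

section SymplecticForm

variable {n : ℕ} {X : Type*} [TopologicalSpace X] [ChartedSpace (Fin n → ℂ) X]
  [IsManifold (ComplexModel n) ω X] [T2Space X] [CompactSpace X]
  {F : Type*} [NormedAddCommGroup F] [NormedSpace ℂ F] [FiniteDimensional ℂ F]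
  {E : X → Type*} [TopologicalSpace (TotalSpace F E)] [∀ x, NormedAddCommGroup (E x)]
  [∀ x, InnerProductSpace ℂ (E x)] [FiberBundle F E] [VectorBundle ℂ F E] [VectorBundle ℝ F E]
  [ContMDiffVectorBundle ∞ F E (RealModel n)]
  (R : Resolution n F E) (hE : IsSmoothHermitian n F E) (hn : 1 ≤ n) (g : HermitianMetric n X)

/-- The symplectic form `Ω(a, b) = -∫ tr(a ∧ b) ∧ ω^(n-1)` on the space of unitary connections. -/
def symplecticForm : unitaryOneForms n X F E →ₗ[ℝ] unitaryOneForms n X F E →ₗ[ℝ] ℝ :=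
  let Q : unitaryOneForms n X F E → unitaryOneForms n X F E → ℝ := fun a b =>
    -((1 / n : ℝ) * twoFormIntegral g (traceWedge a b))
  have hadd : ∀ a a' b, Q (a + a') b = Q a b + Q a' b := fun a a' b => by
    simp only [Q]
    rw [traceWedge_add_left, twoFormIntegral_add hn g (isSmooth_traceWedge R hE a b)
      (isSmooth_traceWedge R hE a' b)]
    rw [mul_add, neg_add]
  have hsmul : ∀ (r : ℝ) a b, Q (r • a) b = r * Q a b := fun r a b => by
    simp only [Q]
    rw [traceWedge_smul_left, twoFormIntegral_smul]
    ring
  have hswap : ∀ a b, Q a b = -Q b a := fun a b => by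
    simp only [Q]
    rw [traceWedge_swap R, twoFormIntegral_smul]
    ring
  LinearMap.mk₂ ℝ Q hadd hsmul
    (fun a b b' => by rw [hswap, hadd, hswap a b, hswap a b']; ring)
    (fun r a b => by rw [hswap, hsmul, hswap a b, smul_eq_mul]; ring)

theorem symplecticForm_apply (a b : unitaryOneForms n X F E) : symplecticForm R hE hn g a b =
    -((1 / n : ℝ) * twoFormIntegral g (traceWedge a b)) := rfl

theorem symplecticForm_eq_integral (a b : unitaryOneForms n X F E) :
    (symplecticForm R hE hn g a b : ℂ) = symplecticIntegral hn g a b := by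
  unfold symplecticIntegral
  rw [symplecticForm_apply, formIntegral_wedge_kahlerForm_pow hn g (traceWedge_im R a b),
    Complex.ofReal_neg]

/-- The one-form `a ∘ J`. -/
def compComplexStructure (a : unitaryOneForms n X F E) : unitaryOneForms n X F E :=
  ⟨fun x => a.1 x ∘ₗ complexStructure x, fun x _ => a.2.1 x _,
    fun V s => a.2.2 ⟨_, contMDiff_complexStructure V⟩ s⟩

/-- The positive semidefinite form `-Re tr(a(v) a(w))` on the tangent space. -/
def tracePairing (a : unitaryOneForms n X F E) (x : X) :
    TangentSpace (RealModel n) x →ₗ[ℝ] TangentSpace (RealModel n) x →ₗ[ℝ] ℝ :=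
  LinearMap.mk₂ ℝ (fun v w => -(LinearMap.trace ℂ (E x) (a.1 x v ∘ₗ a.1 x w)).re)
    (fun v v' w => by rw [map_add, LinearMap.add_comp, map_add, Complex.add_re, neg_add])
    (fun c v w => by
      rw [map_smul, LinearMap.smul_comp, LinearMap.map_smul_of_tower, Complex.smul_re, smul_neg])
    (fun v w w' => by rw [map_add, LinearMap.comp_add, map_add, Complex.add_re, neg_add])
    (fun c v w => by
      rw [map_smul, LinearMap.comp_smul, LinearMap.map_smul_of_tower, Complex.smul_re, smul_neg])

/-- `Ω` is symplectic: `Ω(a, a ∘ J)` is, up to a nonzero factor, the squared norm of `a`. -/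
theorem isSymplecticForm_symplecticForm : IsSymplecticForm (symplecticForm R hE hn g) where
  alternating a := by
    have h : twoFormIntegral g (traceWedge a a) = -1 * twoFormIntegral g (traceWedge a a) := by
      conv_lhs => rw [traceWedge_swap R]
      exact twoFormIntegral_smul g (-1) _
    rw [symplecticForm_apply, show twoFormIntegral g (traceWedge a a) = 0 by linarith, mul_zero,
      neg_zero]
  nondegenerate a ha := by
    -- the contraction of `tr(a ∧ (a ∘ J))` is nonnegative, and zero only where `a` vanishes
    set b := compComplexStructure a with hb
    let C : ∀ x : X, (Fin n → ℂ) →ₗ[ℝ] (Fin n → ℂ) →ₗ[ℝ] ℝ := fun x => tracePairing a x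
    have hC : ∀ x v w, C x v w = -(LinearMap.trace ℂ (E x) (a.1 x v ∘ₗ a.1 x w)).re :=
      fun _ _ _ => rfl
    have key := fun x => contraction_nonneg (metricBilin_symm g x) (metricBilin_pos g x)
      (kahlerMatrix_apply g x) (C x) (fun v w => by
        have := R.finite x
        rw [hC, hC, LinearMap.trace_comp_comm'])
      (fun v => by
        have := R.finite x
        rw [hC, (a.2.1 x v).re_trace_comp_self]
        exact sum_nonneg fun i _ => by positivity)
      (Ψ := Matrix.of fun i j => (traceWedge a b x ![realFrame n i, realFrame n j]).re)
      (fun i j => by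
        rw [hC, hC]
        refine (Complex.sub_re _ _).trans ?_
        rw [neg_neg, sub_eq_add_neg]
        rfl)
    have h0 : twoFormIntegral g (traceWedge a b) = 0 := by
      have h := ha b
      rw [symplecticForm_apply, neg_eq_zero] at h
      have hn0 : (1 / n : ℝ) ≠ 0 := one_div_ne_zero (by exact_mod_cast (by omega : n ≠ 0))
      exact (mul_eq_zero.1 h).resolve_left hn0
    have h1 : ∀ x, (contractForm g x (traceWedge a b x)).re = 0 :=
      eq_zero_of_volIntegral_eq_zero g
        (continuous_re_contractForm hn g (isSmooth_traceWedge R hE a b)) (fun x => by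
          rw [contractForm_re]
          exact mul_nonneg (by norm_num) (key x).1) h0
    refine Subtype.ext (funext fun x => LinearMap.ext fun v => ?_)
    have := R.finite x
    have h2 := h1 x
    rw [contractForm_re] at h2
    have h3 := (key x).2 ((mul_eq_zero.1 h2).resolve_left (by norm_num))
    have h4 : C x v v = 0 := by rw [h3]; rfl
    exact (a.2.1 x v).eq_zero_of_trace (neg_eq_zero.1 h4)

theorem traceWedge_adjointOneForm (u : unitaryGaugeGroup n X F E) (a b : unitaryOneForms n X F E) :
    traceWedge (adjointOneForm u a) (adjointOneForm u b) = traceWedge a b := by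
  funext x
  refine twoForm_ext (x := x) fun v w => ?_
  have h : ∀ v w : TangentSpace (RealModel n) x,
      LinearMap.trace ℂ (E x) ((adjointOneForm u a).1 x v ∘ₗ (adjointOneForm u b).1 x w) =
        LinearMap.trace ℂ (E x) (a.1 x v ∘ₗ b.1 x w) := fun v w => by
    have h1 := LinearEquiv.conj_comp (u.1 x).toLinearEquiv (b.1 x w) (a.1 x v)
    exact (congrArg (LinearMap.trace ℂ (E x)) h1).symm.trans
      (LinearMap.trace_conj' (a.1 x v ∘ₗ b.1 x w) (u.1 x).toLinearEquiv)
  refine (traceWedge_apply _ _ x v w).trans ?_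
  rw [h, h]
  rfl

theorem isSymplecticAction_symplecticForm : IsSymplecticAction (symplecticForm R hE hn g) where
  affine u a A := UnitaryConnection.ext (by
    funext s x
    exact LinearMap.ext fun v => map_add (u.1 x) _ _)
  invariant u a b := by
    rw [symplecticForm_apply, symplecticForm_apply, traceWedge_adjointOneForm]

end SymplecticForm

/-! ### The moment map -/

section MomentMap

variable {n : ℕ} {X : Type*} [TopologicalSpace X] [ChartedSpace (Fin n → ℂ) X]
  [IsManifold (ComplexModel n) ω X] [T2Space X] [CompactSpace X]
  {F : Type*} [NormedAddCommGroup F] [NormedSpace ℂ F] [FiniteDimensional ℂ F]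
  {E : X → Type*} [TopologicalSpace (TotalSpace F E)] [∀ x, NormedAddCommGroup (E x)]
  [∀ x, InnerProductSpace ℂ (E x)] [FiberBundle F E] [VectorBundle ℂ F E] [VectorBundle ℝ F E]
  [ContMDiffVectorBundle ∞ F E (RealModel n)]
  (R : Resolution n F E) (hE : IsSmoothHermitian n F E) (hn : 1 ≤ n) (g : HermitianMetric n X)
  (lam : ℝ)

theorem traceForm_add {B : ∀ x : X, TangentSpace (RealModel n) x →ₗ[ℝ]
    TangentSpace (RealModel n) x →ₗ[ℝ] (E x →ₗ[ℂ] E x)} (hB : IsEndTwoForm (n := n) (F := F) B)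
    (ζ ζ' : gaugeLieAlgebra n X F E) :
    traceForm (ζ + ζ') B hB = fun x => traceForm ζ B hB x + traceForm ζ' B hB x := by
  funext x
  refine twoForm_ext (x := x) fun v w => ?_
  exact (congrArg (LinearMap.trace ℂ (E x)) (LinearMap.add_comp _ _ _)).trans (map_add _ _ _)

theorem traceForm_smul {B : ∀ x : X, TangentSpace (RealModel n) x →ₗ[ℝ]
    TangentSpace (RealModel n) x →ₗ[ℝ] (E x →ₗ[ℂ] E x)} (hB : IsEndTwoForm (n := n) (F := F) B)
    (r : ℝ) (ζ : gaugeLieAlgebra n X F E) :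
    traceForm (r • ζ) B hB = fun x => r • traceForm ζ B hB x := by
  funext x
  refine twoForm_ext (x := x) fun v w => ?_
  exact (congrArg (LinearMap.trace ℂ (E x)) (LinearMap.smul_comp _ _ _)).trans
    (LinearMap.map_smul_of_tower _ _ _)

/-- The function `i tr ζ`, which is real because `ζ` is skew-hermitian. -/
def imTrace (ζ : gaugeLieAlgebra n X F E) (x : X) : ℝ :=
  (Complex.I * LinearMap.trace ℂ (E x) (ζ.1 x)).re

include R hE in
theorem continuous_imTrace (ζ : gaugeLieAlgebra n X F E) : Continuous (imTrace ζ) :=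
  Complex.continuous_re.comp
    (continuous_const.mul (R.isSmooth_trace hE (isSmoothEnd_gauge ζ)).continuous)

/-- The moment map `⟨μ(A), ζ⟩ = -∫ tr(ζ (Λ_ω F_A + iλ)) ωⁿ / n`. -/
def momentMap (A : UnitaryConnection n X F E) : gaugeLieAlgebra n X F E →ₗ[ℝ] ℝ where
  toFun ζ := -((1 / n : ℝ) * (twoFormIntegral g (traceForm ζ _ (isEndTwoForm_curvature hE A)) +
    lam * volIntegral g (imTrace ζ)))
  map_add' ζ ζ' := by
    have h : imTrace (ζ + ζ') = fun x => imTrace ζ x + imTrace ζ' x := funext fun x => by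
      unfold imTrace
      rw [← Complex.add_re, ← mul_add, ← map_add]
      rfl
    rw [traceForm_add, twoFormIntegral_add hn g (isSmooth_traceForm R hE _ _)
      (isSmooth_traceForm R hE _ _), h,
      volIntegral_add g (continuous_imTrace R hE ζ) (continuous_imTrace R hE ζ')]
    ring
  map_smul' r ζ := by
    have h : imTrace (r • ζ) = fun x => r * imTrace ζ x := funext fun x => by
      unfold imTrace
      rw [← Complex.re_ofReal_mul, mul_left_comm, ← smul_eq_mul (r : ℂ), Complex.coe_smul,
        ← LinearMap.map_smul_of_tower]
      rfl
    rw [traceForm_smul, twoFormIntegral_smul, h, volIntegral_smul, RingHom.id_apply, smul_eq_mul]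
    ring

theorem momentMap_apply (A : UnitaryConnection n X F E) (ζ : gaugeLieAlgebra n X F E) :
    momentMap R hE hn g lam A ζ =
      -((1 / n : ℝ) * (twoFormIntegral g (traceForm ζ _ (isEndTwoForm_curvature hE A)) +
        lam * volIntegral g (imTrace ζ))) := rfl

theorem trace_comp_contract (ζ : gaugeLieAlgebra n X F E) (A : UnitaryConnection n X F E) (x : X) :
    LinearMap.trace ℂ (E x) (ζ.1 x ∘ₗ g.contract x (A.curvature x)) =
      contractForm g x (traceForm ζ _ (isEndTwoForm_curvature hE A) x) :=
  map_contract g x ((LinearMap.trace ℂ (E x) ∘ₗ LinearMap.mulLeft ℂ (ζ.1 x)).restrictScalars ℝ)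
    (A.curvature x)

theorem momentMap_eq_integral (A : UnitaryConnection n X F E) (ζ : gaugeLieAlgebra n X F E) :
    (momentMap R hE hn g lam A ζ : ℂ) = momentIntegral g lam A ζ := by
  set ψ := traceForm ζ _ (isEndTwoForm_curvature hE A) with hψ
  have h1 : ∀ x, LinearMap.trace ℂ (E x) (ζ.1 x ∘ₗ
      (g.contract x (A.curvature x) + (Complex.I * (lam : ℂ)) • LinearMap.id)) =
      (((contractForm g x (ψ x)).re + lam * imTrace ζ x : ℝ) : ℂ) := fun x => by
    have := R.finite x
    have h2 : contractForm g x (ψ x) = ((contractForm g x (ψ x)).re : ℂ) :=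
      Complex.ext rfl (contractForm_im g x (ψ x) (traceForm_im R ζ _ x))
    have h3 : Complex.I * LinearMap.trace ℂ (E x) (ζ.1 x) = (imTrace ζ x : ℂ) :=
      Complex.ext rfl (ζ.2.1 x).I_mul_trace_im
    rw [LinearMap.comp_add, map_add, trace_comp_contract hE g, LinearMap.comp_smul, map_smul,
      LinearMap.comp_id, smul_eq_mul, Complex.ofReal_add, ← h2, Complex.ofReal_mul, ← h3]
    ring
  unfold momentIntegral
  rw [formIntegral_eq_volIntegral g rfl _
    (fun x => (1 / n : ℝ) * ((contractForm g x (ψ x)).re + lam * imTrace ζ x)), volIntegral_smul,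
    volIntegral_add g (continuous_re_contractForm hn g (isSmooth_traceForm R hE _ _))
      (f' := fun x => lam * imTrace ζ x) (continuous_const.mul (continuous_imTrace R hE ζ)),
    volIntegral_smul, momentMap_apply,
    ← Complex.ofReal_neg]
  · rfl
  · intro x
    rw [h1]
    refine (congrArg (fun z => z * wedgePow (g.kahlerForm x) n (realFrame n)) ?_)
    push_cast
    ring

include hE in
theorem continuous_norm_section (s : SmoothSection n F E) : Continuous fun x => ‖s x‖ := by
  have h : (fun x => ‖s x‖) = fun x => Real.sqrt (inner ℂ (s x) (s x) : ℂ).re :=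
    funext fun x => norm_eq_sqrt_re_inner (𝕜 := ℂ) (s x)
  rw [h]
  exact Real.continuous_sqrt.comp (Complex.continuous_re.comp (hE s s).continuous)

/-- The two-form `⟨t, F_A s⟩`. -/
def curvatureCoeff (A : UnitaryConnection n X F E) (s t : SmoothSection n F E) : DForm n X 2 :=
  fun x => twoForm ((curvatureBilin A x).compr₂
    ((innerₛₗ ℂ (t x) ∘ₗ LinearMap.applyₗ (R := ℂ) (s x)).restrictScalars ℝ)) fun v =>
      (congrArg (fun T : E x →ₗ[ℂ] E x => (inner ℂ (t x) (T (s x)) : ℂ))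
        ((isEndTwoForm_curvature hE A).self_eq_zero x v)).trans (inner_zero_right _)

/-- Inserting the resolution of the identity twice writes `Λ_ω tr(ζ F_A)` as a combination of the
fixed functions `Λ_ω ⟨tₗ, F_A sₖ⟩` with the matrix coefficients of `ζ`. -/
theorem contractForm_traceForm_curvature (A : UnitaryConnection n X F E)
    (ζ : gaugeLieAlgebra n X F E) (x : X) :
    contractForm g x (traceForm ζ _ (isEndTwoForm_curvature hE A) x) =
      ∑ k, ∑ l, (inner ℂ (R.t k x) (ζ.1 x (R.s l x)) : ℂ) *
        contractForm g x (curvatureCoeff hE A (R.s k) (R.t l) x) := by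
  have h1 : ∀ v w : TangentSpace (RealModel n) x,
      traceForm ζ _ (isEndTwoForm_curvature hE A) x ![v, w] =
      ∑ k, ∑ l, (inner ℂ (R.t k x) (ζ.1 x (R.s l x)) : ℂ) *
        curvatureCoeff hE A (R.s k) (R.t l) x ![v, w] := fun v w => by
    refine (R.trace_eq x _).trans (sum_congr rfl fun k _ => ?_)
    have h2 := R.sum_eq x (A.curvature x v w (R.s k x))
    change (inner ℂ (R.t k x) (ζ.1 x (A.curvature x v w (R.s k x))) : ℂ) = _
    rw [← h2, map_sum, inner_sum]
    refine sum_congr rfl fun l _ => ?_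
    rw [map_smul, inner_smul_right, mul_comm]
    rfl
  unfold contractForm
  have h3 : (fun v w : TangentSpace (RealModel n) x =>
      traceForm ζ _ (isEndTwoForm_curvature hE A) x ![v, w]) = fun v w =>
      ∑ k, ∑ l, (inner ℂ (R.t k x) (ζ.1 x (R.s l x)) : ℂ) *
        curvatureCoeff hE A (R.s k) (R.t l) x ![v, w] := funext fun v => funext fun w => h1 v w
  refine (congrArg (g.contract x) h3).trans ((contract_sum g x univ _).trans
    (sum_congr rfl fun k _ => (contract_sum g x univ _).trans (sum_congr rfl fun l _ => ?_)))
  exact contract_const_mul g x _ _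

/-- `μ(A)` is continuous for the `C⁰`-topology: the contraction of the curvature is bounded. -/
theorem exists_momentMap_bound (A : UnitaryConnection n X F E) :
    ∃ C : ℝ, ∀ (ζ : gaugeLieAlgebra n X F E) (M : ℝ), 0 ≤ M →
      (∀ (x : X) (e : E x), ‖ζ.1 x e‖ ≤ M * ‖e‖) → |momentMap R hE hn g lam A ζ| ≤ C * M := by
  obtain ⟨C, hC⟩ := exists_volIntegral_bound (n := n) (X := X) g
  have hbdd : ∀ f : X → ℝ, Continuous f → ∃ K, ∀ x, f x ≤ K := fun f hf => by
    obtain ⟨K, hK⟩ := (isCompact_range hf).bddAbove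
    exact ⟨K, fun x => hK ⟨x, rfl⟩⟩
  obtain ⟨K₁, hK₁⟩ := hbdd (fun x => ∑ k, ∑ l, ‖R.t k x‖ * ‖R.s l x‖ *
      ‖contractForm g x (curvatureCoeff hE A (R.s k) (R.t l) x)‖)
    (continuous_finsetSum _ fun k _ => continuous_finsetSum _ fun l _ =>
      ((continuous_norm_section hE _).mul (continuous_norm_section hE _)).mul
        (continuous_contractForm hn g _ fun V W =>
          hE (R.t l) (endAct _ (isSmooth_curvature A V W) (R.s k))).norm)
  obtain ⟨K₂, hK₂⟩ := hbdd (fun x => ∑ k, ‖R.t k x‖ * ‖R.s k x‖)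
    (continuous_finsetSum _ fun k _ =>
      (continuous_norm_section hE _).mul (continuous_norm_section hE _))
  refine ⟨(1 / n : ℝ) * (C * K₁ + |lam| * (C * K₂)), fun ζ M hM hζ => ?_⟩
  have hin : ∀ x k l, ‖(inner ℂ (R.t k x) (ζ.1 x (R.s l x)) : ℂ)‖ ≤ M * (‖R.t k x‖ * ‖R.s l x‖) :=
    fun x k l => (norm_inner_le_norm _ _).trans <| by
      rw [mul_left_comm]
      exact mul_le_mul_of_nonneg_left (hζ x _) (norm_nonneg _)
  have h1 : |twoFormIntegral g (traceForm ζ _ (isEndTwoForm_curvature hE A))| ≤ C * (M * K₁) := by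
    refine hC _ _ (continuous_re_contractForm hn g (isSmooth_traceForm R hE _ _)) fun x => ?_
    refine (Complex.abs_re_le_norm _).trans ?_
    rw [contractForm_traceForm_curvature R hE]
    refine ((norm_sum_le _ _).trans (sum_le_sum fun k _ => norm_sum_le _ _)).trans ?_
    refine le_trans ?_ (mul_le_mul_of_nonneg_left (hK₁ x) hM)
    simp only [mul_sum]
    refine sum_le_sum fun k _ => sum_le_sum fun l _ => ?_
    rw [norm_mul, ← mul_assoc M]
    exact mul_le_mul_of_nonneg_right (hin x k l) (norm_nonneg _)
  have h2 : |volIntegral g (imTrace ζ)| ≤ C * (M * K₂) := by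
    refine hC _ _ (continuous_imTrace R hE ζ) fun x => ?_
    refine (Complex.abs_re_le_norm _).trans ?_
    rw [norm_mul, Complex.norm_I, one_mul, R.trace_eq]
    refine (norm_sum_le _ _).trans (le_trans ?_ (mul_le_mul_of_nonneg_left (hK₂ x) hM))
    rw [mul_sum]
    exact sum_le_sum fun k _ => hin x k k
  rw [momentMap_apply, abs_neg, abs_mul, abs_of_nonneg (by positivity : (0 : ℝ) ≤ 1 / n), mul_assoc]
  refine mul_le_mul_of_nonneg_left ((abs_add_le _ _).trans ?_) (by positivity)
  rw [abs_mul]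
  nlinarith [mul_le_mul_of_nonneg_left h2 (abs_nonneg lam)]

/-- `μ` is equivariant since `F_(u · A) = u F_A u⁻¹` and the trace is invariant. -/
theorem momentMap_equivariant (u : unitaryGaugeGroup n X F E) (A : UnitaryConnection n X F E)
    (ζ : gaugeLieAlgebra n X F E) :
    momentMap R hE hn g lam (u • A) (adjoint u ζ) = momentMap R hE hn g lam A ζ := by
  have h1 : traceForm (adjoint u ζ) _ (isEndTwoForm_curvature hE (u • A)) =
      traceForm ζ _ (isEndTwoForm_curvature hE A) := by
    funext x
    refine twoForm_ext (x := x) fun v w => ?_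
    have h2 := LinearEquiv.conj_comp (u.1 x).toLinearEquiv (A.curvature x v w) (ζ.1 x)
    rw [← curvature_smul u A x v w] at h2
    exact (congrArg (LinearMap.trace ℂ (E x)) h2).symm.trans
      (LinearMap.trace_conj' (ζ.1 x ∘ₗ A.curvature x v w) (u.1 x).toLinearEquiv)
  have h3 : imTrace (adjoint u ζ) = imTrace ζ := funext fun x =>
    congrArg (fun z => (Complex.I * z).re)
      (LinearMap.trace_conj' (ζ.1 x) (u.1 x).toLinearEquiv)
  rw [momentMap_apply, momentMap_apply, h1, h3]

/-- The product of a smooth real function and an element of the gauge Lie algebra. -/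
def gaugeFunctionSmul (f : X → ℝ) (hf : ContMDiff (RealModel n) 𝓘(ℝ, ℝ) ∞ f)
    (ζ : gaugeLieAlgebra n X F E) : gaugeLieAlgebra n X F E :=
  ⟨fun x => f x • ζ.1 x, fun x => (ζ.2.1 x).real_smul (f x), fun s =>
    (functionSmul f hf (endAct ζ.1 (isSmoothEnd_gauge ζ) s)).contMDiff⟩

/-- The two-form `tr(d_A ζ ∧ a) + tr(ζ d_A a)`, the exterior derivative of `tr(ζ a)`. -/
def exactForm (A : UnitaryConnection n X F E) (a : unitaryOneForms n X F E)
    (ζ : gaugeLieAlgebra n X F E) : DForm n X 2 :=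
  fun x => traceWedge (covGauge R hE A ζ) a x + traceForm ζ _ (isEndTwoForm_covOneForm hE A a) x

theorem isSmooth_exactForm (A : UnitaryConnection n X F E) (a : unitaryOneForms n X F E)
    (ζ : gaugeLieAlgebra n X F E) : IsSmoothTwoForm (exactForm R hE A a ζ) := fun V W =>
  (isSmooth_traceWedge R hE _ _ V W).add (isSmooth_traceForm R hE ζ _ V W)

theorem covGauge_add (A : UnitaryConnection n X F E) (ζ ζ' : gaugeLieAlgebra n X F E) :
    covGauge R hE A (ζ + ζ') = covGauge R hE A ζ + covGauge R hE A ζ' := by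
  refine Subtype.ext (funext fun x => LinearMap.ext fun v => LinearMap.ext fun e => ?_)
  obtain ⟨s, rfl⟩ := exists_smoothSection_eq (n := n) (F := F) x e
  have h1 : endAct (ζ + ζ').1 (isSmoothEnd_gauge (ζ + ζ')) s =
      endAct ζ.1 (isSmoothEnd_gauge ζ) s + endAct ζ'.1 (isSmoothEnd_gauge ζ') s := rfl
  have h2 : ∀ e : E x, (ζ + ζ').1 x e = ζ.1 x e + ζ'.1 x e := fun _ => rfl
  refine (covGauge_apply R hE A (ζ + ζ') s x v).trans ?_
  rw [h1, A.add, h2]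
  refine Eq.trans ?_ (congrArg₂ (· + ·) (covGauge_apply R hE A ζ s x v)
    (covGauge_apply R hE A ζ' s x v)).symm
  exact add_sub_add_comm _ _ _ _

theorem exactForm_add (A : UnitaryConnection n X F E) (a : unitaryOneForms n X F E)
    (ζ ζ' : gaugeLieAlgebra n X F E) : exactForm R hE A a (ζ + ζ') =
      fun x => exactForm R hE A a ζ x + exactForm R hE A a ζ' x := by
  funext x
  unfold exactForm
  rw [covGauge_add, traceWedge_add_left, traceForm_add]
  exact add_add_add_comm _ _ _ _

theorem exactForm_apply (A : UnitaryConnection n X F E) (a : unitaryOneForms n X F E)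
    (ζ : gaugeLieAlgebra n X F E) (V W : SmoothVectorField n X) (x : X) :
    exactForm R hE A a ζ x ![V x, W x] =
      mvfderiv (RealModel n) (fun y => LinearMap.trace ℂ (E y) (ζ.1 y ∘ₗ a.1 y (W y))) x (V x) -
      mvfderiv (RealModel n) (fun y => LinearMap.trace ℂ (E y) (ζ.1 y ∘ₗ a.1 y (V y))) x (W x) -
      LinearMap.trace ℂ (E x) (ζ.1 x ∘ₗ a.1 x (VectorField.mlieBracket (RealModel n) V W x)) :=
  traceWedge_covGauge_add R hE A ζ a V W x

include hn in
/-- Stokes' theorem for `tr(ζ a)` with `ζ` supported in a coordinate domain. -/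
theorem twoFormIntegral_exactForm_of_support (hg : g.IsBalanced) (A : UnitaryConnection n X F E)
    (a : unitaryOneForms n X F E) (ζ : gaugeLieAlgebra n X F E) (c : X) {K : Set X}
    (hK : IsClosed K) (hKc : K ⊆ (chartAt (Fin n → ℂ) c).source) (hζ : ∀ x ∉ K, ζ.1 x = 0) :
    twoFormIntegral g (exactForm R hE A a ζ) = 0 := by
  set ψ := exactForm R hE A a ζ with hψdef
  have hn0 : (1 / n : ℝ) ≠ 0 := one_div_ne_zero (by exact_mod_cast (by omega : n ≠ 0))
  refine (mul_eq_zero.1 ?_).resolve_left hn0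
  unfold twoFormIntegral
  rw [← volIntegral_smul]
  have him : ∀ x v w, (ψ x ![v, w]).im = 0 := fun x v w => by
    refine (Complex.add_im _ _).trans ?_
    exact (congrArg₂ (· + ·) (traceWedge_im R _ a x v w) (traceForm_im R ζ _ x v w)).trans
      (add_zero _)
  refine volIntegral_eq_zero_of_exact hn g hg
    (fun x => (LinearMap.trace ℂ (E x) ∘ₗ LinearMap.mulLeft ℂ (ζ.1 x)).restrictScalars ℝ ∘ₗ a.1 x)
    ψ (fun V => R.isSmooth_trace hE ((isSmoothEnd_gauge ζ).comp (isSmoothEnd_oneForm a V)))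
    (exactForm_apply R hE A a ζ)
    (continuous_const.mul (continuous_re_contractForm hn g (isSmooth_exactForm R hE A a ζ)))
    (fun x => ?_) c hK hKc (fun x hx => ?_) fun x hx => ?_
  · have h := wedge_kahlerForm_pow hn g x (ψ x)
    rw [show contractForm g x (ψ x) = ((contractForm g x (ψ x)).re : ℂ) from
      Complex.ext rfl (contractForm_im g x (ψ x) (him x))] at h
    rw [h]
    push_cast
    ring
  · refine LinearMap.ext fun v => ?_
    change LinearMap.trace ℂ (E x) (ζ.1 x ∘ₗ a.1 x v) = 0
    rw [hζ x hx, LinearMap.zero_comp, map_zero]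
  · have h0 : ∀ U : SmoothVectorField n X, mvfderiv (RealModel n)
        (fun y => LinearMap.trace ℂ (E y) (ζ.1 y ∘ₗ a.1 y (U y))) x = 0 := fun U => by
      have h1 : (fun y => LinearMap.trace ℂ (E y) (ζ.1 y ∘ₗ a.1 y (U y))) =ᶠ[nhds x]
          fun _ => 0 := by
        filter_upwards [hK.isOpen_compl.mem_nhds hx] with y hy
        rw [hζ y hy, LinearMap.zero_comp, map_zero]
      exact (Filter.EventuallyEq.mfderiv_eq h1).trans mfderiv_const
    have h2 : ψ x = 0 := twoForm_ext (x := x) fun v w => by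
      obtain ⟨V, rfl⟩ := exists_smoothVectorField_eq x v
      obtain ⟨W, rfl⟩ := exists_smoothVectorField_eq x w
      refine (exactForm_apply R hE A a ζ V W x).trans ?_
      rw [h0, h0, hζ x hx, LinearMap.zero_comp, map_zero]
      change (0 : ℂ) - 0 - 0 = 0
      simp
    rw [h2]
    have h3 := contractForm_add g x (0 : (Fin n → ℂ) [⋀^Fin 2]→L[ℝ] ℂ) 0
    rw [add_zero, left_eq_add] at h3
    rw [h3, Complex.zero_re, mul_zero]

include hn in
/-- `∫ d tr(ζ a) ∧ ω^(n-1) = 0` on a balanced manifold, by localizing `ζ` with a partition of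
unity. -/
theorem twoFormIntegral_exactForm (hg : g.IsBalanced) (A : UnitaryConnection n X F E)
    (a : unitaryOneForms n X F E) (ζ : gaugeLieAlgebra n X F E) :
    twoFormIntegral g (exactForm R hE A a ζ) = 0 := by
  obtain ⟨S, hS⟩ := exists_chartPartition_finset (n := n) (X := X)
  let P : gaugeLieAlgebra n X F E →+ ℝ :=
    AddMonoidHom.mk' (fun ζ => twoFormIntegral g (exactForm R hE A a ζ)) fun ζ ζ' => by
      rw [exactForm_add, twoFormIntegral_add hn g (isSmooth_exactForm R hE A a ζ)
        (isSmooth_exactForm R hE A a ζ')]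
  have hζ : ζ = ∑ c ∈ S, gaugeFunctionSmul (chartPartition n X c)
      (chartPartition n X c).contMDiff ζ := by
    refine Subtype.ext (funext fun x => ?_)
    rw [AddSubmonoidClass.coe_finsetSum, Finset.sum_apply]
    change ζ.1 x = ∑ c ∈ S, chartPartition n X c x • ζ.1 x
    have h1 := (chartPartition n X).sum_eq_one (Set.mem_univ x)
    rw [finsum_eq_sum_of_support_subset (s := S) _ fun c hc => by
      by_contra h
      exact hc (hS c h x)] at h1
    rw [← sum_smul, h1, one_smul]
  change P ζ = 0
  rw [hζ, map_sum]
  refine sum_eq_zero fun c _ => ?_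
  refine twoFormIntegral_exactForm_of_support R hE hn g hg A a _ c (isClosed_tsupport _)
    (tsupport_chartPartition c) fun x hx => ?_
  change chartPartition n X c x • ζ.1 x = 0
  rw [image_eq_zero_of_notMem_tsupport hx, zero_smul]

/-- `F_(A + ta) = F_A + t d_A a + t² a ∧ a` makes `⟨μ(A + ta), ζ⟩` a quadratic polynomial in `t`,
with linear coefficient `-∫ tr(ζ d_A a) ∧ ω^(n-1)`. -/
theorem hasDerivAt_momentMap (A : UnitaryConnection n X F E) (a : unitaryOneForms n X F E)
    (ζ : gaugeLieAlgebra n X F E) :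
    HasDerivAt (fun t : ℝ => momentMap R hE hn g lam ((t • a) +ᵥ A) ζ)
      (-((1 / n : ℝ) * twoFormIntegral g (traceForm ζ _ (isEndTwoForm_covOneForm hE A a)))) 0 := by
  set c₀ := twoFormIntegral g (traceForm ζ _ (isEndTwoForm_curvature hE A))
  set c₁ := twoFormIntegral g (traceForm ζ _ (isEndTwoForm_covOneForm hE A a))
  set c₂ := twoFormIntegral g (traceForm ζ _ (isEndTwoForm_oneFormSq a))
  have h1 : ∀ t : ℝ, twoFormIntegral g (traceForm ζ _ (isEndTwoForm_curvature hE ((t • a) +ᵥ A))) =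
      c₀ + t * c₁ + t ^ 2 * c₂ := fun t => by
    have h2 : traceForm ζ _ (isEndTwoForm_curvature hE ((t • a) +ᵥ A)) = fun x =>
        (traceForm ζ _ (isEndTwoForm_curvature hE A) x +
          t • traceForm ζ _ (isEndTwoForm_covOneForm hE A a) x) +
        t ^ 2 • traceForm ζ _ (isEndTwoForm_oneFormSq a) x := by
      funext x
      refine twoForm_ext (x := x) fun v w => ?_
      have h3 := congrArg (fun T => LinearMap.trace ℂ (E x) (ζ.1 x ∘ₗ T))
        (curvature_smul_vadd R hE A a t x v w)
      simp only [LinearMap.comp_add, LinearMap.comp_smul, map_add,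
        LinearMap.map_smul_of_tower] at h3
      exact h3
    have hs : ∀ (r : ℝ) {ψ : DForm n X 2}, IsSmoothTwoForm ψ → IsSmoothTwoForm fun x => r • ψ x :=
      fun r ψ hψ V W => by
        have h := (IsSmoothFun.const (r : ℂ)).mul (hψ V W)
        simp only [← smul_eq_mul, Complex.coe_smul] at h
        exact h
    have s0 := isSmooth_traceForm R hE ζ (isEndTwoForm_curvature hE A)
    have s1 := hs t (isSmooth_traceForm R hE ζ (isEndTwoForm_covOneForm hE A a))
    have s2 := hs (t ^ 2) (isSmooth_traceForm R hE ζ (isEndTwoForm_oneFormSq a))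
    rw [h2, twoFormIntegral_add hn g (fun V W => (s0 V W).add (s1 V W)) s2,
      twoFormIntegral_add hn g s0 s1, twoFormIntegral_smul, twoFormIntegral_smul]
  simp only [momentMap_apply, h1]
  have h4 : HasDerivAt (fun t : ℝ => c₀ + t * c₁ + t ^ 2 * c₂ + lam * volIntegral g (imTrace ζ))
      c₁ 0 := by
    have h5 := ((((hasDerivAt_id (0 : ℝ)).mul_const c₁).const_add c₀).add
      (((hasDerivAt_id (0 : ℝ)).pow 2).mul_const c₂)).add_const (lam * volIntegral g (imTrace ζ))
    simpa using h5
  exact (h4.const_mul _).neg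

/-- The derivative `-∫ tr(ζ d_A a) ∧ ω^(n-1)` of the moment map equals `Ω(-d_A ζ, a)`, because
`tr(d_A ζ ∧ a) + tr(ζ d_A a)` is exact. -/
theorem isEquivariantMomentMap_momentMap (hg : g.IsBalanced) :
    IsEquivariantMomentMap (symplecticForm R hE hn g) (momentMap R hE hn g lam) where
  continuous := exists_momentMap_bound R hE hn g lam
  exists_subgroup ζ := ⟨_, isOneParameterSubgroup_gaugeExp R hE ζ⟩
  moment ζ γ hγ A := ⟨-covGauge R hE A ζ, isOrbitVelocity R hE A hγ, fun a => by
    have h := hasDerivAt_momentMap R hE hn g lam A a ζ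
    have h1 := twoFormIntegral_exactForm R hE hn g hg A a ζ
    unfold exactForm at h1
    rw [twoFormIntegral_add hn g (isSmooth_traceWedge R hE _ _) (isSmooth_traceForm R hE ζ _)] at h1
    convert h using 1
    refine (LinearMap.map_neg₂ (symplecticForm R hE hn g) (covGauge R hE A ζ) a).trans ?_
    rw [symplecticForm_apply, eq_neg_of_add_eq_zero_left h1]
    ring⟩
  equivariant := momentMap_equivariant R hE hn g lam

end MomentMap

end

end GaugeTheory

theorem mainTheorem2 {n : ℕ} (hn : 1 ≤ n)
    {X : Type*} [TopologicalSpace X] [T2Space X] [CompactSpace X]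
    [ChartedSpace (Fin n → ℂ) X] [IsManifold (ComplexModel n) ω X]
    {F : Type*} [NormedAddCommGroup F] [NormedSpace ℂ F] [FiniteDimensional ℂ F]
    {E : X → Type*} [TopologicalSpace (TotalSpace F E)]
    [∀ x, NormedAddCommGroup (E x)] [∀ x, InnerProductSpace ℂ (E x)]
    [FiberBundle F E] [VectorBundle ℂ F E] [VectorBundle ℝ F E]
    [ContMDiffVectorBundle ∞ F E (RealModel n)]
    (hE : IsSmoothHermitian n F E)
    (g : HermitianMetric n X) (hg : g.IsBalanced) (lam : ℝ) :
    ∃ (Ω : unitaryOneForms n X F E →ₗ[ℝ] unitaryOneForms n X F E →ₗ[ℝ] ℝ)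
      (μ : UnitaryConnection n X F E → (gaugeLieAlgebra n X F E →ₗ[ℝ] ℝ)),
      (∀ a b, (Ω a b : ℂ) = symplecticIntegral hn g a b) ∧
      (∀ A ζ, (μ A ζ : ℂ) = momentIntegral g lam A ζ) ∧
      IsSymplecticForm Ω ∧ IsSymplecticAction Ω ∧ IsEquivariantMomentMap Ω μ := by
  obtain ⟨R⟩ := nonempty_resolution hE
  exact ⟨symplecticForm R hE hn g, momentMap R hE hn g lam, symplecticForm_eq_integral R hE hn g,
    momentMap_eq_integral R hE hn g lam, isSymplecticForm_symplecticForm R hE hn g,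
    isSymplecticAction_symplecticForm R hE hn g,
    isEquivariantMomentMap_momentMap R hE hn g lam hg⟩
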